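/- **Setting.** Let $M$ be a smooth $n$-dimensional manifold, $E=\mathbb{R}\times M$ the trivial bundle over $\mathbb{R}$ and, for $k\ge 1$, $J^k(E)$ the manifold of $k$-jets of its local sections $\gamma_t=(t,c(t))$, defined and smooth on open intervals $I\subset\mathbb{R}$. A chart $(y^i)$ of $M$ gives the adapted coordinates $(t,y^i_{(a)})_{0\le a\le k}$ of $J^k(E)$, where $y^i_{(a)}(j^k_t\gamma)=\frac{d^a\gamma^i}{dt^a}(t)$ and $y^i_{(0)}=y^i$; put $\omega^i_{(0)}=dy^i-y^i_{(1)}dt$ and $\frac{d}{dt}=\frac{\partial}{\partial t}+\sum_{a<k}y^j_{(a+1)}\frac{\partial}{\partial y^j_{(a)}}$. Write $\gamma^{(k)}(t)=j^k_t\gamma$ for the lift of $\gamma$ and $\dot\gamma^{(k)}_t$ for its tangent vector. The holonomic distribution $\mathcal D_u\subset T_uJ^k(E)$ is the span of the vectors $\dot\gamma^{(k)}_t$ with $j^k_t\gamma=u$. All forms are smooth. A $p$-form $\lambda$, $p\ge1$, is *holonomic* if $\imath_v\lambda=0$ for all $v\in\mathcal D$; a holonomic $0$-form is zero. Two $p$-forms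 $\beta,\beta'$ on an open set of $J^k(E)$ are *variationally equivalent* if $\beta-\beta'=\lambda+d\mu$ with a holonomic $p$-form $\lambda$ and a holonomic $(p-1)$-form $\mu$ on that set; $[\beta]$ is the class of $\beta$. A form on an open subset of $J^k(E)$ is *of order $r$* ($r\le k$) if it is the pull-back of a form on an open subset of $J^r(E)$. A *source form* is a $2$-form $\sigma$ on $J^k(E)$ with $\imath_V\sigma=0$ for every vector $V$ tangent to the fibres of $J^k(E)\to E$; in adapted coordinates $\sigma=\sigma_i\,\omega^i_{(0)}\wedge dt+\sum_{j<l}\sigma_{jl}\,\omega^j_{(0)}\wedge\omega^l_{(0)}$, where $\sigma_i=\sigma\big(\frac{\partial}{\partial y^i},\frac{d}{dt}\big)$. For a $1$-form $\alpha$ on $J^k(E)$, a section $\gamma:I\to E$ *satisfies the variational principle of $\mathcal I_{[\alpha]}$ with boundary order $m$* if, for every $[a,b]\subset I$ and every smooth map $F:[a,b]\times[-\varepsilon,\varepsilon]\to E$ such that each $\gamma_s=F(\cdot,s)$ extends to a smooth section over an open interval containing $[a,b]$, $\gamma_0=\gamma|_{[a,b]}$, and the $m$-jets of $\gamma_s$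 and of $\gamma$ agree at $a$ and at $b$ for all $s$, the derivative $\frac{d}{ds}\big|_{s=0}\int_{\gamma_s^{(k)}([a,b])}\alpha$ exists and is $0$. **Theorem.** Let $k\ge1$ and $r\le k/2$, and let $\alpha$ be a $1$-form on $J^k(E)$ which is locally variationally equivalent to forms $L\,dt$ of order $r$: every point of $J^k(E)$ has an open neighbourhood $U$ with a smooth $L:U\to\mathbb{R}$ such that $L\,dt$ is of order $r$ on $U$ and $\alpha|_U$ is variationally equivalent to $L\,dt$. Let $m$ be an integer such that $m\ge r$ or $\alpha$ is of order $m$, let $\sigma$ be a source form in $[d\alpha]$, and let $\gamma:I\to E$ be a section. Then $\gamma$ satisfies the variational principle of $\mathcal I_{[\alpha]}$ with boundary order $m$ if and only if $$\imath_{\dot\gamma^{(k)}_t}\sigma=0\qquad\text{for all }t\in I .$$ Moreover, for each $t\in I$ and in all adapted coordinates around $\gamma^{(k)}(t)$, the equation $\imath_{\dot\gamma^{(k)}_t}\sigma=0$ is equivalent to $\sigma_i(\gamma^{(k)}(t))=0$, $1\le i\le n$. These are the Euler–Lagrange equations: if $\alpha$ is variationally equivalent to $L\,dt$, of order $r$,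 on an open set $U\ni\gamma^{(k)}(t)$, then $$\sigma_i(\gamma^{(k)}(t))=\sum_{a=0}^{k}(-1)^a\frac{d^a}{dt^a}\left(\frac{\partial L}{\partial y^i_{(a)}}\big(\gamma^{(k)}(t)\big)\right),\qquad 1\le i\le n,$$ where the terms with $a>r$ vanish. -/

import Mathlib

open scoped Manifold ContDiff Topology

noncomputable section

set_option linter.unusedSectionVars false

namespace JetVar

/-! ### Local sections of `E = ℝ × M → ℝ` and their jets -/

/-- The model space of the configuration manifold. -/
abbrev Coord (n : ℕ) : Type := EuclideanSpace ℝ (Fin n)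

/-- A smooth local section `t ↦ (t, curve t)` of the trivial bundle `ℝ × M → ℝ`, over an open
interval `dom`. Only the values of `curve` on `dom` matter. -/
structure LocalSection (n : ℕ) (M : Type*) [TopologicalSpace M] [ChartedSpace (Coord n) M] where
  dom : Set ℝ
  isOpen_dom : IsOpen dom
  ordConnected_dom : dom.OrdConnected
  curve : ℝ → M
  smooth : ContMDiffOn 𝓘(ℝ, ℝ) (𝓡 n) ∞ curve dom

/-- A local section together with an instant of its domain. -/
structure PointedSection (n : ℕ) (M : Type*) [TopologicalSpace M] [ChartedSpace (Coord n) M] where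
  sec : LocalSection n M
  time : ℝ
  mem : time ∈ sec.dom

section

variable {n : ℕ} {M : Type*} [TopologicalSpace M] [ChartedSpace (Coord n) M]

/-- The point of `M` through which the section passes at the given instant. -/
def PointedSection.point (p : PointedSection n M) : M := p.sec.curve p.time

/-- The `a`-th time derivative, at the given instant, of the coordinate expression of the section
in the chart `φ` of `M`. -/
def PointedSection.coordDeriv (φ : OpenPartialHomeomorph M (Coord n)) (p : PointedSection n M)
    (a : ℕ) : Coord n :=
  iteratedDeriv a (fun s => φ (p.sec.curve s)) p.time

variable (n M) in
/-- Two sections have the same `k`-jet at an instant: same instant, same point, and the same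
derivatives up to order `k` in the preferred chart at that point (hence in every chart). -/
def jetSetoid (k : ℕ) : Setoid (PointedSection n M) where
  r p q := p.time = q.time ∧ p.point = q.point ∧
    ∀ a ≤ k, p.coordDeriv (chartAt (Coord n) p.point) a = q.coordDeriv (chartAt (Coord n) p.point) a
  iseqv :=
    { refl := fun _ => ⟨rfl, rfl, fun _ _ => rfl⟩
      symm := fun {p q} h => ⟨h.1.symm, h.2.1.symm, fun a ha => by
        rw [← h.2.1]; exact (h.2.2 a ha).symm⟩
      trans := fun {p q r} h h' => ⟨h.1.trans h'.1, h.2.1.trans h'.2.1, fun a ha => by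
        rw [h.2.2 a ha]
        have := h'.2.2 a ha
        rwa [← h.2.1] at this⟩ }

variable (n M) in
/-- The space `J^k(E)` of `k`-jets of local sections of `E = ℝ × M → ℝ`. -/
def JetSpace (k : ℕ) : Type _ := Quotient (jetSetoid n M k)

/-- The jet `j^k_t(γ)`. -/
def jetMk (k : ℕ) (p : PointedSection n M) : JetSpace n M k := Quotient.mk (jetSetoid n M k) p

namespace JetSpace

variable {k : ℕ}

/-- The projection `π^k_{-1} : J^k(E) → ℝ`. -/
def time (u : JetSpace n M k) : ℝ := Quotient.lift (s := jetSetoid n M k) PointedSection.time (fun _ _ h => h.1) u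

/-- The point of `M` under a jet. -/
def point (u : JetSpace n M k) : M := Quotient.lift (s := jetSetoid n M k) PointedSection.point (fun _ _ h => h.2.1) u

/-- The projection `π^k_0 : J^k(E) → E = ℝ × M`. -/
def toE (u : JetSpace n M k) : ℝ × M := (u.time, u.point)

/-- The projection `π^k_l : J^k(E) → J^l(E)`. -/
def proj {l : ℕ} (h : l ≤ k) (u : JetSpace n M k) : JetSpace n M l :=
  Quotient.lift (s := jetSetoid n M k) (jetMk l)
    (fun _ _ hpq => Quotient.sound ⟨hpq.1, hpq.2.1, fun a ha => hpq.2.2 a (ha.trans h)⟩) u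

@[simp] lemma time_mk (p : PointedSection n M) : (jetMk k p).time = p.time := rfl

@[simp] lemma point_mk (p : PointedSection n M) : (jetMk k p).point = p.point := rfl

end JetSpace

/-- The model space of `J^k(E)`, with coordinates `(t, y_{(0)}, …, y_{(k)})`. -/
abbrev JetModel (n k : ℕ) : Type := ℝ × (Fin (k + 1) → Coord n)

/-- The adapted coordinates `(t, y^i_{(a)})` on `J^k(E)` determined by a chart `φ` of `M`; they are
meaningful on jets whose point is in the domain of `φ`. -/
def adaptedCoord (k : ℕ) (φ : OpenPartialHomeomorph M (Coord n)) (u : JetSpace n M k) :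
    JetModel n k :=
  (u.time, fun a => (Quotient.out u).coordDeriv φ a)

/-! ### Change of adapted coordinates -/

/-- The change of the coordinates `y_{(a)}` under a change of chart `τ` of `M`, by the formula of
Faà di Bruno. -/
def jetChange (k : ℕ) (τ : Coord n → Coord n) (y : Fin (k + 1) → Coord n) :
    Fin (k + 1) → Coord n :=
  fun a => ∑ c : OrderedFinpartition (a : ℕ), iteratedFDeriv ℝ c.length τ (y 0) fun j =>
    y ⟨c.partSize j, lt_of_le_of_lt (c.partSize_le j) a.2⟩

lemma PointedSection.contDiffAt (p : PointedSection n M) [IsManifold (𝓡 n) ∞ M]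
    {φ : OpenPartialHomeomorph M (Coord n)}
    (hφ : φ ∈ IsManifold.maximalAtlas (𝓡 n) ∞ M) (hp : p.point ∈ φ.source) :
    ContDiffAt ℝ ∞ (fun s => φ (p.sec.curve s)) p.time := by
  have h1 : ContMDiffAt 𝓘(ℝ, ℝ) (𝓡 n) ∞ p.sec.curve p.time :=
    p.sec.smooth.contMDiffAt (p.sec.isOpen_dom.mem_nhds p.mem)
  have h2 : ContMDiffAt (𝓡 n) (𝓡 n) ∞ φ (p.sec.curve p.time) :=
    contMDiffAt_of_mem_maximalAtlas hφ hp
  exact (h2.comp p.time h1).contDiffAt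

lemma contDiffOn_transition [IsManifold (𝓡 n) ∞ M] {φ ψ : OpenPartialHomeomorph M (Coord n)}
    (hφ : φ ∈ IsManifold.maximalAtlas (𝓡 n) ∞ M) (hψ : ψ ∈ IsManifold.maximalAtlas (𝓡 n) ∞ M) :
    ContDiffOn ℝ ∞ (φ ∘ ψ.symm) (ψ.symm.trans φ).source := by
  have h1 := contMDiffOn_of_mem_maximalAtlas hφ
  have h2 := contMDiffOn_symm_of_mem_maximalAtlas hψ
  have h2' : ContMDiffOn (𝓡 n) (𝓡 n) ∞ ψ.symm (ψ.symm.trans φ).source :=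
    h2.mono (fun x hx => ((OpenPartialHomeomorph.trans_source _ _).subset hx).1)
  have h := h1.comp h2' (fun x hx => ((OpenPartialHomeomorph.trans_source _ _).subset hx).2)
  exact h.contDiffOn

lemma PointedSection.coordDeriv_change [IsManifold (𝓡 n) ∞ M] (p : PointedSection n M)
    {φ ψ : OpenPartialHomeomorph M (Coord n)}
    (hφ : φ ∈ IsManifold.maximalAtlas (𝓡 n) ∞ M) (hψ : ψ ∈ IsManifold.maximalAtlas (𝓡 n) ∞ M)
    (hpφ : p.point ∈ φ.source) (hpψ : p.point ∈ ψ.source) (k : ℕ) :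
    (fun a : Fin (k + 1) => p.coordDeriv φ a) =
      jetChange k (φ ∘ ψ.symm) (fun a : Fin (k + 1) => p.coordDeriv ψ a) := by
  funext a
  have hev : (fun s => φ (p.sec.curve s)) =ᶠ[𝓝 p.time]
      (φ ∘ ψ.symm) ∘ (fun s => ψ (p.sec.curve s)) := by
    have hc : ContinuousAt p.sec.curve p.time :=
      (p.sec.smooth.contMDiffAt (p.sec.isOpen_dom.mem_nhds p.mem)).continuousAt
    filter_upwards [hc.preimage_mem_nhds (ψ.open_source.mem_nhds hpψ)] with s hs
    simp [ψ.left_inv hs]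
  have hmem : ψ (p.sec.curve p.time) ∈ (ψ.symm.trans φ).source := by
    rw [OpenPartialHomeomorph.trans_source]
    refine ⟨ψ.map_source hpψ, ?_⟩
    have hl : ψ.symm (ψ (p.sec.curve p.time)) = p.sec.curve p.time := ψ.left_inv hpψ
    rw [Set.mem_preimage, hl]
    exact hpφ
  have hτ : ContDiffAt ℝ ∞ (φ ∘ ψ.symm) (ψ (p.sec.curve p.time)) :=
    (contDiffOn_transition hφ hψ).contDiffAt ((ψ.symm.trans φ).open_source.mem_nhds hmem)
  have := iteratedDeriv_vcomp_eq_sum_orderedFinpartition (i := (a : ℕ)) hτ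
    (p.contDiffAt hψ hpψ) (by exact_mod_cast le_top)
  simp only [PointedSection.coordDeriv]
  rw [hev.iteratedDeriv_eq, this]
  simp [jetChange]

lemma contDiffOn_jetChange {τ : Coord n → Coord n} {S : Set (Coord n)} (hS : IsOpen S)
    (hτ : ContDiffOn ℝ ∞ τ S) (k : ℕ) :
    ContDiffOn ℝ ∞ (jetChange k τ) {y | y 0 ∈ S} := by
  rw [contDiffOn_pi]
  intro a
  refine ContDiffOn.sum fun c _ => ?_
  intro y hy
  have h0 : ContDiffAt ℝ ∞ τ (y 0) := hτ.contDiffAt (hS.mem_nhds hy)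
  have h1 : ContDiffAt ℝ ∞ (iteratedFDeriv ℝ c.length τ) (y 0) :=
    h0.iteratedFDeriv_right (i := c.length) (m := ∞) (by exact_mod_cast le_top)
  have h2 : ContDiffAt ℝ ∞ (fun y : Fin (k + 1) → Coord n => iteratedFDeriv ℝ c.length τ (y 0)) y :=
    h1.comp y (contDiff_apply ℝ (Coord n) (0 : Fin (k + 1))).contDiffAt
  have h3 : ContDiffAt ℝ ∞ (fun (y : Fin (k + 1) → Coord n) (j : Fin c.length) =>
      y ⟨c.partSize j, lt_of_le_of_lt (c.partSize_le j) a.2⟩) y := by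
    refine contDiffAt_pi.2 fun j => (contDiff_apply ℝ (Coord n) _).contDiffAt
  have h4 : ContDiffAt ℝ ∞ (fun y : Fin (k + 1) → Coord n =>
      iteratedFDeriv ℝ c.length τ (y 0) fun j =>
      y ⟨c.partSize j, lt_of_le_of_lt (c.partSize_le j) a.2⟩) y := by
    have h5 := (ContinuousLinearMap.id ℝ (ContinuousMultilinearMap ℝ
      (fun _ : Fin c.length => Coord n) (Coord n))).analyticAt_uncurry_of_multilinear
        (x := (iteratedFDeriv ℝ c.length τ (y 0), fun j =>
          y ⟨c.partSize j, lt_of_le_of_lt (c.partSize_le j) a.2⟩))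
    exact (h5.contDiffAt (n := ∞)).comp y (h2.prodMk h3)
  exact h4.contDiffWithinAt

variable [IsManifold (𝓡 n) ∞ M] {k : ℕ}

lemma adaptedCoord_mk {φ : OpenPartialHomeomorph M (Coord n)}
    (hφ : φ ∈ IsManifold.maximalAtlas (𝓡 n) ∞ M) (p : PointedSection n M)
    (hp : p.point ∈ φ.source) :
    adaptedCoord k φ (jetMk k p) = (p.time, fun a : Fin (k + 1) => p.coordDeriv φ a) := by
  have h : (jetSetoid n M k).r (Quotient.out (jetMk k p)) p :=
    Quotient.exact (Quotient.out_eq (jetMk k p))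
  set q := Quotient.out (jetMk k p) with hq
  refine Prod.ext rfl ?_
  change (fun a : Fin (k + 1) => q.coordDeriv φ a) = fun a : Fin (k + 1) => p.coordDeriv φ a
  have hc := IsManifold.chart_mem_maximalAtlas (I := 𝓡 n) (n := ∞) q.point
  rw [q.coordDeriv_change hφ hc (by rw [h.2.1]; exact hp) (mem_chart_source _ _) k,
    p.coordDeriv_change hφ hc hp (by rw [← h.2.1]; exact mem_chart_source _ _) k]
  congr 1
  funext a
  exact h.2.2 a (Nat.lt_succ_iff.1 a.2)

lemma adaptedCoord_change {φ ψ : OpenPartialHomeomorph M (Coord n)}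
    (hφ : φ ∈ IsManifold.maximalAtlas (𝓡 n) ∞ M) (hψ : ψ ∈ IsManifold.maximalAtlas (𝓡 n) ∞ M)
    (u : JetSpace n M k) (huφ : u.point ∈ φ.source) (huψ : u.point ∈ ψ.source) :
    adaptedCoord k φ u =
      ((adaptedCoord k ψ u).1, jetChange k (φ ∘ ψ.symm) (adaptedCoord k ψ u).2) := by
  obtain ⟨p, rfl⟩ : ∃ p, u = jetMk k p := ⟨Quotient.out u, (Quotient.out_eq u).symm⟩
  rw [adaptedCoord_mk hφ p huφ, adaptedCoord_mk hψ p huψ, p.coordDeriv_change hφ hψ huφ huψ k]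

/-! ### Jets with prescribed coordinates -/

/-- The polynomial curve with derivatives `y_{(a)}` at `t`. -/
def polyCurve (z : JetModel n k) (s : ℝ) : Coord n :=
  ∑ b : Fin (k + 1), ((s - z.1) ^ (b : ℕ) / ((b : ℕ).factorial : ℝ)) • z.2 b

lemma iteratedDeriv_sub_pow_div (a b : ℕ) (t : ℝ) :
    iteratedDeriv a (fun s : ℝ => (s - t) ^ b / (b.factorial : ℝ)) t = if a = b then 1 else 0 := by
  have h := congrFun (iteratedDeriv_comp_sub_const a (fun x : ℝ => x ^ b / (b.factorial : ℝ)) t) t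
  simp only [sub_self] at h
  rw [h, iteratedDeriv_div_const, iteratedDeriv_fun_pow_zero]
  have := Nat.factorial_ne_zero b
  split_ifs with hab
  · subst hab; field_simp
  · simp

lemma contDiff_polyCurve (z : JetModel n k) : ContDiff ℝ ∞ (polyCurve z) := by
  unfold polyCurve
  fun_prop

lemma iteratedDeriv_polyCurve (z : JetModel n k) (a : Fin (k + 1)) :
    iteratedDeriv a (polyCurve z) z.1 = z.2 a := by
  unfold polyCurve
  rw [iteratedDeriv_fun_sum (fun b _ => by fun_prop)]
  rw [Finset.sum_eq_single a]
  · rw [iteratedDeriv_smul_const (by fun_prop)]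
    have : iteratedDeriv (a : ℕ) (fun s : ℝ => (s - z.1) ^ (a : ℕ) / ((a : ℕ).factorial : ℝ)) z.1
        = 1 := by
      rw [iteratedDeriv_sub_pow_div, if_pos rfl]
    rw [this, one_smul]
  · intro b _ hb
    rw [iteratedDeriv_smul_const (by fun_prop)]
    have : iteratedDeriv (a : ℕ) (fun s : ℝ => (s - z.1) ^ (b : ℕ) / ((b : ℕ).factorial : ℝ)) z.1
        = 0 := by
      rw [iteratedDeriv_sub_pow_div, if_neg (fun h => hb (Fin.ext h.symm))]
    rw [this, zero_smul]
  · simp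

lemma polyCurve_self (z : JetModel n k) : polyCurve z z.1 = z.2 0 := by
  simpa using iteratedDeriv_polyCurve z 0

lemma isOpen_ordConnectedComponent {S : Set ℝ} (hS : IsOpen S) (t : ℝ) :
    IsOpen (S.ordConnectedComponent t) := by
  rw [isOpen_iff_mem_nhds]
  intro s hs
  rw [Set.ordConnectedComponent_eq hs]
  exact Set.ordConnectedComponent_mem_nhds.2
    (hS.mem_nhds (Set.ordConnectedComponent_subset hs))

/-- A section whose `k`-jet at `t` has the coordinates `z = (t, y_{(a)})` in the chart `φ`. -/
def polySection {φ : OpenPartialHomeomorph M (Coord n)}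
    (hφ : φ ∈ IsManifold.maximalAtlas (𝓡 n) ∞ M) (z : JetModel n k) (hz : z.2 0 ∈ φ.target) :
    PointedSection n M where
  sec :=
    { dom := (polyCurve z ⁻¹' φ.target).ordConnectedComponent z.1
      isOpen_dom := isOpen_ordConnectedComponent
        (φ.open_target.preimage (contDiff_polyCurve z).continuous) _
      ordConnected_dom := inferInstance
      curve := fun s => φ.symm (polyCurve z s)
      smooth := (contMDiffOn_symm_of_mem_maximalAtlas hφ).comp
        (contDiff_polyCurve z).contMDiff.contMDiffOn
        (fun _ hs => Set.ordConnectedComponent_subset hs) }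
  time := z.1
  mem := Set.self_mem_ordConnectedComponent.2 (by rw [Set.mem_preimage, polyCurve_self]; exact hz)

/-- The section which is constantly equal to `x` in `M`. -/
def constSection (x : M) (t : ℝ) : PointedSection n M where
  sec :=
    { dom := Set.univ
      isOpen_dom := isOpen_univ
      ordConnected_dom := Set.ordConnected_univ
      curve := fun _ => x
      smooth := contMDiffOn_const }
  time := t
  mem := Set.mem_univ t

lemma polySection_coordDeriv {φ : OpenPartialHomeomorph M (Coord n)}
    (hφ : φ ∈ IsManifold.maximalAtlas (𝓡 n) ∞ M) (z : JetModel n k) (hz : z.2 0 ∈ φ.target)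
    (a : Fin (k + 1)) : (polySection hφ z hz).coordDeriv φ a = z.2 a := by
  have hev : (fun s => φ ((polySection hφ z hz).sec.curve s)) =ᶠ[𝓝 z.1] polyCurve z := by
    filter_upwards [(polySection hφ z hz).sec.isOpen_dom.mem_nhds (polySection hφ z hz).mem]
      with s hs
    have hs' : s ∈ (polyCurve z ⁻¹' φ.target).ordConnectedComponent z.1 := hs
    have hs2 : s ∈ polyCurve z ⁻¹' φ.target := Set.ordConnectedComponent_subset hs'
    exact φ.right_inv hs2
  change iteratedDeriv a (fun s => φ ((polySection hφ z hz).sec.curve s)) z.1 = z.2 a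
  rw [hev.iteratedDeriv_eq, iteratedDeriv_polyCurve]

lemma polySection_point_mem {φ : OpenPartialHomeomorph M (Coord n)}
    (hφ : φ ∈ IsManifold.maximalAtlas (𝓡 n) ∞ M) (z : JetModel n k) (hz : z.2 0 ∈ φ.target) :
    (polySection hφ z hz).point ∈ φ.source := by
  change φ.symm (polyCurve z z.1) ∈ φ.source
  rw [polyCurve_self]
  exact φ.map_target hz

lemma jetMk_eq_of_coord {φ : OpenPartialHomeomorph M (Coord n)}
    (hφ : φ ∈ IsManifold.maximalAtlas (𝓡 n) ∞ M) (p q : PointedSection n M)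
    (hp : p.point ∈ φ.source) (hq : q.point ∈ φ.source) (ht : p.time = q.time)
    (h : ∀ a : Fin (k + 1), p.coordDeriv φ a = q.coordDeriv φ a) : jetMk k p = jetMk k q := by
  have hpt : p.point = q.point := by
    have h0 := h 0
    simp only [PointedSection.coordDeriv, Fin.val_zero, iteratedDeriv_zero] at h0
    exact φ.injOn hp hq h0
  refine Quotient.sound ⟨ht, hpt, fun a ha => ?_⟩
  have hc := IsManifold.chart_mem_maximalAtlas (I := 𝓡 n) (n := ∞) p.point
  have e1 := p.coordDeriv_change hc hφ (mem_chart_source _ _) hp k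
  have e2 := q.coordDeriv_change hc hφ (by rw [← hpt]; exact mem_chart_source _ _) hq k
  rw [show (fun a : Fin (k + 1) => p.coordDeriv φ a) = fun a : Fin (k + 1) => q.coordDeriv φ a from
    funext h, ← e2] at e1
  exact congrFun e1 ⟨a, Nat.lt_succ_iff.2 ha⟩

/-- The system of adapted coordinates of `J^k(E)` determined by a chart `φ` of `M`, as a bijection
from the jets over the domain of `φ` onto an open subset of the model space. -/
def adaptedEquiv (k : ℕ) (φ : OpenPartialHomeomorph M (Coord n))
    (hφ : φ ∈ IsManifold.maximalAtlas (𝓡 n) ∞ M) :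
    PartialEquiv (JetSpace n M k) (JetModel n k) where
  toFun := adaptedCoord k φ
  invFun z := open Classical in
    if hz : z.2 0 ∈ φ.target then jetMk k (polySection hφ z hz)
    else jetMk k (constSection (φ.symm 0) 0)
  source := {u | u.point ∈ φ.source}
  target := {z | z.2 0 ∈ φ.target}
  map_source' := by
    intro u hu
    obtain ⟨p, rfl⟩ : ∃ p, u = jetMk k p := ⟨Quotient.out u, (Quotient.out_eq u).symm⟩
    rw [adaptedCoord_mk hφ p hu]
    exact φ.map_source hu
  map_target' := by
    intro z hz
    rw [dif_pos (show z.2 0 ∈ φ.target from hz)]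
    exact polySection_point_mem hφ z hz
  left_inv' := by
    intro u hu
    obtain ⟨p, rfl⟩ : ∃ p, u = jetMk k p := ⟨Quotient.out u, (Quotient.out_eq u).symm⟩
    have hz : (adaptedCoord k φ (jetMk k p)).2 0 ∈ φ.target := by
      rw [adaptedCoord_mk hφ p hu]
      exact φ.map_source hu
    rw [dif_pos hz]
    refine jetMk_eq_of_coord hφ _ _ (polySection_point_mem hφ _ hz) hu rfl fun a => ?_
    rw [polySection_coordDeriv, adaptedCoord_mk hφ p hu]
  right_inv' := by
    intro z hz
    rw [dif_pos (show z.2 0 ∈ φ.target from hz),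
      adaptedCoord_mk hφ _ (polySection_point_mem hφ z hz)]
    exact Prod.ext rfl (funext fun a => polySection_coordDeriv hφ z hz a)

lemma adaptedEquiv_trans_source {φ ψ : OpenPartialHomeomorph M (Coord n)}
    (hφ : φ ∈ IsManifold.maximalAtlas (𝓡 n) ∞ M) (hψ : ψ ∈ IsManifold.maximalAtlas (𝓡 n) ∞ M) :
    ((adaptedEquiv k φ hφ).symm.trans (adaptedEquiv k ψ hψ)).source =
      Prod.snd ⁻¹' {y | y 0 ∈ (φ.symm.trans ψ).source} := by
  rw [PartialEquiv.trans_source]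
  ext z
  have key : ∀ hz : z.2 0 ∈ φ.target, ((adaptedEquiv k φ hφ).symm z).point = φ.symm (z.2 0) := by
    intro hz
    have hs : (adaptedEquiv k φ hφ).symm z = jetMk k (polySection hφ z hz) := dif_pos hz
    rw [hs]
    change φ.symm (polyCurve z z.1) = _
    rw [polyCurve_self]
  change _ ↔ z.2 0 ∈ (φ.symm.trans ψ).source
  rw [OpenPartialHomeomorph.trans_source]
  constructor
  · rintro ⟨hz, hz'⟩
    refine ⟨hz, ?_⟩
    have : ((adaptedEquiv k φ hφ).symm z).point ∈ ψ.source := hz'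
    rwa [key hz] at this
  · rintro ⟨hz, hz'⟩
    refine ⟨hz, ?_⟩
    change ((adaptedEquiv k φ hφ).symm z).point ∈ ψ.source
    rw [key hz]
    exact hz'

lemma contDiffOn_adaptedEquiv_trans {φ ψ : OpenPartialHomeomorph M (Coord n)}
    (hφ : φ ∈ IsManifold.maximalAtlas (𝓡 n) ∞ M) (hψ : ψ ∈ IsManifold.maximalAtlas (𝓡 n) ∞ M) :
    ContDiffOn ℝ ∞ ((adaptedEquiv k φ hφ).symm.trans (adaptedEquiv k ψ hψ))
      ((adaptedEquiv k φ hφ).symm.trans (adaptedEquiv k ψ hψ)).source := by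
  have h := contDiffOn_jetChange (φ.symm.trans ψ).open_source (contDiffOn_transition hψ hφ) k
  have h' : ContDiffOn ℝ ∞ (fun z : JetModel n k => (z.1, jetChange k (ψ ∘ φ.symm) z.2))
      (Prod.snd ⁻¹' {y | y 0 ∈ (φ.symm.trans ψ).source}) :=
    contDiffOn_fst.prodMk (h.comp contDiffOn_snd (fun _ hz => hz))
  rw [← adaptedEquiv_trans_source hφ hψ] at h'
  refine h'.congr fun z hz => ?_
  rw [PartialEquiv.trans_source] at hz
  have hz1 : (adaptedEquiv k φ hφ) ((adaptedEquiv k φ hφ).symm z) = z :=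
    (adaptedEquiv k φ hφ).right_inv hz.1
  have := adaptedCoord_change hψ hφ ((adaptedEquiv k φ hφ).symm z) hz.2
    ((adaptedEquiv k φ hφ).map_target hz.1)
  change adaptedCoord k ψ ((adaptedEquiv k φ hφ).symm z) = _
  rw [this]
  change adaptedCoord k φ ((adaptedEquiv k φ hφ).symm z) = z at hz1
  rw [hz1]

variable (n M k) in
/-- The adapted coordinates form an atlas of `J^k(E)`. -/
def jetCore : ChartedSpaceCore (JetModel n k) (JetSpace n M k) where
  atlas := {e | ∃ φ, ∃ hφ : φ ∈ IsManifold.maximalAtlas (𝓡 n) ∞ M, e = adaptedEquiv k φ hφ}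
  chartAt u := adaptedEquiv k (chartAt (Coord n) u.point)
    (IsManifold.chart_mem_maximalAtlas u.point)
  mem_chart_source u := mem_chart_source (Coord n) u.point
  chart_mem_atlas u := ⟨_, _, rfl⟩
  open_source := by
    rintro _ _ ⟨φ, hφ, rfl⟩ ⟨ψ, hψ, rfl⟩
    rw [adaptedEquiv_trans_source]
    have hc : Continuous fun z : JetModel n k => z.2 0 := by fun_prop
    exact (φ.symm.trans ψ).open_source.preimage hc
  continuousOn_toFun := by
    rintro _ _ ⟨φ, hφ, rfl⟩ ⟨ψ, hψ, rfl⟩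
    exact (contDiffOn_adaptedEquiv_trans hφ hψ).continuousOn

instance : TopologicalSpace (JetSpace n M k) := (jetCore n M k).toTopologicalSpace

instance : ChartedSpace (JetModel n k) (JetSpace n M k) := (jetCore n M k).toChartedSpace

/-- The adapted coordinates determined by a chart `φ` of `M`, as a chart of the manifold
`J^k(E)`. -/
def adaptedChart (k : ℕ) (φ : OpenPartialHomeomorph M (Coord n))
    (hφ : φ ∈ IsManifold.maximalAtlas (𝓡 n) ∞ M) :
    OpenPartialHomeomorph (JetSpace n M k) (JetModel n k) :=
  (jetCore n M k).openPartialHomeomorph (adaptedEquiv k φ hφ) ⟨φ, hφ, rfl⟩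

lemma mem_atlas_jetSpace_iff (e : OpenPartialHomeomorph (JetSpace n M k) (JetModel n k)) :
    e ∈ atlas (JetModel n k) (JetSpace n M k) ↔
      ∃ φ, ∃ hφ : φ ∈ IsManifold.maximalAtlas (𝓡 n) ∞ M, e = adaptedChart k φ hφ := by
  change e ∈ ⋃ (e' : PartialEquiv (JetSpace n M k) (JetModel n k)) (he : e' ∈ (jetCore n M k).atlas),
    {(jetCore n M k).openPartialHomeomorph e' he} ↔ _
  simp only [Set.mem_iUnion, Set.mem_singleton_iff]
  constructor
  · rintro ⟨_, ⟨φ, hφ, rfl⟩, rfl⟩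
    exact ⟨φ, hφ, rfl⟩
  · rintro ⟨φ, hφ, rfl⟩
    exact ⟨_, ⟨φ, hφ, rfl⟩, rfl⟩

/-- `J^k(E)` is a smooth manifold. -/
instance : IsManifold 𝓘(ℝ, JetModel n k) ∞ (JetSpace n M k) := by
  refine isManifold_of_contDiffOn _ _ _ ?_
  intro e e' he he'
  obtain ⟨φ, hφ, rfl⟩ := (mem_atlas_jetSpace_iff e).1 he
  obtain ⟨ψ, hψ, rfl⟩ := (mem_atlas_jetSpace_iff e').1 he'
  have h := contDiffOn_adaptedEquiv_trans (k := k) hφ hψ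
  rw [PartialEquiv.trans_source] at h
  simp only [modelWithCornersSelf_coe, modelWithCornersSelf_coe_symm, Function.comp_id,
    Function.id_comp, Set.preimage_id, Set.range_id, Set.inter_univ]
  exact h

end

/-! ### Differential forms on a manifold -/

section Forms

variable {V : Type*} [NormedAddCommGroup V] [NormedSpace ℝ V]
  {N : Type*} [TopologicalSpace N] [ChartedSpace V N]
  {V' : Type*} [NormedAddCommGroup V'] [NormedSpace ℝ V']
  {N' : Type*} [TopologicalSpace N'] [ChartedSpace V' N'] {p : ℕ}

variable (V N) in
/-- Fields of alternating `p`-linear forms on the tangent spaces of a manifold `N` modelled on `V`;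
smoothness is the separate predicate `SmoothOn`. -/
abbrev DiffForm (p : ℕ) : Type _ := (x : N) → (TangentSpace 𝓘(ℝ, V) x) [⋀^Fin p]→L[ℝ] ℝ

/-- The pull-back of a form by a map. -/
def pullback (f : N' → N) (η : DiffForm V N p) : DiffForm V' N' p :=
  fun x => (η (f x)).compContinuousLinearMap (mfderiv 𝓘(ℝ, V') 𝓘(ℝ, V) f x)

/-- The expression of a form in a chart. -/
def inChart (e : OpenPartialHomeomorph N V) (η : DiffForm V N p) : V → V [⋀^Fin p]→L[ℝ] ℝ :=
  pullback (V' := V) (N' := V) e.symm η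

/-- Smoothness of a form on an open set: its expressions in all the charts of the atlas are
smooth. -/
def SmoothOn (η : DiffForm V N p) (U : Set N) : Prop :=
  ∀ e ∈ atlas V N, ContDiffOn ℝ ∞ (inChart e η) (e.target ∩ e.symm ⁻¹' U)

/-- The exterior differential, computed at each point in the preferred chart at that point. -/
def extD (η : DiffForm V N p) : DiffForm V N (p + 1) :=
  fun x => pullback (V := V) (N := V) (chartAt V x) (extDeriv (inChart (chartAt V x) η)) x

/-- The interior product `ι_v η` at a point. -/
def interiorProduct (η : DiffForm V N (p + 1)) (x : N) (v : TangentSpace 𝓘(ℝ, V) x) :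
    (TangentSpace 𝓘(ℝ, V) x) [⋀^Fin p]→L[ℝ] ℝ :=
  ContinuousAlternatingMap.curryLeft (E := V) (η x) v

end Forms

/-! ### Holonomic distribution, variational classes, source forms -/

section

variable {n : ℕ} {M : Type*} [TopologicalSpace M] [ChartedSpace (Coord n) M]

/-- The lift `γ^{(k)}(t) = j^k_t(γ)` of a section (with an irrelevant value when `t ∉ dom`). -/
def LocalSection.lift (γ : LocalSection n M) (k : ℕ) (t : ℝ) : JetSpace n M k :=
  open Classical in
  if h : t ∈ γ.dom then jetMk k ⟨γ, t, h⟩ else jetMk k (constSection (γ.curve t) t)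

variable [IsManifold (𝓡 n) ∞ M] {k : ℕ}

/-- The tangent vector of the lift `γ^{(k)}` at `t`. -/
def LocalSection.velocity (γ : LocalSection n M) (k : ℕ) (t : ℝ) :
    TangentSpace 𝓘(ℝ, JetModel n k) (γ.lift k t) :=
  mfderiv 𝓘(ℝ, ℝ) 𝓘(ℝ, JetModel n k) (γ.lift k) t (1 : ℝ)

/-- The holonomic distribution: at `u`, the span of the tangent vectors of the lifts of the
sections with jet `u`. -/
def holonomicSpace (u : JetSpace n M k) : Submodule ℝ (TangentSpace 𝓘(ℝ, JetModel n k) u) :=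
  Submodule.span ℝ {v | ∃ (γ : LocalSection n M) (t : ℝ) (_ : t ∈ γ.dom) (h : γ.lift k t = u),
    v = h ▸ γ.velocity k t}

variable (n M k) in
/-- The `p`-forms on `J^k(E)`. -/
abbrev JetForm (p : ℕ) : Type _ := DiffForm (JetModel n k) (JetSpace n M k) p

/-- Holonomic forms on `U`: their interior products with holonomic vectors vanish; a holonomic
`0`-form vanishes identically. -/
def IsHolonomicOn : {p : ℕ} → JetForm n M k p → Set (JetSpace n M k) → Prop
  | 0, η, U => ∀ u ∈ U, η u = 0
  | _ + 1, η, U => ∀ u ∈ U, ∀ v ∈ holonomicSpace u, interiorProduct η u v = 0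

/-- Variational equivalence on `U` of forms of positive degree. -/
def VariationallyEquivalentOn {p : ℕ} (U : Set (JetSpace n M k)) (η η' : JetForm n M k (p + 1)) :
    Prop :=
  ∃ (lam : JetForm n M k (p + 1)) (mu : JetForm n M k p),
    SmoothOn lam U ∧ SmoothOn mu U ∧ IsHolonomicOn lam U ∧ IsHolonomicOn mu U ∧
      ∀ u ∈ U, η u - η' u = lam u + extD mu u

/-- The form `η` on `U ⊆ J^k(E)` is of order `r`: it is the pull-back of a smooth form on an open
subset of `J^r(E)`. -/
def IsOfOrderOn {p : ℕ} (r : ℕ) (U : Set (JetSpace n M k)) (η : JetForm n M k p) : Prop :=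
  ∃ (h : r ≤ k) (W : Set (JetSpace n M r)) (β : JetForm n M r p), IsOpen W ∧ SmoothOn β W ∧
    ∀ u ∈ U, JetSpace.proj h u ∈ W ∧ η u = pullback (JetSpace.proj h) β u

/-- The `1`-form `L dt`. -/
def lagrangianForm (L : JetSpace n M k → ℝ) : JetForm n M k 1 :=
  fun u => L u • ContinuousAlternatingMap.ofSubsingleton ℝ
    (TangentSpace 𝓘(ℝ, JetModel n k) u) ℝ (0 : Fin 1)
    (mfderiv 𝓘(ℝ, JetModel n k) 𝓘(ℝ, ℝ) JetSpace.time u)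

/-- `L` is a smooth Lagrangian on the open set `U`, the form `L dt` is of order `r` on `U`, and
`α` is variationally equivalent to `L dt` on `U`. -/
structure IsLocalLagrangian (r : ℕ) (α : JetForm n M k 1) (U : Set (JetSpace n M k))
    (L : JetSpace n M k → ℝ) : Prop where
  isOpen : IsOpen U
  smooth : ContMDiffOn 𝓘(ℝ, JetModel n k) 𝓘(ℝ, ℝ) ∞ L U
  order : IsOfOrderOn r U (lagrangianForm L)
  equivalent : VariationallyEquivalentOn U α (lagrangianForm L)

/-- Source forms: `2`-forms whose interior products with the `π^k_0`-vertical vectors vanish. -/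
def IsSourceForm (σ : JetForm n M k 2) : Prop :=
  ∀ (u : JetSpace n M k) (v : TangentSpace 𝓘(ℝ, JetModel n k) u),
    mfderiv 𝓘(ℝ, JetModel n k) (𝓘(ℝ, ℝ).prod (𝓡 n)) JetSpace.toE u v = 0 →
      interiorProduct σ u v = 0

/-! ### The variational principle -/

/-- The action `∫_{γ^{(k)}([a,b])} α`. -/
def action (α : JetForm n M k 1) (γ : LocalSection n M) (a b : ℝ) : ℝ :=
  ∫ t in a..b, α (γ.lift k t) (fun _ => γ.velocity k t)

/-- The map `F(t, s) = δ_s(t)` on `[a,b] × [-ε,ε]` is a smooth variation of `γ|_{[a,b]}` with fixed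
boundary up to order `m`. The local section `δ_s` is a smooth extension of `F(·, s)` to an open
interval containing `[a,b]`. -/
structure IsVariation (m : ℕ) (γ : LocalSection n M) (a b ε : ℝ) (δ : ℝ → LocalSection n M) :
    Prop where
  pos : 0 < ε
  subset_dom : ∀ s ∈ Set.Icc (-ε) ε, Set.Icc a b ⊆ (δ s).dom
  smooth : ContMDiffOn 𝓘(ℝ, ℝ × ℝ) (𝓡 n) ∞ (fun q : ℝ × ℝ => (δ q.2).curve q.1)
    (Set.Icc a b ×ˢ Set.Icc (-ε) ε)
  start : ∀ t ∈ Set.Icc a b, (δ 0).curve t = γ.curve t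
  left_fixed : ∀ s ∈ Set.Icc (-ε) ε, (δ s).lift m a = γ.lift m a
  right_fixed : ∀ s ∈ Set.Icc (-ε) ε, (δ s).lift m b = γ.lift m b

/-- `γ` satisfies the variational principle of the action of `α`, with respect to the variations
with fixed boundary up to order `m` on all closed subintervals of its domain. -/
def SatisfiesVariationalPrinciple (m : ℕ) (α : JetForm n M k 1) (γ : LocalSection n M) : Prop :=
  ∀ a b : ℝ, a < b → Set.Icc a b ⊆ γ.dom → ∀ (ε : ℝ) (δ : ℝ → LocalSection n M),
    IsVariation m γ a b ε δ → HasDerivAt (fun s => action α (δ s) a b) 0 0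

/-! ### Coordinate expressions -/

/-- The tangent vector at `u` with components `w` in the adapted coordinates of `φ`. -/
def coordVector (φ : OpenPartialHomeomorph M (Coord n))
    (hφ : φ ∈ IsManifold.maximalAtlas (𝓡 n) ∞ M) (u : JetSpace n M k) (w : JetModel n k) :
    TangentSpace 𝓘(ℝ, JetModel n k) u :=
  mfderiv 𝓘(ℝ, JetModel n k) 𝓘(ℝ, JetModel n k) (adaptedChart k φ hφ).symm
    (adaptedChart k φ hφ u) w

/-- The components of `∂/∂y^i_{(a)}`. -/
def partialVec (i : Fin n) (a : Fin (k + 1)) : JetModel n k :=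
  (0, Pi.single a (EuclideanSpace.single i 1))

/-- The components of the total derivative `d/dt = ∂/∂t + ∑_{a<k} y^j_{(a+1)} ∂/∂y^j_{(a)}` at the
point of coordinates `z`. -/
def totalDerivVec (z : JetModel n k) : JetModel n k :=
  (1, fun a => if h : (a : ℕ) + 1 < k + 1 then z.2 ⟨a + 1, h⟩ else 0)

/-- The coefficient `σ_i = σ(∂/∂y^i, d/dt)` of `ω^i_{(0)} ∧ dt`, where
`ω^i_{(0)} = dy^i - y^i_{(1)} dt`, in the expression
`σ = σ_i ω^i_{(0)} ∧ dt + ∑_{j<l} σ_{jl} ω^j_{(0)} ∧ ω^l_{(0)}` of a source form. -/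
def sourceCoeff (φ : OpenPartialHomeomorph M (Coord n))
    (hφ : φ ∈ IsManifold.maximalAtlas (𝓡 n) ∞ M) (σ : JetForm n M k 2) (i : Fin n)
    (u : JetSpace n M k) : ℝ :=
  σ u ![coordVector φ hφ u (partialVec i 0),
    coordVector φ hφ u (totalDerivVec (adaptedChart k φ hφ u))]

/-- The partial derivative `∂L/∂y^i_{(a)}` in the adapted coordinates of `φ`. -/
def partialDeriv (φ : OpenPartialHomeomorph M (Coord n))
    (hφ : φ ∈ IsManifold.maximalAtlas (𝓡 n) ∞ M) (L : JetSpace n M k → ℝ) (i : Fin n)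
    (a : Fin (k + 1)) (u : JetSpace n M k) : ℝ :=
  fderiv ℝ (L ∘ (adaptedChart k φ hφ).symm) (adaptedChart k φ hφ u) (partialVec i a)

/-- The `i`-th Euler–Lagrange expression `∑_a (-1)^a (d/dt)^a (∂L/∂y^i_{(a)})` along `γ`. -/
def eulerLagrange (φ : OpenPartialHomeomorph M (Coord n))
    (hφ : φ ∈ IsManifold.maximalAtlas (𝓡 n) ∞ M) (L : JetSpace n M k → ℝ)
    (γ : LocalSection n M) (i : Fin n) (t : ℝ) : ℝ :=
  ∑ a : Fin (k + 1), (-1) ^ (a : ℕ) *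
    iteratedDeriv a (fun s => partialDeriv φ hφ L i a (γ.lift k s)) t

end

end JetVar

end

open JetVar

/-! # The variational principle for classes of forms on jet spaces -/

noncomputable section

set_option linter.unusedSectionVars false

open scoped Manifold ContDiff Topology

namespace JetVar

/-! ### Differential forms in charts -/

section FormsInCharts

variable {V : Type*} [NormedAddCommGroup V] [NormedSpace ℝ V]
  {N : Type*} [TopologicalSpace N] [ChartedSpace V N] {p : ℕ}

/-! Write `σ - dα = λ + dμ` with `λ`, `μ` holonomic and put `β = α + μ`. Since `μ` vanishes on
velocities of lifts, `α` and `β` have the same action; since `λ` is holonomic, `σ` and `dβ` agree as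
soon as one argument is holonomic. This `β` (`exists_lepageRepresentative`) is a globally defined
Lepage form, and everything is computed with it.

In adapted coordinates let `V = d/dt + c ∂/∂y_(k)`, which is the velocity of a lift when `c` is the
derivative of order `k + 1`. Near any jet `β(V) = L` whatever `c` is, so the momenta `p_a =
β(∂/∂y_(a))` satisfy `p_k = 0`. Evaluating `dβ` on `∂/∂y_(a)` and `V` along a section, and using
that a source form kills `∂/∂y_(a)` for `a ≥ 1`, gives (`force_zero_eq`, `force_succ_eq`) `∂L/∂y_(0)
= σ_i + p_0'` and `∂L/∂y_(a+1) = p_a + p_(a+1)'`. The alternating sum of derivatives of these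
relations telescopes to the Euler–Lagrange expression (`sourceCoeff_eq_eulerLagrange`). The momenta
are taken along a section, so that total derivatives are ordinary time derivatives and no higher jet
space is needed.

The same relations settle the boundary order. If `r ≤ m`, or if `α` has order `m`, then `L` involves
no derivative of order above `m + 1`; descending from `p_k = 0` one finds `p_a = 0` for `a > m`.
Thus `β` vanishes on variations that fix the `m`-jet (`coordCovec_eq_zero_of_fixed`).

For a variation with prolongation `G(t, s)`, symmetry of second derivatives gives `∂_s (β(∂_t G)) =
dβ(∂_s G, ∂_t G) + ∂_t (β(∂_s G))`. Integration makes the derivative of the action equal to `∫ σ(∂_s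
G, ∂_t G) dt`, the boundary terms being zero (`IsVariation.hasDerivAt_action`). The density is `∑
(∂_s y^i) σ_i`, so zeros of the `σ_i` are extremals; bump variations inside one chart give the
converse. -/

lemma form_apply_congr (η : DiffForm V N p) {x y : N} (h : x = y) (v : Fin p → V) :
    (η x : V [⋀^Fin p]→L[ℝ] ℝ) v = (η y : V [⋀^Fin p]→L[ℝ] ℝ) v := by
  subst h; rfl

variable [IsManifold 𝓘(ℝ, V) ∞ N]

lemma mdifferentiable_atlas {e : OpenPartialHomeomorph N V} (he : e ∈ atlas V N) :
    e.MDifferentiable 𝓘(ℝ, V) 𝓘(ℝ, V) :=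
  haveI : IsManifold 𝓘(ℝ, V) 1 N := IsManifold.of_le (n := ∞) (by norm_cast)
  mdifferentiable_of_mem_atlas he

lemma apply_eq_inChart {e : OpenPartialHomeomorph N V} (he : e ∈ atlas V N) (η : DiffForm V N p)
    {u : N} (hu : u ∈ e.source) (v : Fin p → TangentSpace 𝓘(ℝ, V) u) :
    η u v = inChart e η (e u) (fun i => (mfderiv 𝓘(ℝ, V) 𝓘(ℝ, V) e u (v i) : V)) := by
  have h := (mdifferentiable_atlas he).symm_comp_deriv hu
  have hv : ∀ i, mfderiv 𝓘(ℝ, V) 𝓘(ℝ, V) e.symm (e u) (mfderiv 𝓘(ℝ, V) 𝓘(ℝ, V) e u (v i)) = v i :=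
    fun i => DFunLike.congr_fun h (v i)
  change η u v = (η (e.symm (e u)) : V [⋀^Fin p]→L[ℝ] ℝ) fun i =>
    mfderiv 𝓘(ℝ, V) 𝓘(ℝ, V) e.symm (e u) (mfderiv 𝓘(ℝ, V) 𝓘(ℝ, V) e u (v i))
  exact (congrArg (η u) (funext fun i => (hv i).symm)).trans
    (form_apply_congr η (e.left_inv hu) _).symm

lemma contDiffAt_transition {e c : OpenPartialHomeomorph N V} (he : e ∈ atlas V N)
    (hc : c ∈ atlas V N) {z : V} (hz : z ∈ e.target) (hz' : e.symm z ∈ c.source) :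
    ContDiffAt ℝ ∞ (c ∘ e.symm) z := by
  have h1 := contMDiffAt_of_mem_maximalAtlas
    (IsManifold.subset_maximalAtlas (I := 𝓘(ℝ, V)) (n := ∞) hc) hz'
  have h2 := contMDiffAt_symm_of_mem_maximalAtlas
    (IsManifold.subset_maximalAtlas (I := 𝓘(ℝ, V)) (n := ∞) he) hz
  exact (h1.comp z h2).contDiffAt

lemma mfderiv_comp_transition {e c : OpenPartialHomeomorph N V} (he : e ∈ atlas V N)
    (hc : c ∈ atlas V N) {z : V} (hz : z ∈ e.target) (hz' : e.symm z ∈ c.source) (w : V) :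
    (mfderiv 𝓘(ℝ, V) 𝓘(ℝ, V) c (e.symm z) (mfderiv 𝓘(ℝ, V) 𝓘(ℝ, V) e.symm z w) : V) =
      fderiv ℝ (c ∘ e.symm) z w := by
  rw [← mfderiv_eq_fderiv, mfderiv_comp z ((mdifferentiable_atlas hc).mdifferentiableAt hz')
    ((mdifferentiable_atlas he).mdifferentiableAt_symm hz)]
  rfl

lemma inChart_change {e c : OpenPartialHomeomorph N V} (he : e ∈ atlas V N)
    (hc : c ∈ atlas V N) (η : DiffForm V N p) {z : V} (hz : z ∈ e.target)
    (hz' : e.symm z ∈ c.source) :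
    inChart e η z =
      (inChart c η ((c ∘ e.symm) z)).compContinuousLinearMap (fderiv ℝ (c ∘ e.symm) z) := by
  ext v
  change (η (e.symm z)) (fun i => mfderiv 𝓘(ℝ, V) 𝓘(ℝ, V) e.symm z (v i)) = _
  rw [apply_eq_inChart hc η hz']
  exact congrArg (inChart c η (c (e.symm z)))
    (funext fun i => mfderiv_comp_transition he hc hz hz' (v i))

lemma isOpen_chart_preimage (e : OpenPartialHomeomorph N V) {U : Set N} (hU : IsOpen U) :
    IsOpen (e.target ∩ e.symm ⁻¹' U) :=
  e.isOpen_inter_preimage_symm hU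

lemma SmoothOn.contDiffAt_inChart {η : DiffForm V N p} {U : Set N} (hη : SmoothOn η U)
    (hU : IsOpen U) {e : OpenPartialHomeomorph N V} (he : e ∈ atlas V N) {z : V}
    (hz : z ∈ e.target) (hzU : e.symm z ∈ U) : ContDiffAt ℝ ∞ (inChart e η) z :=
  (hη e he).contDiffAt ((isOpen_chart_preimage e hU).mem_nhds ⟨hz, hzU⟩)

/-- Naturality of `d` under the transition map: `extD` uses the preferred chart at each point, and
this lemma frees it from that choice. -/
lemma inChart_extD {η : DiffForm V N p} {U : Set N} (hU : IsOpen U) (hη : SmoothOn η U)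
    {e : OpenPartialHomeomorph N V} (he : e ∈ atlas V N) {z : V}
    (hz : z ∈ e.target) (hzU : e.symm z ∈ U) :
    inChart e (extD η) z = extDeriv (inChart e η) z := by
  set c := chartAt V (e.symm z) with hcdef
  have hc : c ∈ atlas V N := chart_mem_atlas V _
  have hzc : e.symm z ∈ c.source := mem_chart_source V _
  have hev : inChart e η =ᶠ[𝓝 z] fun z => (inChart c η ((c ∘ e.symm) z)).compContinuousLinearMap
      (fderiv ℝ (c ∘ e.symm) z) := by
    filter_upwards [(isOpen_chart_preimage e c.open_source).mem_nhds ⟨hz, hzc⟩] with y hy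
    exact inChart_change he hc η hy.1 hy.2
  have hd : DifferentiableAt ℝ (inChart c η) ((c ∘ e.symm) z) :=
    (hη.contDiffAt_inChart hU hc (c.map_source hzc) (by
      rwa [c.left_inv hzc])).differentiableAt (by simp)
  rw [hev.extDeriv_eq, extDeriv_pullback hd (contDiffAt_transition he hc hz hzc)
    (by rw [minSmoothness_of_isRCLikeNormedField]; exact ENat.LEInfty.out)]
  ext v
  exact congrArg (extDeriv (inChart c η) (c (e.symm z)))
    (funext fun i => mfderiv_comp_transition he hc hz hzc (v i))

/-- The tangent vector of a curve, read in a chart. -/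
lemma mfderiv_chart_curve {e : OpenPartialHomeomorph N V} (he : e ∈ atlas V N) {c : ℝ → N} {t : ℝ}
    (ht : c t ∈ e.source) (hc : MDifferentiableAt 𝓘(ℝ, ℝ) 𝓘(ℝ, V) c t) :
    (mfderiv 𝓘(ℝ, V) 𝓘(ℝ, V) e (c t) (mfderiv 𝓘(ℝ, ℝ) 𝓘(ℝ, V) c t (1 : ℝ)) : V) =
      deriv (e ∘ c) t := by
  rw [← fderiv_apply_one_eq_deriv, ← mfderiv_eq_fderiv,
    mfderiv_comp t ((mdifferentiable_atlas he).mdifferentiableAt ht) hc]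
  rfl

lemma mdifferentiableAt_curve_of_chart {e : OpenPartialHomeomorph N V} (he : e ∈ atlas V N)
    {c : ℝ → N} {t : ℝ} (hc : ∀ᶠ s in 𝓝 t, c s ∈ e.source)
    (hd : DifferentiableAt ℝ (e ∘ c) t) : MDifferentiableAt 𝓘(ℝ, ℝ) 𝓘(ℝ, V) c t := by
  have h := ((mdifferentiable_atlas he).mdifferentiableAt_symm
    (e.map_source hc.self_of_nhds)).comp (x := t) hd.mdifferentiableAt
  refine h.congr_of_eventuallyEq ?_
  filter_upwards [hc] with s hs
  exact (e.left_inv hs).symm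

end FormsInCharts

/-! ### Prolonged curves in coordinates -/

/-- The prolongation `t ↦ (t, y(t), y'(t), …, y^{(k)}(t))` of a curve in `ℝⁿ`. -/
def prolong {n : ℕ} (k : ℕ) (y : ℝ → Coord n) (t : ℝ) : JetModel n k :=
  (t, fun a => iteratedDeriv a y t)

/-- The vectors `d/dt + c ∂/∂y_{(k)}`, which span the holonomic distribution. -/
def contactVec {n k : ℕ} (z : JetModel n k) (c : Coord n) : JetModel n k :=
  totalDerivVec z + (0, Pi.single (Fin.last k) c)

lemma contactVec_fst {n k : ℕ} (z : JetModel n k) (c : Coord n) : (contactVec z c).1 = 1 := by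
  simp [contactVec, totalDerivVec]

lemma contactVec_snd {n k : ℕ} (z : JetModel n k) (c : Coord n) (a : Fin (k + 1)) :
    (contactVec z c).2 a = if h : (a : ℕ) + 1 < k + 1 then z.2 ⟨a + 1, h⟩ else c := by
  simp only [contactVec, totalDerivVec, Prod.snd_add, Pi.add_apply]
  split_ifs with h
  · have : a ≠ Fin.last k := by rintro rfl; simp at h
    simp [Pi.single_eq_of_ne this]
  · have : a = Fin.last k := by
      apply Fin.ext; have := a.2; simp only [Fin.val_last]; omega
    subst this; simp

lemma contactVec_prolong {n k : ℕ} (y : ℝ → Coord n) (t : ℝ) :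
    contactVec (prolong k y t) (iteratedDeriv (k + 1) y t) =
      (1, fun a : Fin (k + 1) => iteratedDeriv (a + 1) y t) := by
  refine Prod.ext (contactVec_fst _ _) (funext fun a => ?_)
  rw [contactVec_snd]
  split_ifs with h
  · rfl
  · have : (a : ℕ) = k := by have := a.2; omega
    simp [this]

lemma contDiffAt_iteratedDeriv {F : Type*} [NormedAddCommGroup F] [NormedSpace ℝ F]
    {y : ℝ → F} {t : ℝ} (hy : ContDiffAt ℝ ∞ y t) (a : ℕ) :
    ContDiffAt ℝ ∞ (iteratedDeriv a y) t :=
  (ContinuousMultilinearMap.apply ℝ (fun _ : Fin a => ℝ) F (fun _ => 1)).contDiff.contDiffAt.comp t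
    (hy.iteratedFDeriv_right (i := a) (m := ∞) (by exact_mod_cast le_top))

lemma hasDerivAt_iteratedDeriv {F : Type*} [NormedAddCommGroup F] [NormedSpace ℝ F]
    {y : ℝ → F} {t : ℝ} (hy : ContDiffAt ℝ ∞ y t) (a : ℕ) :
    HasDerivAt (iteratedDeriv a y) (iteratedDeriv (a + 1) y t) t := by
  have h : DifferentiableAt ℝ (iteratedDeriv a y) t :=
    (contDiffAt_iteratedDeriv hy a).differentiableAt (by simp)
  simpa [iteratedDeriv_succ] using h.hasDerivAt

lemma hasDerivAt_prolong {n k : ℕ} {y : ℝ → Coord n} {t : ℝ} (hy : ContDiffAt ℝ ∞ y t) :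
    HasDerivAt (prolong k y) (contactVec (prolong k y t) (iteratedDeriv (k + 1) y t)) t := by
  rw [contactVec_prolong]
  exact (hasDerivAt_id t).prodMk (hasDerivAt_pi.2 fun a => hasDerivAt_iteratedDeriv hy a)

/-! ### Lifts of sections in adapted coordinates -/

section Lifts

variable {n : ℕ} {M : Type*} [TopologicalSpace M] [ChartedSpace (Coord n) M]
  [IsManifold (𝓡 n) ∞ M] {k : ℕ} {φ : OpenPartialHomeomorph M (Coord n)}
  (hφ : φ ∈ IsManifold.maximalAtlas (𝓡 n) ∞ M)

lemma adaptedChart_mem_atlas : adaptedChart k φ hφ ∈ atlas (JetModel n k) (JetSpace n M k) :=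
  (mem_atlas_jetSpace_iff _).2 ⟨φ, hφ, rfl⟩

lemma mem_adaptedChart_source {u : JetSpace n M k} :
    u ∈ (adaptedChart k φ hφ).source ↔ u.point ∈ φ.source := Iff.rfl

lemma adaptedChart_apply (u : JetSpace n M k) :
    adaptedChart k φ hφ u = adaptedCoord k φ u := rfl

variable {γ : LocalSection n M} {t : ℝ}

lemma LocalSection.lift_of_mem (ht : t ∈ γ.dom) : γ.lift k t = jetMk k ⟨γ, t, ht⟩ := dif_pos ht

lemma LocalSection.lift_mem_source (ht : t ∈ γ.dom) (hs : γ.curve t ∈ φ.source) :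
    γ.lift k t ∈ (adaptedChart k φ hφ).source := by
  rw [mem_adaptedChart_source, LocalSection.lift_of_mem ht]
  exact hs

lemma LocalSection.eventually_mem (ht : t ∈ γ.dom) (hs : γ.curve t ∈ φ.source) :
    ∀ᶠ s in 𝓝 t, s ∈ γ.dom ∧ γ.curve s ∈ φ.source := by
  have hc : ContinuousAt γ.curve t :=
    (γ.smooth.contMDiffAt (γ.isOpen_dom.mem_nhds ht)).continuousAt
  filter_upwards [γ.isOpen_dom.mem_nhds ht, hc.preimage_mem_nhds (φ.open_source.mem_nhds hs)]
    with s h1 h2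
  exact ⟨h1, h2⟩

lemma LocalSection.contDiffAt_coord
    (hφ : φ ∈ IsManifold.maximalAtlas (𝓡 n) ∞ M) (ht : t ∈ γ.dom) (hs : γ.curve t ∈ φ.source) :
    ContDiffAt ℝ ∞ (fun s => φ (γ.curve s)) t :=
  PointedSection.contDiffAt ⟨γ, t, ht⟩ hφ hs

lemma LocalSection.adaptedChart_lift (ht : t ∈ γ.dom) (hs : γ.curve t ∈ φ.source) :
    adaptedChart k φ hφ (γ.lift k t) = prolong k (fun s => φ (γ.curve s)) t := by
  rw [LocalSection.lift_of_mem ht, adaptedChart_apply, adaptedCoord_mk hφ ⟨γ, t, ht⟩ hs]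
  rfl

lemma LocalSection.hasDerivAt_adaptedChart_lift (ht : t ∈ γ.dom) (hs : γ.curve t ∈ φ.source) :
    HasDerivAt (adaptedChart k φ hφ ∘ γ.lift k)
      (contactVec (adaptedChart k φ hφ (γ.lift k t))
        (iteratedDeriv (k + 1) (fun s => φ (γ.curve s)) t)) t := by
  rw [LocalSection.adaptedChart_lift hφ ht hs]
  refine (hasDerivAt_prolong (LocalSection.contDiffAt_coord hφ ht hs)).congr_of_eventuallyEq ?_
  filter_upwards [LocalSection.eventually_mem ht hs] with s h
  exact LocalSection.adaptedChart_lift hφ h.1 h.2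

lemma LocalSection.mdifferentiableAt_lift (ht : t ∈ γ.dom) :
    MDifferentiableAt 𝓘(ℝ, ℝ) 𝓘(ℝ, JetModel n k) (γ.lift k) t := by
  have hc := IsManifold.chart_mem_maximalAtlas (I := 𝓡 n) (n := ∞) (γ.curve t)
  have hs := mem_chart_source (Coord n) (γ.curve t)
  refine mdifferentiableAt_curve_of_chart (adaptedChart_mem_atlas hc) ?_
    (LocalSection.hasDerivAt_adaptedChart_lift hc ht hs).differentiableAt
  filter_upwards [LocalSection.eventually_mem ht hs] with s h
  exact LocalSection.lift_mem_source hc h.1 h.2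

/-- The components of the velocity of a lift. -/
lemma LocalSection.mfderiv_velocity (ht : t ∈ γ.dom) (hs : γ.curve t ∈ φ.source) :
    (mfderiv 𝓘(ℝ, JetModel n k) 𝓘(ℝ, JetModel n k) (adaptedChart k φ hφ) (γ.lift k t)
      (γ.velocity k t) : JetModel n k) =
      contactVec (adaptedChart k φ hφ (γ.lift k t))
        (iteratedDeriv (k + 1) (fun s => φ (γ.curve s)) t) := by
  rw [← (LocalSection.hasDerivAt_adaptedChart_lift hφ ht hs).deriv]
  exact mfderiv_chart_curve (adaptedChart_mem_atlas hφ) (LocalSection.lift_mem_source hφ ht hs)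
    (LocalSection.mdifferentiableAt_lift ht)

/-- A `1`-form on the velocity of a lift, in adapted coordinates. -/
lemma apply_velocity (η : JetForm n M k 1) (ht : t ∈ γ.dom) (hs : γ.curve t ∈ φ.source) :
    η (γ.lift k t) (fun _ => γ.velocity k t) =
      inChart (adaptedChart k φ hφ) η (prolong k (fun s => φ (γ.curve s)) t) (fun _ =>
        contactVec (prolong k (fun s => φ (γ.curve s)) t)
          (iteratedDeriv (k + 1) (fun s => φ (γ.curve s)) t)) := by
  rw [apply_eq_inChart (adaptedChart_mem_atlas hφ) η (LocalSection.lift_mem_source hφ ht hs),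
    ← LocalSection.adaptedChart_lift hφ ht hs, ← LocalSection.mfderiv_velocity hφ ht hs]

/-- Every vector `d/dt + c ∂/∂y_{(k)}` is the velocity of a lift. -/
lemma exists_section_contactVec (hφ : φ ∈ IsManifold.maximalAtlas (𝓡 n) ∞ M)
    (z : JetModel n k) (hz : z.2 0 ∈ φ.target) (c : Coord n) :
    ∃ (γ : LocalSection n M) (t : ℝ), t ∈ γ.dom ∧ γ.curve t ∈ φ.source ∧
      prolong k (fun s => φ (γ.curve s)) t = z ∧
      iteratedDeriv (k + 1) (fun s => φ (γ.curve s)) t = c := by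
  -- Appending `c` to `z` gives the coordinates of a `(k + 1)`-jet, which a polynomial curve
  -- realises.
  let z' : JetModel n (k + 1) := (z.1, Fin.snoc z.2 c)
  have hz0 : z'.2 0 = z.2 0 := by
    have : (0 : Fin (k + 2)) = Fin.castSucc (0 : Fin (k + 1)) := rfl
    simp only [z', this, Fin.snoc_castSucc]
  have hz' : z'.2 0 ∈ φ.target := by rw [hz0]; exact hz
  refine ⟨(polySection hφ z' hz').sec, (polySection hφ z' hz').time, (polySection hφ z' hz').mem,
    polySection_point_mem hφ z' hz', Prod.ext rfl (funext fun a => ?_), ?_⟩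
  · have h := polySection_coordDeriv hφ z' hz' a.castSucc
    simpa [z', PointedSection.coordDeriv, prolong] using h
  · have h := polySection_coordDeriv hφ z' hz' (Fin.last (k + 1))
    simpa [z', PointedSection.coordDeriv, prolong] using h

lemma velocity_mem_holonomicSpace (ht : t ∈ γ.dom) :
    γ.velocity k t ∈ holonomicSpace (γ.lift k t) :=
  Submodule.subset_span ⟨γ, t, ht, rfl, rfl⟩

/-- Holonomic forms vanish on the vectors `d/dt + c ∂/∂y_{(k)}`. -/
lemma IsHolonomicOn.inChart_apply {p : ℕ} {η : JetForm n M k (p + 1)} {U : Set (JetSpace n M k)}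
    (hη : IsHolonomicOn η U) {z : JetModel n k} (hz : z ∈ (adaptedChart k φ hφ).target)
    (hzU : (adaptedChart k φ hφ).symm z ∈ U) (c : Coord n) (v : Fin p → JetModel n k) :
    inChart (adaptedChart k φ hφ) η z (Matrix.vecCons (contactVec z c) v) = 0 := by
  -- Realising `z` and `c` by a section turns the contact vector into a velocity, on which holonomic
  -- forms vanish by definition.
  obtain ⟨γ, t, ht, hs, rfl, rfl⟩ := exists_section_contactVec hφ z hz c
  have he := adaptedChart_mem_atlas (k := k) hφ
  have hsrc := LocalSection.lift_mem_source (k := k) hφ ht hs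
  rw [← LocalSection.adaptedChart_lift hφ ht hs, (adaptedChart k φ hφ).left_inv hsrc] at hzU
  have h := DFunLike.congr_fun (hη _ hzU _ (velocity_mem_holonomicSpace ht)) (fun i =>
    mfderiv 𝓘(ℝ, JetModel n k) 𝓘(ℝ, JetModel n k) (adaptedChart k φ hφ).symm
      (adaptedChart k φ hφ (γ.lift k t)) (v i))
  change η (γ.lift k t) (Matrix.vecCons _ _) = 0 at h
  rw [apply_eq_inChart he η hsrc] at h
  rw [← h, ← LocalSection.adaptedChart_lift hφ ht hs]
  congr 1
  funext i
  refine Fin.cases ?_ (fun j => ?_) i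
  · exact (LocalSection.mfderiv_velocity hφ ht hs).symm
  · have := (mdifferentiable_atlas he).comp_symm_deriv ((adaptedChart k φ hφ).map_source hsrc)
    rw [(adaptedChart k φ hφ).left_inv hsrc] at this
    exact (DFunLike.congr_fun this (v j)).symm

/-- Source forms annihilate the vectors without components along `∂/∂t` and `∂/∂y_{(0)}`. -/
lemma IsSourceForm.inChart_apply {σ : JetForm n M k 2} (hσ : IsSourceForm σ) {z : JetModel n k}
    (hz : z ∈ (adaptedChart k φ hφ).target) {w : JetModel n k} (hw1 : w.1 = 0) (hw2 : w.2 0 = 0)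
    (v : Fin 1 → JetModel n k) :
    inChart (adaptedChart k φ hφ) σ z (Matrix.vecCons w v) = 0 := by
  have he := adaptedChart_mem_atlas (k := k) hφ
  set e := adaptedChart k φ hφ with hedef
  -- In the chart the projection to `E` is `(id × φ⁻¹) ∘ ℓ`, where `ℓ` keeps `(t, y_(0))`. Hence
  -- `w`, which `ℓ` kills, represents a vertical vector.
  let ℓ₁ : JetModel n k →L[ℝ] ℝ := ContinuousLinearMap.fst ℝ ℝ _
  let ℓ₂ : JetModel n k →L[ℝ] Coord n :=
    (ContinuousLinearMap.proj (0 : Fin (k + 1))).comp (ContinuousLinearMap.snd ℝ ℝ _)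
  let ℓ : JetModel n k → ℝ × Coord n := fun z => (ℓ₁ z, ℓ₂ z)
  have hℓ₁ : MDifferentiableAt 𝓘(ℝ, JetModel n k) 𝓘(ℝ, ℝ) ℓ₁ z :=
    ℓ₁.differentiableAt.mdifferentiableAt
  have hℓ₂ : MDifferentiableAt 𝓘(ℝ, JetModel n k) (𝓡 n) ℓ₂ z :=
    ℓ₂.differentiableAt.mdifferentiableAt
  let g : ℝ × Coord n → ℝ × M := Prod.map id φ.symm
  have hφt : MDifferentiableAt (𝓡 n) (𝓡 n) φ.symm (z.2 0) :=
    (contMDiffAt_symm_of_mem_maximalAtlas hφ hz).mdifferentiableAt (by simp)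
  have hg : MDifferentiableAt (𝓘(ℝ, ℝ).prod (𝓡 n)) (𝓘(ℝ, ℝ).prod (𝓡 n)) g (ℓ z) :=
    mdifferentiableAt_id.prodMap hφt
  have hℓ : MDifferentiableAt 𝓘(ℝ, JetModel n k) (𝓘(ℝ, ℝ).prod (𝓡 n)) ℓ z :=
    hℓ₁.prodMk hℓ₂
  have hgl := hg.comp z hℓ
  have hpt : ∀ u ∈ e.source, JetSpace.toE u = (g ∘ ℓ) (e u) := by
    intro u hu
    obtain ⟨p, rfl⟩ : ∃ p, u = jetMk k p := ⟨Quotient.out u, (Quotient.out_eq u).symm⟩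
    have h : e (jetMk k p) = _ := adaptedCoord_mk hφ p hu
    rw [h]
    refine Prod.ext rfl ?_
    change p.point = φ.symm (p.coordDeriv φ 0)
    exact (φ.left_inv hu).symm
  have hee : e (e.symm z) = z := e.right_inv hz
  have hE : MDifferentiableAt 𝓘(ℝ, JetModel n k) (𝓘(ℝ, ℝ).prod (𝓡 n)) JetSpace.toE (e.symm z) := by
    have h1 : MDifferentiableAt 𝓘(ℝ, JetModel n k) (𝓘(ℝ, ℝ).prod (𝓡 n)) ((g ∘ ℓ) ∘ e)
        (e.symm z) := by
      refine MDifferentiableAt.comp (I' := 𝓘(ℝ, JetModel n k)) _ ?_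
        ((mdifferentiable_atlas he).mdifferentiableAt (e.map_target hz))
      rwa [hee]
    refine h1.congr_of_eventuallyEq ?_
    filter_upwards [e.open_source.mem_nhds (e.map_target hz)] with u hu using hpt u hu
  have hcomp : mfderiv 𝓘(ℝ, JetModel n k) (𝓘(ℝ, ℝ).prod (𝓡 n)) (JetSpace.toE ∘ e.symm) z =
      mfderiv 𝓘(ℝ, JetModel n k) (𝓘(ℝ, ℝ).prod (𝓡 n)) (g ∘ ℓ) z := by
    refine Filter.EventuallyEq.mfderiv_eq ?_
    filter_upwards [e.open_target.mem_nhds hz] with x hx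
    change JetSpace.toE (e.symm x) = _
    rw [hpt _ (e.map_target hx), e.right_inv hx]
  have hvert : mfderiv 𝓘(ℝ, JetModel n k) (𝓘(ℝ, ℝ).prod (𝓡 n)) JetSpace.toE (e.symm z)
      (mfderiv 𝓘(ℝ, JetModel n k) 𝓘(ℝ, JetModel n k) e.symm z w) = 0 := by
    rw [mfderiv_comp z hE ((mdifferentiable_atlas he).mdifferentiableAt_symm hz),
      mfderiv_comp z hg hℓ] at hcomp
    refine (DFunLike.congr_fun hcomp w).trans ?_
    have hw : mfderiv 𝓘(ℝ, JetModel n k) (𝓘(ℝ, ℝ).prod (𝓡 n)) ℓ z w = 0 := by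
      rw [mfderiv_prodMk hℓ₁ hℓ₂]
      refine Prod.ext ?_ ?_
      · change mfderiv 𝓘(ℝ, JetModel n k) 𝓘(ℝ, ℝ) ℓ₁ z w = 0
        rw [mfderiv_eq_fderiv, ℓ₁.fderiv]
        exact hw1
      · change mfderiv 𝓘(ℝ, JetModel n k) (𝓡 n) ℓ₂ z w = 0
        rw [mfderiv_eq_fderiv, ℓ₂.fderiv]
        exact hw2
    change (mfderiv _ _ g (ℓ z)) ((mfderiv _ _ ℓ z) w) = 0
    rw [hw]
    exact map_zero _
  have h := DFunLike.congr_fun (hσ _ _ hvert) (fun i =>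
    mfderiv 𝓘(ℝ, JetModel n k) 𝓘(ℝ, JetModel n k) e.symm z (v i))
  refine Eq.trans ?_ h
  change (σ (e.symm z)) _ = (σ (e.symm z)) _
  congr 1
  funext i
  refine Fin.cases rfl (fun j => rfl) i

end Lifts

/-! ### One-forms as covector fields -/

section Covectors

variable {V : Type*} [NormedAddCommGroup V] [NormedSpace ℝ V]

variable (V) in
/-- Alternating `1`-forms as continuous linear forms. -/
def covec : (V [⋀^Fin 1]→L[ℝ] ℝ) →L[ℝ] (V →L[ℝ] ℝ) :=
  ((ContinuousMultilinearMap.ofSubsingletonₗᵢ ℝ V (G' := ℝ) (0 : Fin 1)).symm.toContinuousLinearEquiv :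
    _ →L[ℝ] _).comp (ContinuousAlternatingMap.toContinuousMultilinearMapCLM ℝ)

@[simp] lemma covec_apply (η : V [⋀^Fin 1]→L[ℝ] ℝ) (w : V) : covec V η w = η (fun _ => w) := rfl

/-- Cartan's formula for the constant vector fields `X` and `Y`, whose bracket is zero. -/
lemma extDeriv_eq_covec {μ : V → V [⋀^Fin 1]→L[ℝ] ℝ} {z : V} (hμ : DifferentiableAt ℝ μ z)
    (X Y : V) : extDeriv μ z ![X, Y] =
      fderiv ℝ (fun z => covec V (μ z)) z X Y - fderiv ℝ (fun z => covec V (μ z)) z Y X := by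
  have h : ∀ X Y, fderiv ℝ (fun z => covec V (μ z)) z X Y = fderiv ℝ μ z X (fun _ => Y) := by
    intro X Y
    have := ((covec V).hasFDerivAt.comp z hμ.hasFDerivAt).fderiv
    change fderiv ℝ (covec V ∘ μ) z X Y = _
    rw [this]
    rfl
  rw [h, h, extDeriv, ContinuousAlternatingMap.alternatizeUncurryFin_apply, Fin.sum_univ_two]
  have e0 : Fin.removeNth (0 : Fin 2) ![X, Y] = fun _ => Y := by ext i; fin_cases i; rfl
  have e1 : Fin.removeNth (1 : Fin 2) ![X, Y] = fun _ => X := by ext i; fin_cases i; rfl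
  simp [e0, e1, sub_eq_add_neg]

end Covectors

/-! ### Contact vectors -/

section Contact

variable {n k : ℕ}

variable (n k) in
/-- The linear part of the total derivative `z ↦ totalDerivVec z`. -/
def shift : JetModel n k →L[ℝ] JetModel n k :=
  (0 : JetModel n k →L[ℝ] ℝ).prod (ContinuousLinearMap.pi fun a =>
    if h : (a : ℕ) + 1 < k + 1 then
      (ContinuousLinearMap.proj (⟨a + 1, h⟩ : Fin (k + 1))).comp (ContinuousLinearMap.snd ℝ ℝ _)
    else 0)

/-- Contact vectors depend affinely on the point, so differentiating them in direction `X` gives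
`shift n k X`. -/
lemma contactVec_eq_shift (z : JetModel n k) (c : Coord n) :
    contactVec z c = shift n k z + (1, Pi.single (Fin.last k) c) := by
  refine Prod.ext ?_ (funext fun a => ?_)
  · simp [contactVec, totalDerivVec, shift]
  · simp only [contactVec, totalDerivVec, shift, Prod.snd_add, Pi.add_apply]
    congr 1
    change _ = (if h : (a : ℕ) + 1 < k + 1 then
      (ContinuousLinearMap.proj (⟨a + 1, h⟩ : Fin (k + 1))).comp (ContinuousLinearMap.snd ℝ ℝ _)
      else (0 : JetModel n k →L[ℝ] Coord n)) z
    split_ifs <;> rfl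

lemma shift_snd (X : JetModel n k) (a : Fin (k + 1)) :
    (shift n k X).2 a = if h : (a : ℕ) + 1 < k + 1 then X.2 ⟨a + 1, h⟩ else 0 := by
  change (if h : (a : ℕ) + 1 < k + 1 then
      (ContinuousLinearMap.proj (⟨a + 1, h⟩ : Fin (k + 1))).comp (ContinuousLinearMap.snd ℝ ℝ _)
      else (0 : JetModel n k →L[ℝ] Coord n)) X = _
  split_ifs <;> rfl

lemma shift_partialVec_zero (i : Fin n) : shift n k (partialVec i 0) = 0 := by
  refine Prod.ext rfl (funext fun a => ?_)
  rw [shift_snd]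
  split_ifs with h
  · simp [partialVec]
  · rfl

/-- This is the commutator of `∂/∂y_(a+1)` with `d/dt`; it is what links consecutive momenta. -/
lemma shift_partialVec_succ (i : Fin n) (a : ℕ) (h : a + 1 < k + 1) :
    shift n k (partialVec i ⟨a + 1, h⟩) = partialVec i ⟨a, by omega⟩ := by
  refine Prod.ext rfl (funext fun b => ?_)
  rw [shift_snd]
  by_cases hb : (b : ℕ) = a
  · subst hb
    simp [partialVec, h]
  · have h2 : b ≠ ⟨a, by omega⟩ := fun h => hb (by rw [h])
    split_ifs with h1
    · have h3 : (⟨b + 1, h1⟩ : Fin (k + 1)) ≠ ⟨a + 1, h⟩ := by simpa [Fin.ext_iff] using hb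
      simp [partialVec, Pi.single_eq_of_ne h3, Pi.single_eq_of_ne h2]
    · simp [partialVec, Pi.single_eq_of_ne h2]

/-- A covector whose value on `contactVec z c` is independent of `c` therefore kills the top
vertical directions. -/
lemma partialVec_last (z : JetModel n k) (i : Fin n) :
    partialVec i (Fin.last k) = contactVec z (EuclideanSpace.single i 1) - contactVec z 0 := by
  simp [contactVec, partialVec]

/-- Expansion of a covector on a vector without `∂/∂t`-component. -/
lemma covector_eq_sum (S : JetModel n k →L[ℝ] ℝ) {w : JetModel n k} (hw : w.1 = 0) :
    S w = ∑ a : Fin (k + 1), ∑ i : Fin n, w.2 a i * S (partialVec i a) := by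
  have h : w = ∑ a : Fin (k + 1), ∑ i : Fin n, w.2 a i • (partialVec i a : JetModel n k) := by
    refine Prod.ext ?_ (funext fun b => ?_)
    · simp [Prod.fst_sum, partialVec, hw]
    · ext j
      simp only [Prod.snd_sum, Finset.sum_apply, partialVec, Prod.smul_snd, Pi.smul_apply]
      rw [Finset.sum_eq_single b (fun a _ hab => ?_) (by simp)]
      · simp [Pi.single_apply]
      · simp [Pi.single_eq_of_ne hab.symm]
  conv_lhs => rw [h]
  simp [map_sum]

/-- Differentiation of the values of a covector field on contact vectors. -/
lemma fderiv_contact {S : JetModel n k → JetModel n k →L[ℝ] ℝ} {ℓ : JetModel n k → ℝ}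
    {z : JetModel n k} (hS : DifferentiableAt ℝ S z) (c : Coord n)
    (h : ∀ᶠ x in 𝓝 z, S x (contactVec x c) = ℓ x) (X : JetModel n k) :
    fderiv ℝ S z X (contactVec z c) = fderiv ℝ ℓ z X - S z (shift n k X) := by
  have h1 : HasFDerivAt (fun x : JetModel n k => contactVec x c) (shift n k) z := by
    have : (fun x : JetModel n k => contactVec x c) =
      fun x => shift n k x + (1, Pi.single (Fin.last k) c) := funext fun x => contactVec_eq_shift x c
    rw [this]
    exact (shift n k).hasFDerivAt.add_const _
  -- Product rule: besides the wanted term, the moving contact vector contributes `S z (shift n k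
  -- X)`.
  have h2 := hS.hasFDerivAt.clm_apply h1
  have h3 : ℓ =ᶠ[𝓝 z] fun x => S x (contactVec x c) := h.mono fun _ hx => hx.symm
  rw [h3.fderiv_eq, h2.fderiv]
  simp

end Contact

/-! ### The recursion for the momenta -/

/-- Telescoping: if `l_0 = s + p_0'`, `l_{a+1} = p_a + p_{a+1}'` and `p_k = 0`, the alternating sum
of the derivatives of the `l_a` is `s`. -/
lemma sum_alternating_iteratedDeriv {p l : ℕ → ℝ → ℝ} {s : ℝ → ℝ} {t : ℝ} {k : ℕ}
    (hp : ∀ a, ContDiffAt ℝ ∞ (p a) t) (h0 : ∀ᶠ x in 𝓝 t, l 0 x = s x + deriv (p 0) x)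
    (hl : ∀ a < k, ∀ᶠ x in 𝓝 t, l (a + 1) x = p a x + deriv (p (a + 1)) x)
    (hk : ∀ᶠ x in 𝓝 t, p k x = 0) :
    ∑ a ∈ Finset.range (k + 1), (-1 : ℝ) ^ a * iteratedDeriv a (l a) t = s t := by
  -- The partial sum up to `j` leaves one uncancelled derivative of `p j`; at `j = k` it is zero.
  have key : ∀ j ≤ k, ∑ a ∈ Finset.range (j + 1), (-1 : ℝ) ^ a * iteratedDeriv a (l a) t =
      s t + (-1) ^ j * iteratedDeriv (j + 1) (p j) t := by
    intro j
    induction j with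
    | zero =>
      intro _
      simp [h0.self_of_nhds, iteratedDeriv_one]
    | succ j ih =>
      intro hj
      have hd : ContDiffAt ℝ ∞ (deriv (p (j + 1))) t := by
        simpa [iteratedDeriv_one] using contDiffAt_iteratedDeriv (hp (j + 1)) 1
      have he : l (j + 1) =ᶠ[𝓝 t] p j + deriv (p (j + 1)) := hl j (by omega)
      rw [Finset.sum_range_succ, ih (by omega), he.iteratedDeriv_eq,
        iteratedDeriv_add ((hp j).of_le (by exact_mod_cast le_top))
          (hd.of_le (by exact_mod_cast le_top)),
        ← iteratedDeriv_succ']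
      ring
  rw [key k le_rfl]
  have hz : p k =ᶠ[𝓝 t] fun _ => 0 := hk
  rw [hz.iteratedDeriv_eq]
  simp

/-- If moreover the `l_a` with `a > m + 1` vanish, so do the `p_a` with `a > m`. -/
lemma momenta_eventually_zero {p l : ℕ → ℝ → ℝ} {t : ℝ} {k m : ℕ}
    (hl : ∀ a < k, ∀ᶠ x in 𝓝 t, l (a + 1) x = p a x + deriv (p (a + 1)) x)
    (hk : ∀ᶠ x in 𝓝 t, p k x = 0)
    (hz : ∀ a ≤ k, m + 1 < a → ∀ᶠ x in 𝓝 t, l a x = 0) :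
    ∀ a ≤ k, m < a → ∀ᶠ x in 𝓝 t, p a x = 0 := by
  intro a hak
  -- Descent from `p k = 0`: once `p (a + 1)` vanishes near `t`, so does its derivative, and the
  -- relation reduces to `l (a + 1) = p a`.
  induction hak using Nat.decreasingInduction with
  | self => exact fun _ => hk
  | of_succ a hak ih =>
    intro hma
    have hd : p (a + 1) =ᶠ[𝓝 t] fun _ => 0 := ih (by omega)
    filter_upwards [hl a hak, hd.deriv, hz (a + 1) hak (by omega)] with x h1 h2 h3
    rw [h3, h2] at h1
    simpa using h1.symm

/-! ### Lagrangians and source forms in adapted coordinates -/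

section Euler

variable {n : ℕ} {M : Type*} [TopologicalSpace M] [ChartedSpace (Coord n) M]
  [IsManifold (𝓡 n) ∞ M] {k : ℕ} {φ : OpenPartialHomeomorph M (Coord n)}
  {γ : LocalSection n M} {t : ℝ}

lemma mdifferentiableAt_time (u : JetSpace n M k) :
    MDifferentiableAt 𝓘(ℝ, JetModel n k) 𝓘(ℝ, ℝ) JetSpace.time u := by
  have hd : MDifferentiableAt 𝓘(ℝ, JetModel n k) 𝓘(ℝ, ℝ)
      (Prod.fst ∘ chartAt (JetModel n k) u) u :=
    MDifferentiableAt.comp (I' := 𝓘(ℝ, JetModel n k)) u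
      (differentiableAt_fst (𝕜 := ℝ)).mdifferentiableAt
      ((mdifferentiable_atlas (chart_mem_atlas (JetModel n k) u)).mdifferentiableAt
        (mem_chart_source _ u))
  exact hd

/-- Time composed with a lift is the identity near `t`, so `dt` takes the value 1 on the velocity.
-/
lemma lagrangianForm_velocity (L : JetSpace n M k → ℝ) (ht : t ∈ γ.dom) :
    lagrangianForm L (γ.lift k t) (fun _ => γ.velocity k t) = L (γ.lift k t) := by
  have h1 : mfderiv 𝓘(ℝ, JetModel n k) 𝓘(ℝ, ℝ) JetSpace.time (γ.lift k t) (γ.velocity k t) =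
      (1 : ℝ) := by
    have hc := mfderiv_comp t (mdifferentiableAt_time (γ.lift k t))
      (LocalSection.mdifferentiableAt_lift ht)
    have he : JetSpace.time ∘ γ.lift k =ᶠ[𝓝 t] id := by
      filter_upwards [γ.isOpen_dom.mem_nhds ht] with s hs
      change (γ.lift k s).time = s
      rw [LocalSection.lift_of_mem hs]
      rfl
    rw [he.mfderiv_eq] at hc
    have h2 := DFunLike.congr_fun hc (1 : ℝ)
    rw [mfderiv_id] at h2
    exact h2.symm
  exact (congrArg (L (γ.lift k t) * ·) h1).trans (mul_one _)

/-- The differential is local. For forms of degree 1 this removes the exact term from variational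
equivalence, since there `μ` is a holonomic `0`-form, zero on the open set. -/
lemma extD_eq_zero_of_isOpen {V : Type*} [NormedAddCommGroup V] [NormedSpace ℝ V]
    {N : Type*} [TopologicalSpace N] [ChartedSpace V N] {p : ℕ} {η : DiffForm V N p} {U : Set N}
    (hU : IsOpen U) (h : ∀ u ∈ U, η u = 0) {u : N} (hu : u ∈ U) : extD η u = 0 := by
  set c := chartAt V u
  have hcu : u ∈ c.source := mem_chart_source V u
  have hev : inChart c η =ᶠ[𝓝 (c u)] fun _ => 0 := by
    have hm : c u ∈ c.target ∩ c.symm ⁻¹' U := ⟨c.map_source hcu, by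
      change c.symm (c u) ∈ U
      rwa [c.left_inv hcu]⟩
    filter_upwards [(c.isOpen_inter_preimage_symm hU).mem_nhds hm] with z hz
    change (η (c.symm z)).compContinuousLinearMap _ = 0
    rw [h _ hz.2]
    rfl
  change (extDeriv (inChart c η) (c u)).compContinuousLinearMap _ = 0
  rw [hev.extDeriv_eq]
  have : extDeriv (fun _ : V => (0 : V [⋀^Fin p]→L[ℝ] ℝ)) (c u) = 0 := by
    rw [extDeriv, fderiv_fun_const]
    exact map_zero (ContinuousAlternatingMap.alternatizeUncurryFinCLM ℝ V ℝ)
  rw [this]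
  rfl

lemma IsHolonomicOn.apply_velocity {η : JetForm n M k 1} {U : Set (JetSpace n M k)}
    (hη : IsHolonomicOn η U) (ht : t ∈ γ.dom) (hU : γ.lift k t ∈ U) :
    η (γ.lift k t) (fun _ => γ.velocity k t) = 0 := by
  have h := DFunLike.congr_fun (hη _ hU _ (velocity_mem_holonomicSpace ht)) ![]
  refine Eq.trans ?_ h
  change η _ _ = η _ _
  congr 1
  funext i
  fin_cases i
  rfl

lemma IsLocalLagrangian.apply_velocity {r : ℕ} {α : JetForm n M k 1} {U : Set (JetSpace n M k)}
    {L : JetSpace n M k → ℝ} (h : IsLocalLagrangian r α U L) (ht : t ∈ γ.dom)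
    (hU : γ.lift k t ∈ U) : α (γ.lift k t) (fun _ => γ.velocity k t) = L (γ.lift k t) := by
  obtain ⟨lam, mu, -, -, hlam, hmu, heq⟩ := h.equivalent
  have h1 := heq _ hU
  rw [extD_eq_zero_of_isOpen h.isOpen hmu hU, add_zero, sub_eq_iff_eq_add] at h1
  rw [h1]
  change lam _ _ + lagrangianForm L _ _ = _
  rw [hlam.apply_velocity ht hU, lagrangianForm_velocity L ht, zero_add]

/-- A form `β` which represents the class of `α` (it has the same values on the velocities of
lifts) and whose exterior differential agrees with `σ` on holonomic vectors. -/
structure IsLepageRepresentative (α : JetForm n M k 1) (σ : JetForm n M k 2)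
    (β : JetForm n M k 1) : Prop where
  smooth : SmoothOn β Set.univ
  apply_velocity : ∀ (γ : LocalSection n M) (t : ℝ), t ∈ γ.dom →
    β (γ.lift k t) (fun _ => γ.velocity k t) = α (γ.lift k t) (fun _ => γ.velocity k t)
  source : ∀ (φ : OpenPartialHomeomorph M (Coord n))
    (hφ : φ ∈ IsManifold.maximalAtlas (𝓡 n) ∞ M), ∀ z ∈ (adaptedChart k φ hφ).target,
    ∀ (X : JetModel n k) (c : Coord n),
      inChart (adaptedChart k φ hφ) σ z ![X, contactVec z c] =
        extDeriv (inChart (adaptedChart k φ hφ) β) z ![X, contactVec z c]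

lemma map_swap_two {V : Type*} [NormedAddCommGroup V] [NormedSpace ℝ V]
    (η : V [⋀^Fin 2]→L[ℝ] ℝ) (X Y : V) : η ![X, Y] = -η ![Y, X] := by
  have h := η.toAlternatingMap.map_swap ![Y, X] (show (0 : Fin 2) ≠ 1 by simp)
  rw [show ![Y, X] ∘ Equiv.swap (0 : Fin 2) 1 = ![X, Y] by
    ext i; fin_cases i <;> simp] at h
  exact h

/-- The representative is `α + μ`, with `μ` the holonomic `1`-form of the equivalence between `σ`
and `dα`. Then `σ = d(α + μ) + λ`, and `λ` disappears when one argument is a contact vector. -/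
lemma exists_lepageRepresentative {α : JetForm n M k 1} (hα : SmoothOn α Set.univ)
    {σ : JetForm n M k 2} (hclass : VariationallyEquivalentOn Set.univ σ (extD α)) :
    ∃ β, IsLepageRepresentative α σ β := by
  obtain ⟨lam, mu, -, hmus, hlam, hmu, heq⟩ := hclass
  have hadd : ∀ e : OpenPartialHomeomorph (JetSpace n M k) (JetModel n k),
      inChart e (fun u => α u + mu u : JetForm n M k 1) = inChart e α + inChart e mu :=
    fun e => rfl
  refine ⟨fun u => α u + mu u, fun e he => ?_, fun γ t ht => ?_, fun φ hφ z hz X c => ?_⟩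
  · rw [hadd]
    exact (hα e he).add (hmus e he)
  · change α _ _ + mu _ _ = _
    rw [hmu.apply_velocity ht (Set.mem_univ _), add_zero]
  · have he := adaptedChart_mem_atlas (k := k) hφ
    set e := adaptedChart k φ hφ with hedef
    have hσ : inChart e σ z = inChart e lam z + inChart e (extD mu) z + inChart e (extD α) z := by
      have h := heq (e.symm z) (Set.mem_univ _)
      rw [sub_eq_iff_eq_add] at h
      change (σ (e.symm z)).compContinuousLinearMap _ = _
      rw [h]
      rfl
    have hlam0 : inChart e lam z ![X, contactVec z c] = 0 := by
      have := hlam.inChart_apply hφ hz (Set.mem_univ _) c ![X]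
      rw [map_swap_two, neg_eq_zero]
      exact this
    rw [hσ, hadd, extDeriv_add
      ((hα.contDiffAt_inChart isOpen_univ he hz (Set.mem_univ _)).differentiableAt (by simp))
      ((hmus.contDiffAt_inChart isOpen_univ he hz (Set.mem_univ _)).differentiableAt (by simp)),
      inChart_extD isOpen_univ hα he hz (Set.mem_univ _),
      inChart_extD isOpen_univ hmus he hz (Set.mem_univ _)]
    change inChart e lam z _ + extDeriv _ z _ + extDeriv _ z _ = extDeriv _ z _ + extDeriv _ z _
    rw [hlam0]
    ring

variable (hφ : φ ∈ IsManifold.maximalAtlas (𝓡 n) ∞ M)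

/-- The covector field of a `1`-form in adapted coordinates. -/
def coordCovec (η : JetForm n M k 1) (z : JetModel n k) : JetModel n k →L[ℝ] ℝ :=
  covec (JetModel n k) (inChart (adaptedChart k φ hφ) η z)

lemma contDiffAt_coordCovec {η : JetForm n M k 1} (hη : SmoothOn η Set.univ) {z : JetModel n k}
    (hz : z ∈ (adaptedChart k φ hφ).target) : ContDiffAt ℝ ∞ (coordCovec hφ η) z :=
  (covec (JetModel n k)).contDiff.contDiffAt.comp z
    (hη.contDiffAt_inChart isOpen_univ (adaptedChart_mem_atlas hφ) hz (Set.mem_univ _))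

lemma coordCovec_velocity (η : JetForm n M k 1) (ht : t ∈ γ.dom) (hs : γ.curve t ∈ φ.source) :
    η (γ.lift k t) (fun _ => γ.velocity k t) =
      coordCovec hφ η (prolong k (fun s => φ (γ.curve s)) t)
        (contactVec (prolong k (fun s => φ (γ.curve s)) t)
          (iteratedDeriv (k + 1) (fun s => φ (γ.curve s)) t)) :=
  JetVar.apply_velocity hφ η ht hs

variable {α β : JetForm n M k 1} {σ : JetForm n M k 2}

lemma IsLepageRepresentative.source_eq (hβ : IsLepageRepresentative α σ β) {z : JetModel n k}
    (hz : z ∈ (adaptedChart k φ hφ).target) (X : JetModel n k) (c : Coord n) :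
    inChart (adaptedChart k φ hφ) σ z ![X, contactVec z c] =
      fderiv ℝ (coordCovec hφ β) z X (contactVec z c) -
        fderiv ℝ (coordCovec hφ β) z (contactVec z c) X := by
  rw [hβ.source φ hφ z hz X c]
  exact extDeriv_eq_covec ((hβ.smooth.contDiffAt_inChart isOpen_univ (adaptedChart_mem_atlas hφ) hz
    (Set.mem_univ _)).differentiableAt (by simp)) X _

/-- A section with the jet `z` and next derivative `c` has this contact vector as velocity, where
`β`, `α` and `L dt` agree. The right-hand side does not contain `c`, which will force the top
momentum to vanish. -/
lemma IsLepageRepresentative.coordCovec_contactVec (hβ : IsLepageRepresentative α σ β) {r : ℕ}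
    {U : Set (JetSpace n M k)} {L : JetSpace n M k → ℝ} (h : IsLocalLagrangian r α U L)
    {z : JetModel n k} (hz : z ∈ (adaptedChart k φ hφ).target)
    (hzU : (adaptedChart k φ hφ).symm z ∈ U) (c : Coord n) :
    coordCovec hφ β z (contactVec z c) = (L ∘ (adaptedChart k φ hφ).symm) z := by
  obtain ⟨γ, t, ht, hs, rfl, rfl⟩ := exists_section_contactVec hφ z hz c
  rw [← coordCovec_velocity hφ β ht hs, hβ.apply_velocity γ t ht]
  have hl : (adaptedChart k φ hφ).symm (prolong k (fun s => φ (γ.curve s)) t) = γ.lift k t := by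
    rw [← LocalSection.adaptedChart_lift hφ ht hs]
    exact (adaptedChart k φ hφ).left_inv (LocalSection.lift_mem_source hφ ht hs)
  rw [Function.comp_apply, hl]
  rw [hl] at hzU
  exact h.apply_velocity ht hzU

/-- The fundamental identity between the source form, the Lagrangian and the momenta. -/
lemma IsLepageRepresentative.source_eq_lagrangian (hβ : IsLepageRepresentative α σ β) {r : ℕ}
    {U : Set (JetSpace n M k)} {L : JetSpace n M k → ℝ} (h : IsLocalLagrangian r α U L)
    {z : JetModel n k} (hz : z ∈ (adaptedChart k φ hφ).target)
    (hzU : (adaptedChart k φ hφ).symm z ∈ U) (X : JetModel n k) (c : Coord n) :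
    inChart (adaptedChart k φ hφ) σ z ![X, contactVec z c] =
      fderiv ℝ (L ∘ (adaptedChart k φ hφ).symm) z X - coordCovec hφ β z (shift n k X) -
        fderiv ℝ (coordCovec hφ β) z (contactVec z c) X := by
  rw [hβ.source_eq hφ hz, fderiv_contact ((contDiffAt_coordCovec hφ hβ.smooth hz).differentiableAt
    (by simp)) c (ℓ := L ∘ (adaptedChart k φ hφ).symm)]
  filter_upwards [(isOpen_chart_preimage (adaptedChart k φ hφ) h.isOpen).mem_nhds ⟨hz, hzU⟩]
    with x hx
  exact hβ.coordCovec_contactVec hφ h hx.1 hx.2 c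

lemma IsSourceForm.inChart_right (hσ : IsSourceForm σ) {z : JetModel n k}
    (hz : z ∈ (adaptedChart k φ hφ).target) {w : JetModel n k} (hw1 : w.1 = 0) (hw2 : w.2 0 = 0)
    (X : JetModel n k) : inChart (adaptedChart k φ hφ) σ z ![X, w] = 0 := by
  rw [map_swap_two, neg_eq_zero]
  exact hσ.inChart_apply hφ hz hw1 hw2 ![X]

/-- Changing `d/dt` by a multiple of `∂/∂y_(k)` does not affect a source form, so the truncated
total derivative may be replaced by the true velocity of any lift through `u`. -/
lemma sourceCoeff_eq (hk : 1 ≤ k) (hσ : IsSourceForm σ) (i : Fin n) {u : JetSpace n M k}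
    (hu : u ∈ (adaptedChart k φ hφ).source) (c : Coord n) :
    sourceCoeff φ hφ σ i u = inChart (adaptedChart k φ hφ) σ (adaptedChart k φ hφ u)
      ![partialVec i 0, contactVec (adaptedChart k φ hφ u) c] := by
  set e := adaptedChart k φ hφ with hedef
  have h1 : sourceCoeff φ hφ σ i u = inChart e σ (e u) ![partialVec i 0, totalDerivVec (e u)] := by
    change (σ u) _ = (σ (e.symm (e u))) _
    have h := form_apply_congr σ (e.left_inv hu)
      (fun j => mfderiv 𝓘(ℝ, JetModel n k) 𝓘(ℝ, JetModel n k) e.symm (e u)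
        ((![partialVec i 0, totalDerivVec (e u)] : Fin 2 → JetModel n k) j))
    refine Eq.trans ?_ h.symm
    congr 1
    funext j
    fin_cases j <;> rfl
  -- Here `k ≥ 1` matters: for `k = 0` the top direction would not be vertical over `E`.
  have h0 : (0 : Fin (k + 1)) ≠ Fin.last k := by
    intro h
    have := congrArg Fin.val h
    simp at this
    omega
  have h2 := hσ.inChart_right hφ (e.map_source hu) (w := (0, Pi.single (Fin.last k) c)) rfl
    (by simp [Pi.single_eq_of_ne h0]) (partialVec i 0)
  have h3 := (inChart e σ (e u)).toAlternatingMap.map_update_add ![partialVec i 0, 0] 1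
    (totalDerivVec (e u)) (0, Pi.single (Fin.last k) c)
  have hupd : ∀ w : JetModel n k,
      Function.update (![partialVec i 0, 0] : Fin 2 → JetModel n k) 1 w = ![partialVec i 0, w] := by
    intro w
    ext j : 1
    fin_cases j <;> simp
  rw [hupd, hupd, hupd] at h3
  change inChart e σ (e u) _ = inChart e σ (e u) _ + inChart e σ (e u) _ at h3
  rw [h1, contactVec, h3, h2, add_zero]

end Euler

/-! ### Momenta along a section and the Euler–Lagrange expressions -/

section EulerLagrange

variable {n : ℕ} {M : Type*} [TopologicalSpace M] [ChartedSpace (Coord n) M]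
  [IsManifold (𝓡 n) ∞ M] {k : ℕ} {φ : OpenPartialHomeomorph M (Coord n)}
  (hφ : φ ∈ IsManifold.maximalAtlas (𝓡 n) ∞ M)
  {γ : LocalSection n M} {t : ℝ} {α β : JetForm n M k 1} {σ : JetForm n M k 2}

/-- A source form is determined on a holonomic vector by its coefficients `σ_i`. -/
lemma interiorProduct_velocity_eq_zero_iff (hk : 1 ≤ k) (hσ : IsSourceForm σ) (ht : t ∈ γ.dom)
    (hs : γ.curve t ∈ φ.source) :
    interiorProduct σ (γ.lift k t) (γ.velocity k t) = 0 ↔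
      ∀ i, sourceCoeff φ hφ σ i (γ.lift k t) = 0 := by
  have he := adaptedChart_mem_atlas (k := k) hφ
  have hu := LocalSection.lift_mem_source (k := k) hφ ht hs
  have hvel := LocalSection.mfderiv_velocity (k := k) hφ ht hs
  set u := γ.lift k t with hudef
  set e := adaptedChart k φ hφ with hedef
  set c := iteratedDeriv (k + 1) (fun s => φ (γ.curve s)) t
  have hz : e u ∈ e.target := e.map_source hu
  have hinv : ∀ w : JetModel n k, (mfderiv 𝓘(ℝ, JetModel n k) 𝓘(ℝ, JetModel n k) e u
      (mfderiv 𝓘(ℝ, JetModel n k) 𝓘(ℝ, JetModel n k) e.symm (e u) w : JetModel n k) :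
        JetModel n k) = w := by
    intro w
    have := (mdifferentiable_atlas he).comp_symm_deriv hz
    rw [e.left_inv hu] at this
    exact DFunLike.congr_fun this w
  have happ : ∀ w : Fin 1 → JetModel n k, interiorProduct σ u (γ.velocity k t) w =
      inChart e σ (e u) ![contactVec (e u) c,
        (mfderiv 𝓘(ℝ, JetModel n k) 𝓘(ℝ, JetModel n k) e u (w 0) : JetModel n k)] := by
    intro w
    change σ u (Matrix.vecCons (γ.velocity k t) w) = _
    rw [apply_eq_inChart he σ hu]
    congr 1
    funext j
    fin_cases j
    · exact hvel
    · rfl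
  constructor
  · intro h i
    have h1 := happ (fun _ => mfderiv 𝓘(ℝ, JetModel n k) 𝓘(ℝ, JetModel n k) e.symm (e u)
      (partialVec i 0))
    rw [h, hinv] at h1
    rw [sourceCoeff_eq hφ hk hσ i hu c, map_swap_two, ← h1]
    exact neg_zero
  · intro h
    refine ContinuousAlternatingMap.ext fun w => (happ w).trans ?_
    change _ = (0 : ℝ)
    set X : JetModel n k := mfderiv 𝓘(ℝ, JetModel n k) 𝓘(ℝ, JetModel n k) e u (w 0)
    let S : JetModel n k →L[ℝ] ℝ :=
      covec (JetModel n k) ((inChart e σ (e u)).curryLeft (contactVec (e u) c))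
    have hSapp : ∀ Y, S Y = inChart e σ (e u) ![contactVec (e u) c, Y] := by
      intro Y
      change inChart e σ (e u) (Matrix.vecCons _ _) = _
      congr 1
      funext j
      fin_cases j <;> rfl
    have hSV : S (contactVec (e u) c) = 0 := by
      rw [hSapp]
      have := map_swap_two (inChart e σ (e u)) (contactVec (e u) c) (contactVec (e u) c)
      linarith
    have hSp : ∀ a i, S (partialVec i a) = 0 := by
      intro a i
      rw [hSapp]
      by_cases ha : a = 0
      · subst ha
        rw [map_swap_two, ← sourceCoeff_eq hφ hk hσ i hu c, h i, neg_zero]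
      · exact hσ.inChart_right hφ hz rfl (by simp [partialVec, Pi.single_eq_of_ne (Ne.symm ha)]) _
    -- The contact vector has time component 1, so subtracting this multiple leaves a combination of
    -- the `∂/∂y^i_(a)`; `S` kills both parts.
    have hX : X = X.1 • contactVec (e u) c + (X - X.1 • contactVec (e u) c) := by abel
    rw [← hSapp, hX, map_add, map_smul, hSV, smul_zero, zero_add,
      covector_eq_sum S (by simp [contactVec_fst])]
    simp [hSp]

variable (γ φ) in
/-- The coordinate expression of a section. -/
abbrev coordCurve (s : ℝ) : Coord n := φ (γ.curve s)

/-- The momenta `β(∂/∂y^i_{(a)})` along a section. -/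
def momentum (β : JetForm n M k 1) (γ : LocalSection n M) (i : Fin n) (a : ℕ) (s : ℝ) : ℝ :=
  if h : a < k + 1 then
    coordCovec hφ β (prolong k (coordCurve φ γ) s) (partialVec i ⟨a, h⟩) else 0

/-- The partial derivatives `∂L/∂y^i_{(a)}` along a section. -/
def forceAlong (L : JetSpace n M k → ℝ) (γ : LocalSection n M) (i : Fin n) (a : ℕ) (s : ℝ) : ℝ :=
  if h : a < k + 1 then partialDeriv φ hφ L i ⟨a, h⟩ (γ.lift k s) else 0

lemma prolong_mem_target (ht : t ∈ γ.dom) (hs : γ.curve t ∈ φ.source) :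
    prolong k (coordCurve φ γ) t ∈ (adaptedChart k φ hφ).target := by
  rw [← LocalSection.adaptedChart_lift hφ ht hs]
  exact (adaptedChart k φ hφ).map_source (LocalSection.lift_mem_source hφ ht hs)

lemma adaptedChart_symm_prolong (ht : t ∈ γ.dom) (hs : γ.curve t ∈ φ.source) :
    (adaptedChart k φ hφ).symm (prolong k (coordCurve φ γ) t) = γ.lift k t := by
  rw [← LocalSection.adaptedChart_lift hφ ht hs]
  exact (adaptedChart k φ hφ).left_inv (LocalSection.lift_mem_source hφ ht hs)

lemma contDiffAt_prolong {y : ℝ → Coord n} (hy : ContDiffAt ℝ ∞ y t) :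
    ContDiffAt ℝ ∞ (prolong k y) t :=
  contDiffAt_id.prodMk (contDiffAt_pi.2 fun a => contDiffAt_iteratedDeriv hy a)

lemma contDiffAt_momentum (hβ : SmoothOn β Set.univ) (ht : t ∈ γ.dom)
    (hs : γ.curve t ∈ φ.source) (i : Fin n) (a : ℕ) :
    ContDiffAt ℝ ∞ (momentum hφ β γ i a) t := by
  unfold momentum
  split_ifs with h
  · exact ((contDiffAt_coordCovec hφ hβ (prolong_mem_target hφ ht hs)).comp t
      (contDiffAt_prolong (LocalSection.contDiffAt_coord hφ ht hs))).clm_apply contDiffAt_const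
  · exact contDiffAt_const

lemma eventually_lift_mem {U : Set (JetSpace n M k)} (hU : IsOpen U) (ht : t ∈ γ.dom)
    (hmem : γ.lift k t ∈ U) : ∀ᶠ s in 𝓝 t, γ.lift k s ∈ U :=
  (LocalSection.mdifferentiableAt_lift ht).continuousAt.preimage_mem_nhds (hU.mem_nhds hmem)

/-- Chain rule: the prolonged curve has the contact vector as derivative, so differentiation along
`V` in the source identity becomes a time derivative. -/
lemma deriv_momentum (hβ : SmoothOn β Set.univ) (ht : t ∈ γ.dom) (hs : γ.curve t ∈ φ.source)
    (i : Fin n) (a : Fin (k + 1)) :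
    deriv (momentum hφ β γ i a) t = fderiv ℝ (coordCovec hφ β) (prolong k (coordCurve φ γ) t)
      (contactVec (prolong k (coordCurve φ γ) t) (iteratedDeriv (k + 1) (coordCurve φ γ) t))
      (partialVec i a) := by
  have h1 := (contDiffAt_coordCovec hφ hβ (prolong_mem_target hφ ht hs)).differentiableAt (by simp)
  have h2 := h1.hasFDerivAt.comp_hasDerivAt t
    (hasDerivAt_prolong (k := k) (LocalSection.contDiffAt_coord hφ ht hs))
  have h3 := h2.clm_apply (hasDerivAt_const t (partialVec i a))
  have h4 : momentum hφ β γ i a = fun s =>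
      (coordCovec hφ β ∘ prolong k (coordCurve φ γ)) s (partialVec i a) := by
    funext s
    exact dif_pos a.2
  rw [h4, h3.deriv]
  simp

variable {r : ℕ} {U : Set (JetSpace n M k)} {L : JetSpace n M k → ℝ}

/-- The source identity along a section. -/
lemma source_along (hβ : IsLepageRepresentative α σ β) (hL : IsLocalLagrangian r α U L)
    (ht : t ∈ γ.dom) (hs : γ.curve t ∈ φ.source) (hU : γ.lift k t ∈ U) (i : Fin n)
    (a : Fin (k + 1)) :
    inChart (adaptedChart k φ hφ) σ (prolong k (coordCurve φ γ) t) ![partialVec i a,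
      contactVec (prolong k (coordCurve φ γ) t) (iteratedDeriv (k + 1) (coordCurve φ γ) t)] =
      forceAlong hφ L γ i a t - coordCovec hφ β (prolong k (coordCurve φ γ) t)
        (shift n k (partialVec i a)) - deriv (momentum hφ β γ i a) t := by
  rw [hβ.source_eq_lagrangian hφ hL (prolong_mem_target hφ ht hs)
    (by rwa [adaptedChart_symm_prolong hφ ht hs]), deriv_momentum hφ hβ.smooth ht hs]
  rw [show forceAlong hφ L γ i a t = partialDeriv φ hφ L i a (γ.lift k t) from dif_pos a.2,
    partialDeriv, LocalSection.adaptedChart_lift hφ ht hs]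

/-- The source identity for `∂/∂y_(0)`, which commutes with `d/dt`: no lower momentum appears. -/
lemma force_zero_eq (hk : 1 ≤ k) (hσ : IsSourceForm σ) (hβ : IsLepageRepresentative α σ β)
    (hL : IsLocalLagrangian r α U L) (ht : t ∈ γ.dom) (hs : γ.curve t ∈ φ.source)
    (hU : γ.lift k t ∈ U) (i : Fin n) :
    forceAlong hφ L γ i 0 t =
      sourceCoeff φ hφ σ i (γ.lift k t) + deriv (momentum hφ β γ i 0) t := by
  have h := source_along hφ hβ hL ht hs hU i 0
  rw [shift_partialVec_zero, map_zero, sub_zero, ← LocalSection.adaptedChart_lift hφ ht hs,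
    ← sourceCoeff_eq hφ hk hσ i (LocalSection.lift_mem_source hφ ht hs)] at h
  simp only [Fin.val_zero] at h
  linarith

/-- The source identity for `∂/∂y_(a+1)`, a vertical vector over `E`, so that the left side is zero.
-/
lemma force_succ_eq (hσ : IsSourceForm σ) (hβ : IsLepageRepresentative α σ β)
    (hL : IsLocalLagrangian r α U L) (ht : t ∈ γ.dom) (hs : γ.curve t ∈ φ.source)
    (hU : γ.lift k t ∈ U) (i : Fin n) {a : ℕ} (ha : a < k) :
    forceAlong hφ L γ i (a + 1) t =
      momentum hφ β γ i a t + deriv (momentum hφ β γ i (a + 1)) t := by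
  have h := source_along hφ hβ hL ht hs hU i ⟨a + 1, by omega⟩
  rw [shift_partialVec_succ, map_swap_two] at h
  have h1 : inChart (adaptedChart k φ hφ) σ (prolong k (coordCurve φ γ) t)
    ![contactVec (prolong k (coordCurve φ γ) t) (iteratedDeriv (k + 1) (coordCurve φ γ) t),
      partialVec i ⟨a + 1, by omega⟩] = 0 :=
    hσ.inChart_right hφ (prolong_mem_target hφ ht hs) rfl
      (by simp [partialVec]) _
  rw [h1, neg_zero] at h
  have h2 : momentum hφ β γ i a t =
      coordCovec hφ β (prolong k (coordCurve φ γ) t) (partialVec i ⟨a, by omega⟩) :=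
    dif_pos _
  rw [h2]
  linarith

lemma momentum_last (hβ : IsLepageRepresentative α σ β)
    (hL : IsLocalLagrangian r α U L) (ht : t ∈ γ.dom) (hs : γ.curve t ∈ φ.source)
    (hU : γ.lift k t ∈ U) (i : Fin n) : momentum hφ β γ i k t = 0 := by
  have h : momentum hφ β γ i k t =
      coordCovec hφ β (prolong k (coordCurve φ γ) t) (partialVec i (Fin.last k)) :=
    dif_pos (Nat.lt_succ_self k)
  have hU' := hU
  rw [← adaptedChart_symm_prolong hφ ht hs] at hU'
  rw [h, partialVec_last (prolong k (coordCurve φ γ) t), map_sub,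
    hβ.coordCovec_contactVec hφ hL (prolong_mem_target hφ ht hs) hU',
    hβ.coordCovec_contactVec hφ hL (prolong_mem_target hφ ht hs) hU', sub_self]

lemma eventually_good (hL : IsLocalLagrangian r α U L) (ht : t ∈ γ.dom)
    (hs : γ.curve t ∈ φ.source) (hU : γ.lift k t ∈ U) :
    ∀ᶠ s in 𝓝 t, (s ∈ γ.dom ∧ γ.curve s ∈ φ.source) ∧ γ.lift k s ∈ U :=
  (LocalSection.eventually_mem ht hs).and (eventually_lift_mem hL.isOpen ht hU)

/-- The coefficients of the source form are the Euler–Lagrange expressions. -/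
lemma sourceCoeff_eq_eulerLagrange (hk : 1 ≤ k) (hσ : IsSourceForm σ)
    (hβ : IsLepageRepresentative α σ β) (hL : IsLocalLagrangian r α U L) (ht : t ∈ γ.dom)
    (hs : γ.curve t ∈ φ.source) (hU : γ.lift k t ∈ U) (i : Fin n) :
    sourceCoeff φ hφ σ i (γ.lift k t) = eulerLagrange φ hφ L γ i t := by
  have hgood := eventually_good hL ht hs hU
  -- The relations are supplied on a neighbourhood of `t`, because they are differentiated up to `k`
  -- times.
  have h := sum_alternating_iteratedDeriv (p := momentum hφ β γ i) (l := forceAlong hφ L γ i)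
    (s := fun s => sourceCoeff φ hφ σ i (γ.lift k s)) (t := t) (k := k)
    (fun a => contDiffAt_momentum hφ hβ.smooth ht hs i a)
    (hgood.mono fun s h => force_zero_eq hφ hk hσ hβ hL h.1.1 h.1.2 h.2 i)
    (fun a ha => hgood.mono fun s h => force_succ_eq hφ hσ hβ hL h.1.1 h.1.2 h.2 i ha)
    (hgood.mono fun s h => momentum_last hφ hβ hL h.1.1 h.1.2 h.2 i)
  rw [← h, eulerLagrange, Finset.sum_range]
  refine Finset.sum_congr rfl fun a _ => ?_
  have : forceAlong hφ L γ i a = fun s => partialDeriv φ hφ L i a (γ.lift k s) := by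
    funext s
    exact dif_pos a.2
  rw [this]

end EulerLagrange

/-! ### Forms of lower order and vanishing of the momenta -/

section Order

variable {n : ℕ} {M : Type*} [TopologicalSpace M] [ChartedSpace (Coord n) M]
  [IsManifold (𝓡 n) ∞ M] {k q : ℕ} {φ : OpenPartialHomeomorph M (Coord n)}
  {γ : LocalSection n M} {t : ℝ} {α β : JetForm n M k 1} {σ : JetForm n M k 2}

variable (n) in
/-- The coordinate expression of the projection `J^k(E) → J^q(E)`. -/
def restrictModel (h : q ≤ k) : JetModel n k →L[ℝ] JetModel n q :=
  (ContinuousLinearMap.fst ℝ ℝ _).prod (ContinuousLinearMap.pi fun a =>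
    (ContinuousLinearMap.proj (Fin.castLE (Nat.succ_le_succ h) a)).comp
      (ContinuousLinearMap.snd ℝ ℝ _))

lemma adaptedChart_proj (hφ : φ ∈ IsManifold.maximalAtlas (𝓡 n) ∞ M) (h : q ≤ k)
    {u : JetSpace n M k} (hu : u ∈ (adaptedChart k φ hφ).source) :
    adaptedChart q φ hφ (JetSpace.proj h u) = restrictModel n h (adaptedChart k φ hφ u) := by
  obtain ⟨p, rfl⟩ : ∃ p, u = jetMk k p := ⟨Quotient.out u, (Quotient.out_eq u).symm⟩
  have h1 : adaptedChart k φ hφ (jetMk k p) = _ := adaptedCoord_mk hφ p hu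
  have h2 : adaptedChart q φ hφ (jetMk q p) = _ := adaptedCoord_mk hφ p hu
  rw [h1]
  exact h2

lemma point_proj (h : q ≤ k) (u : JetSpace n M k) : (JetSpace.proj h u).point = u.point := by
  obtain ⟨p, rfl⟩ : ∃ p, u = jetMk k p := ⟨Quotient.out u, (Quotient.out_eq u).symm⟩
  rfl

/-- In adapted coordinates the projection is the linear truncation `restrictModel`. -/
lemma mdifferentiableAt_proj (h : q ≤ k) (u : JetSpace n M k) :
    MDifferentiableAt 𝓘(ℝ, JetModel n k) 𝓘(ℝ, JetModel n q) (JetSpace.proj h) u := by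
  have hφ := IsManifold.chart_mem_maximalAtlas (I := 𝓡 n) (n := ∞) u.point
  set φ := chartAt (Coord n) u.point
  have hu : u ∈ (adaptedChart k φ hφ).source := mem_chart_source (Coord n) u.point
  have hu' : JetSpace.proj h u ∈ (adaptedChart q φ hφ).source := by
    rw [mem_adaptedChart_source, point_proj]
    exact mem_chart_source (Coord n) u.point
  have h1 := (mdifferentiable_atlas (adaptedChart_mem_atlas (k := k) hφ)).mdifferentiableAt hu
  have h2 : MDifferentiableAt 𝓘(ℝ, JetModel n k) 𝓘(ℝ, JetModel n q) (restrictModel n h)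
      (adaptedChart k φ hφ u) := (restrictModel n h).differentiableAt.mdifferentiableAt
  have h3 := (mdifferentiable_atlas (adaptedChart_mem_atlas (k := q) hφ)).mdifferentiableAt_symm
    ((adaptedChart q φ hφ).map_source hu')
  rw [adaptedChart_proj hφ h hu] at h3
  refine (h3.comp u (h2.comp u h1)).congr_of_eventuallyEq ?_
  filter_upwards [(adaptedChart k φ hφ).open_source.mem_nhds hu] with x hx
  change _ = (adaptedChart q φ hφ).symm (restrictModel n h (adaptedChart k φ hφ x))
  rw [← adaptedChart_proj hφ h hx, (adaptedChart q φ hφ).left_inv]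
  rw [mem_adaptedChart_source, point_proj]
  exact hx

lemma proj_lift (h : q ≤ k) (ht : t ∈ γ.dom) : JetSpace.proj h (γ.lift k t) = γ.lift q t := by
  rw [LocalSection.lift_of_mem ht, LocalSection.lift_of_mem ht]
  rfl

lemma mfderiv_proj_velocity (h : q ≤ k) (ht : t ∈ γ.dom) :
    (mfderiv 𝓘(ℝ, JetModel n k) 𝓘(ℝ, JetModel n q) (JetSpace.proj h) (γ.lift k t)
      (γ.velocity k t) : JetModel n q) = γ.velocity q t := by
  have hc := mfderiv_comp t (mdifferentiableAt_proj h (γ.lift k t))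
    (LocalSection.mdifferentiableAt_lift ht)
  have he : JetSpace.proj h ∘ γ.lift k =ᶠ[𝓝 t] γ.lift q := by
    filter_upwards [γ.isOpen_dom.mem_nhds ht] with s hs using proj_lift h hs
  rw [he.mfderiv_eq] at hc
  exact (DFunLike.congr_fun hc (1 : ℝ)).symm

/-- The values of a form of order `q` on the velocities of lifts are those of a form on
`J^q(E)`. -/
lemma IsOfOrderOn.exists_apply_velocity {U : Set (JetSpace n M k)} {η : JetForm n M k 1}
    (hη : IsOfOrderOn q U η) : q ≤ k ∧ ∃ ζ : JetForm n M q 1, ∀ (γ : LocalSection n M) (t : ℝ),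
      t ∈ γ.dom → γ.lift k t ∈ U →
        η (γ.lift k t) (fun _ => γ.velocity k t) = ζ (γ.lift q t) (fun _ => γ.velocity q t) := by
  obtain ⟨h, W, ζ, -, -, hζ⟩ := hη
  refine ⟨h, ζ, fun γ t ht hU => ?_⟩
  rw [(hζ _ hU).2]
  change (ζ (JetSpace.proj h (γ.lift k t))) (fun _ =>
    mfderiv 𝓘(ℝ, JetModel n k) 𝓘(ℝ, JetModel n q) (JetSpace.proj h) (γ.lift k t)
      (γ.velocity k t)) = _
  refine (form_apply_congr ζ (proj_lift h ht) _).trans ?_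
  congr 1
  funext _
  exact mfderiv_proj_velocity h ht

variable {r m : ℕ} {U : Set (JetSpace n M k)} {L : JetSpace n M k → ℝ}

/-- Unifies the two hypotheses on `m`: take `q = r` and `ζ dt`-like from `L dt` in the first case,
`q = m` and `ζ` from `α` in the second. A velocity in `J^q(E)` depends on the `(q + 1)`-jet, whence
the bound `m + 1` below. -/
lemma IsLocalLagrangian.exists_lower_order (hL : IsLocalLagrangian r α U L)
    (hm : r ≤ m ∨ IsOfOrderOn m Set.univ α) :
    ∃ q, q ≤ m ∧ q ≤ k ∧ ∃ ζ : JetForm n M q 1, ∀ (γ : LocalSection n M) (t : ℝ),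
      t ∈ γ.dom → γ.lift k t ∈ U →
        L (γ.lift k t) = ζ (γ.lift q t) (fun _ => γ.velocity q t) := by
  rcases hm with hm | hm
  · obtain ⟨hq, ζ, hζ⟩ := hL.order.exists_apply_velocity
    exact ⟨r, hm, hq, ζ, fun γ t ht hU => by
      rw [← hζ γ t ht hU, lagrangianForm_velocity L ht]⟩
  · obtain ⟨hq, ζ, hζ⟩ := hm.exists_apply_velocity
    exact ⟨m, le_rfl, hq, ζ, fun γ t ht hU => by
      rw [← hζ γ t ht (Set.mem_univ _), hL.apply_velocity ht hU]⟩

variable (hφ : φ ∈ IsManifold.maximalAtlas (𝓡 n) ∞ M)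

/-- The Lagrangian only depends on the derivatives up to order `m + 1`. -/
lemma IsLocalLagrangian.eq_of_agree (hL : IsLocalLagrangian r α U L)
    (hm : r ≤ m ∨ IsOfOrderOn m Set.univ α) {z z' : JetModel n k}
    (hz : z ∈ (adaptedChart k φ hφ).target) (hzU : (adaptedChart k φ hφ).symm z ∈ U)
    (hz' : z' ∈ (adaptedChart k φ hφ).target) (hzU' : (adaptedChart k φ hφ).symm z' ∈ U)
    (h1 : z.1 = z'.1) (h2 : ∀ a : Fin (k + 1), (a : ℕ) ≤ m + 1 → z.2 a = z'.2 a) :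
    L ((adaptedChart k φ hφ).symm z) = L ((adaptedChart k φ hφ).symm z') := by
  obtain ⟨q, hqm, hqk, ζ, hζ⟩ := hL.exists_lower_order hm
  obtain ⟨γ, t, ht, hs, rfl, hc⟩ := exists_section_contactVec hφ z hz 0
  obtain ⟨γ', t', ht', hs', rfl, hc'⟩ := exists_section_contactVec hφ z' hz' 0
  obtain rfl : t = t' := h1
  rw [adaptedChart_symm_prolong hφ ht hs] at hzU ⊢
  rw [adaptedChart_symm_prolong hφ ht' hs'] at hzU' ⊢
  rw [hζ γ t ht hzU, hζ γ' t ht' hzU', coordCovec_velocity hφ ζ ht hs,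
    coordCovec_velocity hφ ζ ht' hs']
  have hd : ∀ a ≤ q + 1, iteratedDeriv a (coordCurve φ γ) t =
      iteratedDeriv a (coordCurve φ γ') t := by
    intro a ha
    by_cases hak : a ≤ k
    · exact h2 ⟨a, by omega⟩ (by simp only; omega)
    -- This happens only for `q = k`. The derivative of order `k + 1` is not recorded in `z` or
    -- `z'`; both sections were chosen with it equal to 0.
    · obtain rfl : a = k + 1 := by omega
      exact hc.trans hc'.symm
  have hp : prolong q (coordCurve φ γ) t = prolong q (coordCurve φ γ') t :=
    Prod.ext rfl (funext fun a => hd a (by omega))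
  change coordCovec hφ ζ (prolong q (coordCurve φ γ) t) (contactVec (prolong q (coordCurve φ γ) t)
    (iteratedDeriv (q + 1) (coordCurve φ γ) t)) = coordCovec hφ ζ (prolong q (coordCurve φ γ') t)
    (contactVec (prolong q (coordCurve φ γ') t) (iteratedDeriv (q + 1) (coordCurve φ γ') t))
  rw [hp, hd _ le_rfl]

lemma IsLocalLagrangian.contDiffAt (hL : IsLocalLagrangian r α U L) {z : JetModel n k}
    (hz : z ∈ (adaptedChart k φ hφ).target) (hzU : (adaptedChart k φ hφ).symm z ∈ U) :
    ContDiffAt ℝ ∞ (L ∘ (adaptedChart k φ hφ).symm) z := by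
  have h1 := contMDiffAt_symm_of_mem_maximalAtlas (IsManifold.subset_maximalAtlas
    (I := 𝓘(ℝ, JetModel n k)) (n := ∞) (adaptedChart_mem_atlas (k := k) hφ)) hz
  exact ((hL.smooth.contMDiffAt (hL.isOpen.mem_nhds hzU)).comp z h1).contDiffAt

/-- Near `u`, moving along `∂/∂y_(a)` with `a > m + 1` leaves all derivatives up to order `m + 1`
fixed, so `L` is constant on that line. -/
lemma IsLocalLagrangian.partialDeriv_eq_zero (hL : IsLocalLagrangian r α U L)
    (hm : r ≤ m ∨ IsOfOrderOn m Set.univ α) {u : JetSpace n M k}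
    (hu : u ∈ (adaptedChart k φ hφ).source) (huU : u ∈ U) (i : Fin n) (a : Fin (k + 1))
    (ha : m + 1 < (a : ℕ)) : partialDeriv φ hφ L i a u = 0 := by
  set e := adaptedChart k φ hφ with hedef
  have hz : e u ∈ e.target := e.map_source hu
  have hzU : e.symm (e u) ∈ U := by rwa [e.left_inv hu]
  have hd := (hL.contDiffAt hφ hz hzU).differentiableAt (by simp)
  rw [partialDeriv, ← hd.lineDeriv_eq_fderiv, lineDeriv]
  have hline : Filter.Tendsto (fun x : ℝ => e u + x • (partialVec i a : JetModel n k)) (𝓝 0)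
      (𝓝 (e u)) := by
    have : Continuous fun x : ℝ => e u + x • (partialVec i a : JetModel n k) := by fun_prop
    simpa using this.tendsto 0
  have hconst : (fun x : ℝ => (L ∘ e.symm) (e u + x • partialVec i a)) =ᶠ[𝓝 0]
      fun _ => (L ∘ e.symm) (e u) := by
    filter_upwards [hline.eventually ((isOpen_chart_preimage e hL.isOpen).mem_nhds ⟨hz, hzU⟩)]
      with x hx
    refine hL.eq_of_agree hφ hm hx.1 hx.2 hz hzU (by simp [partialVec]) fun b hb => ?_
    have : b ≠ a := fun h => by rw [h] at hb; omega
    simp [partialVec, Pi.single_eq_of_ne this]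
  rw [hconst.deriv_eq]
  simp

/-- The representative vanishes on the vectors which fix the `m`-jet. -/
lemma coordCovec_eq_zero_of_fixed (hσ : IsSourceForm σ) (hβ : IsLepageRepresentative α σ β)
    (hloc : ∀ u, ∃ U L, u ∈ U ∧ IsLocalLagrangian r α U L)
    (hm : r ≤ m ∨ IsOfOrderOn m Set.univ α) (ht : t ∈ γ.dom) (hs : γ.curve t ∈ φ.source)
    {w : JetModel n k} (hw1 : w.1 = 0) (hw2 : ∀ a : Fin (k + 1), (a : ℕ) ≤ m → w.2 a = 0) :
    coordCovec hφ β (prolong k (coordCurve φ γ) t) w = 0 := by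
  obtain ⟨U, L, hU, hL⟩ := hloc (γ.lift k t)
  have hgood := eventually_good hL ht hs hU
  rw [covector_eq_sum _ hw1]
  refine Finset.sum_eq_zero fun a _ => Finset.sum_eq_zero fun i _ => ?_
  by_cases ha : (a : ℕ) ≤ m
  · simp [hw2 a ha]
  · have h := momenta_eventually_zero (p := momentum hφ β γ i) (l := forceAlong hφ L γ i)
      (m := m) (t := t)
      (fun a ha => hgood.mono fun s h => force_succ_eq hφ hσ hβ hL h.1.1 h.1.2 h.2 i ha)
      (hgood.mono fun s h => momentum_last hφ hβ hL h.1.1 h.1.2 h.2 i)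
      (fun b hb hmb => hgood.mono fun s h => (dif_pos (Nat.lt_succ_of_le hb)).trans
        (hL.partialDeriv_eq_zero hφ hm (LocalSection.lift_mem_source hφ h.1.1 h.1.2) h.2 i
          ⟨b, Nat.lt_succ_of_le hb⟩ hmb))
      a (Nat.lt_succ_iff.1 a.2) (by omega)
    have h0 : momentum hφ β γ i a t = 0 := h.self_of_nhds
    have h1 : momentum hφ β γ i a t =
      coordCovec hφ β (prolong k (coordCurve φ γ) t) (partialVec i a) := dif_pos a.2
    rw [← h1, h0, mul_zero]

end Order

/-! ### Calculus on rectangles -/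

section Rectangle

variable {F : Type*} [NormedAddCommGroup F] [NormedSpace ℝ F] {I J : Set ℝ}

lemma hasDerivWithinAt_fst_slice {g : ℝ × ℝ → F} {q : ℝ × ℝ} (hq : q ∈ I ×ˢ J)
    (hg : DifferentiableWithinAt ℝ g (I ×ˢ J) q) :
    HasDerivWithinAt (fun t => g (t, q.2)) (fderivWithin ℝ g (I ×ˢ J) q (1, 0)) I q.1 := by
  have h1 : HasDerivWithinAt (fun t : ℝ => (t, q.2)) ((1 : ℝ), (0 : ℝ)) I q.1 :=
    ((hasDerivAt_id q.1).prodMk (hasDerivAt_const q.1 q.2)).hasDerivWithinAt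
  exact hg.hasFDerivWithinAt.comp_hasDerivWithinAt_of_eq q.1 h1 (fun t ht => ⟨ht, hq.2⟩) rfl

lemma hasDerivWithinAt_snd_slice {g : ℝ × ℝ → F} {q : ℝ × ℝ} (hq : q ∈ I ×ˢ J)
    (hg : DifferentiableWithinAt ℝ g (I ×ˢ J) q) :
    HasDerivWithinAt (fun s => g (q.1, s)) (fderivWithin ℝ g (I ×ˢ J) q (0, 1)) J q.2 := by
  have h1 : HasDerivWithinAt (fun s : ℝ => (q.1, s)) ((0 : ℝ), (1 : ℝ)) J q.2 :=
    ((hasDerivAt_const q.2 q.1).prodMk (hasDerivAt_id q.2)).hasDerivWithinAt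
  exact hg.hasFDerivWithinAt.comp_hasDerivWithinAt_of_eq q.2 h1 (fun s hs => ⟨hq.1, hs⟩) rfl

lemma contDiffOn_fderivWithin_apply {g : ℝ × ℝ → F} {S : Set (ℝ × ℝ)} (hS : UniqueDiffOn ℝ S)
    (hg : ContDiffOn ℝ ∞ g S) (v : ℝ × ℝ) :
    ContDiffOn ℝ ∞ (fun q => fderivWithin ℝ g S q v) S :=
  (hg.fderivWithin hS (m := ∞) (by simp)).clm_apply contDiffOn_const

/-- The iterated partial derivatives in the first variable of a smooth function on a rectangle. -/
lemma contDiffOn_iteratedDerivWithin_slice (hI : UniqueDiffOn ℝ I) (hJ : UniqueDiffOn ℝ J)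
    {g : ℝ × ℝ → F} (hg : ContDiffOn ℝ ∞ g (I ×ˢ J)) (a : ℕ) :
    ContDiffOn ℝ ∞ (fun q : ℝ × ℝ => iteratedDerivWithin a (fun t => g (t, q.2)) I q.1)
      (I ×ˢ J) := by
  induction a with
  | zero => simpa using hg
  | succ a ih =>
    refine (contDiffOn_fderivWithin_apply (hI.prod hJ) ih (1, 0)).congr fun q hq => ?_
    rw [iteratedDerivWithin_succ]
    exact (hasDerivWithinAt_fst_slice hq ((ih q hq).differentiableWithinAt (by simp))).derivWithin
      (hI q.1 hq.1)

/-- Symmetry of second derivatives, needed also on the edges of the rectangle; there it follows from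
density of the interior. -/
lemma fderivWithin_fderivWithin_comm {g : ℝ × ℝ → F} {S : Set (ℝ × ℝ)} (hS : UniqueDiffOn ℝ S)
    (hcl : S ⊆ closure (interior S)) (hg : ContDiffOn ℝ ∞ g S) {q : ℝ × ℝ} (hq : q ∈ S)
    (v w : ℝ × ℝ) :
    fderivWithin ℝ (fun q => fderivWithin ℝ g S q v) S q w =
      fderivWithin ℝ (fun q => fderivWithin ℝ g S q w) S q v := by
  have hd : DifferentiableWithinAt ℝ (fderivWithin ℝ g S) S q :=
    ((hg.fderivWithin hS (m := ∞) (by simp)) q hq).differentiableWithinAt (by simp)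
  have h : ∀ v w, fderivWithin ℝ (fun q => fderivWithin ℝ g S q v) S q w =
      fderivWithin ℝ (fderivWithin ℝ g S) S q w v := by
    intro v w
    rw [(hd.hasFDerivWithinAt.clm_apply (hasFDerivWithinAt_const v q S)).fderivWithin (hS q hq)]
    simp
  rw [h, h]
  exact (hg q hq).isSymmSndFDerivWithinAt
    (by rw [minSmoothness_of_isRCLikeNormedField]; exact ENat.LEInfty.out) hS (hcl hq) hq w v

/-- The first variation of `∫ P(∂G/∂t) dt`, pointwise: the derivative in `s` of `P(∂G/∂t)` is
`dP(∂G/∂s, ∂G/∂t) + ∂/∂t (P(∂G/∂s))`. -/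
lemma hasDerivWithinAt_first_variation {V : Type*} [NormedAddCommGroup V] [NormedSpace ℝ V]
    (hS : UniqueDiffOn ℝ (I ×ˢ J)) (hcl : I ×ˢ J ⊆ closure (interior (I ×ˢ J)))
    {G : ℝ × ℝ → V} (hG : ContDiffOn ℝ ∞ G (I ×ˢ J)) {P : V → V →L[ℝ] ℝ} {q : ℝ × ℝ}
    (hq : q ∈ I ×ˢ J) (hP : DifferentiableAt ℝ P (G q)) :
    HasDerivWithinAt
      (fun t => P (G (t, q.2)) (fderivWithin ℝ G (I ×ˢ J) (t, q.2) (0, 1)))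
      (fderivWithin ℝ (fun x => P (G x) (fderivWithin ℝ G (I ×ˢ J) x (1, 0))) (I ×ˢ J) q (0, 1) -
        (fderiv ℝ P (G q) (fderivWithin ℝ G (I ×ˢ J) q (0, 1))
            (fderivWithin ℝ G (I ×ˢ J) q (1, 0)) -
          fderiv ℝ P (G q) (fderivWithin ℝ G (I ×ˢ J) q (1, 0))
            (fderivWithin ℝ G (I ×ˢ J) q (0, 1)))) I q.1 := by
  set S := I ×ˢ J with hSdef
  have hGd : HasFDerivWithinAt G (fderivWithin ℝ G S q) S q :=
    ((hG q hq).differentiableWithinAt (by simp)).hasFDerivWithinAt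
  have hPG := hP.hasFDerivAt.comp_hasFDerivWithinAt q hGd
  have hD : ∀ v, HasFDerivWithinAt (fun x => fderivWithin ℝ G S x v)
      (fderivWithin ℝ (fun x => fderivWithin ℝ G S x v) S q) S q := fun v =>
    ((contDiffOn_fderivWithin_apply hS hG v q hq).differentiableWithinAt (by simp)).hasFDerivWithinAt
  have hv : ∀ v, HasFDerivWithinAt (fun x => P (G x) (fderivWithin ℝ G S x v)) _ S q :=
    fun v => hPG.clm_apply (hD v)
  have h01 := hasDerivWithinAt_fst_slice hq (hv (0, 1)).differentiableWithinAt
  refine h01.congr_deriv ?_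
  rw [(hv (0, 1)).fderivWithin (hS q hq), (hv (1, 0)).fderivWithin (hS q hq)]
  -- The mixed second derivatives of `G` cancel, leaving only the antisymmetric part of the
  -- derivative of `P`.
  have hc := fderivWithin_fderivWithin_comm hS hcl hG hq (1, 0) (0, 1)
  simp only [add_apply, ContinuousLinearMap.comp_apply,
    ContinuousLinearMap.flip_apply, Function.comp_apply]
  rw [hc]
  ring

/-- Differentiation under the integral sign over a compact interval. -/
lemma hasDerivAt_integral_of_contDiffWithinAt {f : ℝ × ℝ → ℝ} {a b : ℝ} (hab : a < b)
    (hf : ∀ t ∈ Set.Icc a b, ∀ᶠ q in 𝓝 ((0 : ℝ), t), q.2 ∈ Set.Icc a b →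
      ContDiffWithinAt ℝ 1 f (Set.Icc a b ×ˢ Set.univ) (q.2, q.1)) :
    ContinuousOn (fun t => deriv (fun s => f (t, s)) 0) (Set.Icc a b) ∧
    HasDerivAt (fun s => ∫ t in a..b, f (t, s))
      (∫ t in a..b, deriv (fun s => f (t, s)) 0) 0 := by
  -- Compactness of `[a, b]` makes the range of `s` uniform in `t`, although each point came with
  -- its own neighbourhood.
  have hev := isCompact_Icc.eventually_forall_of_forall_eventually (x₀ := (0 : ℝ))
    (P := fun s t => t ∈ Set.Icc a b →
      ContDiffWithinAt ℝ 1 f (Set.Icc a b ×ˢ Set.univ) (t, s)) hf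
  obtain ⟨ρ, hρ, hball⟩ := Metric.eventually_nhds_iff_ball.1 hev
  have hI : UniqueDiffOn ℝ (Set.Icc a b) := uniqueDiffOn_Icc hab
  have hJ : UniqueDiffOn ℝ (Metric.ball (0 : ℝ) ρ) := Metric.isOpen_ball.uniqueDiffOn
  have hC : ContDiffOn ℝ 1 f (Set.Icc a b ×ˢ Metric.ball 0 ρ) := fun q hq =>
    (hball q.2 hq.2 q.1 hq.1 hq.1).mono (Set.prod_mono le_rfl (Set.subset_univ _))
  set S := Set.Icc a b ×ˢ Metric.ball (0 : ℝ) ρ with hSdef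
  have hcont : ContinuousOn (fun q => fderivWithin ℝ f S q (0, 1)) S :=
    (hC.continuousOn_fderivWithin (hI.prod hJ) le_rfl).clm_apply continuousOn_const
  have hd : ∀ t ∈ Set.Icc a b, ∀ s ∈ Metric.ball (0 : ℝ) ρ,
      HasDerivAt (fun s => f (t, s)) (fderivWithin ℝ f S (t, s) (0, 1)) s := fun t ht s hs =>
    (hasDerivWithinAt_snd_slice (q := (t, s)) ⟨ht, hs⟩
      ((hC (t, s) ⟨ht, hs⟩).differentiableWithinAt one_ne_zero)).hasDerivAt
      (Metric.isOpen_ball.mem_nhds hs)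
  have h0 : (0 : ℝ) ∈ Metric.ball (0 : ℝ) ρ := Metric.mem_ball_self hρ
  have hslice : ∀ s ∈ Metric.ball (0 : ℝ) ρ,
      ContinuousOn (fun t => fderivWithin ℝ f S (t, s) (0, 1)) (Set.Icc a b) := fun s hs =>
    hcont.comp (Continuous.continuousOn (by fun_prop)) fun t ht => ⟨ht, hs⟩
  have hfs : ∀ s ∈ Metric.ball (0 : ℝ) ρ, ContinuousOn (fun t => f (t, s)) (Set.Icc a b) :=
    fun s hs => hC.continuousOn.comp (Continuous.continuousOn (by fun_prop)) fun t ht => ⟨ht, hs⟩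
  have hsub : Metric.closedBall (0 : ℝ) (ρ / 2) ⊆ Metric.ball 0 ρ :=
    Metric.closedBall_subset_ball (by linarith)
  -- The ball is halved so that its closure is compact and a constant dominates the derivative.
  obtain ⟨C, hCb⟩ := (isCompact_Icc.prod (isCompact_closedBall (0 : ℝ) (ρ / 2))).exists_bound_of_continuousOn
    (hcont.mono (Set.prod_mono (le_refl (Set.Icc a b)) hsub))
  have hu : Set.uIoc a b ⊆ Set.Icc a b := by
    rw [Set.uIoc_of_le hab.le]; exact Set.Ioc_subset_Icc_self
  have hmain := intervalIntegral.hasDerivAt_integral_of_dominated_loc_of_deriv_le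
    (μ := MeasureTheory.volume) (a := a) (b := b) (F := fun s t => f (t, s))
    (F' := fun s t => fderivWithin ℝ f S (t, s) (0, 1)) (x₀ := (0 : ℝ)) (bound := fun _ => C)
    (s := Metric.ball (0 : ℝ) (ρ / 2)) (Metric.ball_mem_nhds _ (by linarith))
    (by
      filter_upwards [Metric.ball_mem_nhds (0 : ℝ) hρ] with s hs
      exact ((hfs s hs).mono hu).aestronglyMeasurable measurableSet_uIoc)
    ((hfs 0 h0).intervalIntegrable_of_Icc hab.le)
    (((hslice 0 h0).mono hu).aestronglyMeasurable measurableSet_uIoc)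
    (Filter.Eventually.of_forall fun t ht s hs =>
      hCb (t, s) ⟨hu ht, Metric.ball_subset_closedBall hs⟩)
    intervalIntegrable_const
    (Filter.Eventually.of_forall fun t ht s hs =>
      hd t (hu ht) s (hsub (Metric.ball_subset_closedBall hs)))
  refine ⟨(hslice 0 h0).congr fun t ht => (hd t ht 0 h0).deriv, hmain.2.congr_deriv ?_⟩
  refine intervalIntegral.integral_congr fun t ht => ?_
  rw [Set.uIcc_of_le hab.le] at ht
  exact (hd t ht 0 h0).deriv.symm

end Rectangle

/-! ### Variations in adapted coordinates -/

section Variation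

variable {n : ℕ} {M : Type*} [TopologicalSpace M] [ChartedSpace (Coord n) M]
  [IsManifold (𝓡 n) ∞ M] {k : ℕ}

/-- A family of sections which is smooth on the rectangle `I × J`, where it stays in the domain of
the chart `φ`. -/
structure IsSmoothRectangle (δ : ℝ → LocalSection n M) (φ : OpenPartialHomeomorph M (Coord n))
    (I J : Set ℝ) : Prop where
  uniqueDiffOn : UniqueDiffOn ℝ I
  isOpen : IsOpen J
  zero_mem : (0 : ℝ) ∈ J
  subset_closure : I ×ˢ J ⊆ closure (interior (I ×ˢ J))
  mem_dom : ∀ t ∈ I, ∀ s ∈ J, t ∈ (δ s).dom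
  mem_source : ∀ t ∈ I, ∀ s ∈ J, (δ s).curve t ∈ φ.source
  smooth : ContMDiffOn 𝓘(ℝ, ℝ × ℝ) (𝓡 n) ∞ (fun q : ℝ × ℝ => (δ q.2).curve q.1) (I ×ˢ J)

/-- The variation vector field `∂/∂s|_{s=0} j^k_t(δ_s)`. -/
def variationField (k : ℕ) (δ : ℝ → LocalSection n M) (t : ℝ) :
    TangentSpace 𝓘(ℝ, JetModel n k) ((δ 0).lift k t) :=
  mfderiv 𝓘(ℝ, ℝ) 𝓘(ℝ, JetModel n k) (fun s => (δ s).lift k t) 0 (1 : ℝ)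

/-- The prolongation of a family of sections, in coordinates. -/
def familyProlong (k : ℕ) (φ : OpenPartialHomeomorph M (Coord n)) (δ : ℝ → LocalSection n M)
    (q : ℝ × ℝ) : JetModel n k :=
  prolong k (coordCurve φ (δ q.2)) q.1

/-- The density of the first variation. -/
def variationDensity (σ : JetForm n M k 2) (δ : ℝ → LocalSection n M) (t : ℝ) : ℝ :=
  σ ((δ 0).lift k t) ![variationField k δ t, (δ 0).velocity k t]

/-- The boundary term of the first variation. -/
def boundaryTerm (β : JetForm n M k 1) (δ : ℝ → LocalSection n M) (t : ℝ) : ℝ :=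
  β ((δ 0).lift k t) (fun _ => variationField k δ t)

/-! ### The first variation inside one chart -/

namespace IsSmoothRectangle

variable {δ : ℝ → LocalSection n M} {φ : OpenPartialHomeomorph M (Coord n)} {I J : Set ℝ}
  (hφ : φ ∈ IsManifold.maximalAtlas (𝓡 n) ∞ M)
  {α β : JetForm n M k 1} {σ : JetForm n M k 2} {t : ℝ}

lemma uniqueDiffOn_prod (hR : IsSmoothRectangle δ φ I J) : UniqueDiffOn ℝ (I ×ˢ J) :=
  hR.uniqueDiffOn.prod hR.isOpen.uniqueDiffOn

/-- Joint smoothness is known only within the rectangle, while jets use two-sided derivatives. The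
two agree, even at an end of `I`, because each `δ s` is smooth on an open interval containing `I`.
-/
lemma contDiffOn_iteratedDeriv (hR : IsSmoothRectangle δ φ I J)
    (hφ : φ ∈ IsManifold.maximalAtlas (𝓡 n) ∞ M) (a : ℕ) :
    ContDiffOn ℝ ∞ (fun q : ℝ × ℝ => iteratedDeriv a (coordCurve φ (δ q.2)) q.1) (I ×ˢ J) := by
  have hg : ContDiffOn ℝ ∞ (fun q : ℝ × ℝ => φ ((δ q.2).curve q.1)) (I ×ˢ J) :=
    ((contMDiffOn_of_mem_maximalAtlas hφ).comp hR.smooth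
      (fun q hq => hR.mem_source q.1 hq.1 q.2 hq.2)).contDiffOn
  refine (contDiffOn_iteratedDerivWithin_slice hR.uniqueDiffOn hR.isOpen.uniqueDiffOn hg a).congr
    fun q hq => ?_
  exact (iteratedDerivWithin_eq_iteratedDeriv hR.uniqueDiffOn
    ((LocalSection.contDiffAt_coord hφ (hR.mem_dom q.1 hq.1 q.2 hq.2)
      (hR.mem_source q.1 hq.1 q.2 hq.2)).of_le (by exact_mod_cast le_top)) hq.1).symm

lemma contDiffOn_familyProlong (hR : IsSmoothRectangle δ φ I J)
    (hφ : φ ∈ IsManifold.maximalAtlas (𝓡 n) ∞ M) :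
    ContDiffOn ℝ ∞ (familyProlong k φ δ) (I ×ˢ J) :=
  contDiffOn_fst.prodMk (contDiffOn_pi.2 fun a => hR.contDiffOn_iteratedDeriv hφ a)

lemma fderivWithin_familyProlong_fst (hR : IsSmoothRectangle δ φ I J)
    (hφ : φ ∈ IsManifold.maximalAtlas (𝓡 n) ∞ M) {q : ℝ × ℝ} (hq : q ∈ I ×ˢ J) :
    fderivWithin ℝ (familyProlong k φ δ) (I ×ˢ J) q (1, 0) =
      contactVec (familyProlong k φ δ q) (iteratedDeriv (k + 1) (coordCurve φ (δ q.2)) q.1) := by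
  have h1 := hasDerivWithinAt_fst_slice hq
    ((hR.contDiffOn_familyProlong (k := k) hφ q hq).differentiableWithinAt (by simp))
  have h2 := (hasDerivAt_prolong (k := k) (LocalSection.contDiffAt_coord hφ
    (hR.mem_dom q.1 hq.1 q.2 hq.2) (hR.mem_source q.1 hq.1 q.2 hq.2))).hasDerivWithinAt (s := I)
  exact (hR.uniqueDiffOn q.1 hq.1).eq_deriv _ h1 h2

lemma familyProlong_mem_target (hR : IsSmoothRectangle δ φ I J) {q : ℝ × ℝ} (hq : q ∈ I ×ˢ J) :
    familyProlong k φ δ q ∈ (adaptedChart k φ hφ).target :=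
  prolong_mem_target hφ (hR.mem_dom q.1 hq.1 q.2 hq.2) (hR.mem_source q.1 hq.1 q.2 hq.2)

lemma apply_velocity_eq (hR : IsSmoothRectangle δ φ I J) (hβ : IsLepageRepresentative α σ β)
    {q : ℝ × ℝ} (hq : q ∈ I ×ˢ J) :
    α ((δ q.2).lift k q.1) (fun _ => (δ q.2).velocity k q.1) =
      coordCovec hφ β (familyProlong k φ δ q)
        (fderivWithin ℝ (familyProlong k φ δ) (I ×ˢ J) q (1, 0)) := by
  have hd := hR.mem_dom q.1 hq.1 q.2 hq.2
  rw [← hβ.apply_velocity _ _ hd, coordCovec_velocity hφ β hd (hR.mem_source q.1 hq.1 q.2 hq.2),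
    hR.fderivWithin_familyProlong_fst hφ hq]
  rfl

lemma contDiffOn_coordCovec_apply (hR : IsSmoothRectangle δ φ I J) (hβ : SmoothOn β Set.univ)
    (v : ℝ × ℝ) :
    ContDiffOn ℝ ∞ (fun q => coordCovec hφ β (familyProlong k φ δ q)
        (fderivWithin ℝ (familyProlong k φ δ) (I ×ˢ J) q v)) (I ×ˢ J) := by
  have h1 : ContDiffOn ℝ ∞ (fun q => coordCovec hφ β (familyProlong k φ δ q)) (I ×ˢ J) :=
    fun q hq => (contDiffAt_coordCovec hφ hβ
      (hR.familyProlong_mem_target hφ hq)).comp_contDiffWithinAt q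
        (hR.contDiffOn_familyProlong hφ q hq)
  exact h1.clm_apply (contDiffOn_fderivWithin_apply hR.uniqueDiffOn_prod
    (hR.contDiffOn_familyProlong hφ) v)

lemma contDiffOn_integrand (hR : IsSmoothRectangle δ φ I J)
    (hφ : φ ∈ IsManifold.maximalAtlas (𝓡 n) ∞ M) (hβ : IsLepageRepresentative α σ β) :
    ContDiffOn ℝ ∞ (fun q : ℝ × ℝ => α ((δ q.2).lift k q.1) (fun _ => (δ q.2).velocity k q.1))
      (I ×ˢ J) :=
  (hR.contDiffOn_coordCovec_apply hφ hβ.smooth (1, 0)).congr fun _ hq =>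
    hR.apply_velocity_eq hφ hβ hq

lemma hasDerivAt_familyProlong (hR : IsSmoothRectangle δ φ I J)
    (hφ : φ ∈ IsManifold.maximalAtlas (𝓡 n) ∞ M) (ht : t ∈ I) :
    HasDerivAt (fun s => familyProlong k φ δ (t, s))
      (fderivWithin ℝ (familyProlong k φ δ) (I ×ˢ J) (t, 0) (0, 1)) 0 :=
  (hasDerivWithinAt_snd_slice (q := (t, 0)) ⟨ht, hR.zero_mem⟩
    ((hR.contDiffOn_familyProlong hφ (t, 0) ⟨ht, hR.zero_mem⟩).differentiableWithinAt
      (by simp))).hasDerivAt (hR.isOpen.mem_nhds hR.zero_mem)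

/-- The components of the variation vector field. -/
lemma mfderiv_variationField (hR : IsSmoothRectangle δ φ I J) (ht : t ∈ I) :
    (mfderiv 𝓘(ℝ, JetModel n k) 𝓘(ℝ, JetModel n k) (adaptedChart k φ hφ) ((δ 0).lift k t)
      (variationField k δ t) : JetModel n k) =
      fderivWithin ℝ (familyProlong k φ δ) (I ×ˢ J) (t, 0) (0, 1) := by
  have he := adaptedChart_mem_atlas (k := k) hφ
  have hJ := hR.isOpen.mem_nhds hR.zero_mem
  have hsrc : ∀ᶠ s in 𝓝 (0 : ℝ), (δ s).lift k t ∈ (adaptedChart k φ hφ).source := by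
    filter_upwards [hJ] with s hs
    exact LocalSection.lift_mem_source hφ (hR.mem_dom t ht s hs) (hR.mem_source t ht s hs)
  have hd : HasDerivAt (adaptedChart k φ hφ ∘ fun s => (δ s).lift k t)
      (fderivWithin ℝ (familyProlong k φ δ) (I ×ˢ J) (t, 0) (0, 1)) 0 := by
    refine (hR.hasDerivAt_familyProlong hφ ht).congr_of_eventuallyEq ?_
    filter_upwards [hJ] with s hs
    exact LocalSection.adaptedChart_lift hφ (hR.mem_dom t ht s hs) (hR.mem_source t ht s hs)
  rw [← hd.deriv]
  exact mfderiv_chart_curve (c := fun s => (δ s).lift k t) (t := 0) he hsrc.self_of_nhds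
    (mdifferentiableAt_curve_of_chart he hsrc hd.differentiableAt)

lemma adaptedChart_lift_zero (hR : IsSmoothRectangle δ φ I J) (ht : t ∈ I) :
    adaptedChart k φ hφ ((δ 0).lift k t) = familyProlong k φ δ (t, 0) :=
  LocalSection.adaptedChart_lift hφ (hR.mem_dom t ht 0 hR.zero_mem)
    (hR.mem_source t ht 0 hR.zero_mem)

lemma boundaryTerm_eq (hR : IsSmoothRectangle δ φ I J) (ht : t ∈ I) :
    boundaryTerm β δ t = coordCovec hφ β (familyProlong k φ δ (t, 0))
      (fderivWithin ℝ (familyProlong k φ δ) (I ×ˢ J) (t, 0) (0, 1)) := by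
  rw [boundaryTerm, apply_eq_inChart (adaptedChart_mem_atlas hφ) β
    (LocalSection.lift_mem_source hφ (hR.mem_dom t ht 0 hR.zero_mem)
    (hR.mem_source t ht 0 hR.zero_mem)), hR.mfderiv_variationField hφ ht,
    hR.adaptedChart_lift_zero hφ ht]
  rfl

lemma variationDensity_eq_inChart (hR : IsSmoothRectangle δ φ I J) (ht : t ∈ I) :
    variationDensity σ δ t = inChart (adaptedChart k φ hφ) σ (familyProlong k φ δ (t, 0))
      ![fderivWithin ℝ (familyProlong k φ δ) (I ×ˢ J) (t, 0) (0, 1),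
        contactVec (familyProlong k φ δ (t, 0))
          (iteratedDeriv (k + 1) (coordCurve φ (δ 0)) t)] := by
  have hd := hR.mem_dom t ht 0 hR.zero_mem
  have hs := hR.mem_source t ht 0 hR.zero_mem
  rw [variationDensity, apply_eq_inChart (adaptedChart_mem_atlas hφ) σ
    (LocalSection.lift_mem_source hφ hd hs), ← hR.adaptedChart_lift_zero hφ ht]
  congr 1
  funext j
  fin_cases j
  · exact hR.mfderiv_variationField hφ ht
  · exact LocalSection.mfderiv_velocity hφ hd hs

lemma variationDensity_eq_fderiv (hR : IsSmoothRectangle δ φ I J)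
    (hβ : IsLepageRepresentative α σ β) (ht : t ∈ I) :
    variationDensity σ δ t =
      fderiv ℝ (coordCovec hφ β) (familyProlong k φ δ (t, 0))
        (fderivWithin ℝ (familyProlong k φ δ) (I ×ˢ J) (t, 0) (0, 1))
        (fderivWithin ℝ (familyProlong k φ δ) (I ×ˢ J) (t, 0) (1, 0)) -
      fderiv ℝ (coordCovec hφ β) (familyProlong k φ δ (t, 0))
        (fderivWithin ℝ (familyProlong k φ δ) (I ×ˢ J) (t, 0) (1, 0))
        (fderivWithin ℝ (familyProlong k φ δ) (I ×ˢ J) (t, 0) (0, 1)) := by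
  have hq : (t, (0 : ℝ)) ∈ I ×ˢ J := ⟨ht, hR.zero_mem⟩
  rw [hR.variationDensity_eq_inChart hφ ht, hβ.source_eq hφ (hR.familyProlong_mem_target hφ hq),
    hR.fderivWithin_familyProlong_fst hφ hq]

lemma continuousOn_variationDensity (hR : IsSmoothRectangle δ φ I J)
    (hφ : φ ∈ IsManifold.maximalAtlas (𝓡 n) ∞ M) (hβ : IsLepageRepresentative α σ β) :
    ContinuousOn (variationDensity σ δ) I := by
  have hmaps : Set.MapsTo (fun t : ℝ => (t, (0 : ℝ))) I (I ×ˢ J) := fun t ht => ⟨ht, hR.zero_mem⟩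
  have hin : ContinuousOn (fun t : ℝ => (t, (0 : ℝ))) I := Continuous.continuousOn (by fun_prop)
  have hG := (hR.contDiffOn_familyProlong (k := k) hφ).continuousOn.comp hin hmaps
  have hv : ∀ v, ContinuousOn
      (fun t => fderivWithin ℝ (familyProlong k φ δ) (I ×ˢ J) (t, 0) v) I := fun v =>
    (contDiffOn_fderivWithin_apply hR.uniqueDiffOn_prod
      (hR.contDiffOn_familyProlong hφ) v).continuousOn.comp hin hmaps
  have hD : ContinuousOn (fun t => fderiv ℝ (coordCovec hφ β) (familyProlong k φ δ (t, 0))) I := by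
    intro t ht
    have h1 : ContDiffAt ℝ ∞ (coordCovec hφ β) (familyProlong k φ δ (t, 0)) :=
      contDiffAt_coordCovec hφ hβ.smooth (hR.familyProlong_mem_target hφ (hmaps ht))
    exact (h1.fderiv_right (m := ∞) (by simp)).continuousAt.comp_continuousWithinAt
      (f := fun t => familyProlong k φ δ (t, 0)) (hG t ht)
  exact (((hD.clm_apply (hv (0, 1))).clm_apply (hv (1, 0))).sub
    ((hD.clm_apply (hv (1, 0))).clm_apply (hv (0, 1)))).congr fun t ht =>
      hR.variationDensity_eq_fderiv hφ hβ ht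

/-- The first variation, pointwise. -/
lemma hasDerivWithinAt_boundaryTerm (hR : IsSmoothRectangle δ φ I J)
    (hφ : φ ∈ IsManifold.maximalAtlas (𝓡 n) ∞ M) (hβ : IsLepageRepresentative α σ β)
    (ht : t ∈ I) :
    HasDerivWithinAt (boundaryTerm β δ)
      (deriv (fun s => α ((δ s).lift k t) (fun _ => (δ s).velocity k t)) 0 -
        variationDensity σ δ t) I t := by
  have hq : (t, (0 : ℝ)) ∈ I ×ˢ J := ⟨ht, hR.zero_mem⟩
  have h := hasDerivWithinAt_first_variation hR.uniqueDiffOn_prod hR.subset_closure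
    (hR.contDiffOn_familyProlong (k := k) hφ) (P := coordCovec hφ β) hq
    ((contDiffAt_coordCovec hφ hβ.smooth (hR.familyProlong_mem_target hφ hq)).differentiableAt
      (by simp))
  refine (h.congr (fun s hs => hR.boundaryTerm_eq hφ hs) (hR.boundaryTerm_eq hφ ht)).congr_deriv ?_
  rw [hR.variationDensity_eq_fderiv hφ hβ ht]
  congr 1
  have h1 := (hasDerivWithinAt_snd_slice hq ((hR.contDiffOn_coordCovec_apply hφ hβ.smooth (1, 0)
    (t, 0) hq).differentiableWithinAt (by simp))).hasDerivAt (hR.isOpen.mem_nhds hR.zero_mem)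
  have h2 : (fun s => α ((δ s).lift k t) (fun _ => (δ s).velocity k t)) =ᶠ[𝓝 0]
      fun s => coordCovec hφ β (familyProlong k φ δ (t, s))
        (fderivWithin ℝ (familyProlong k φ δ) (I ×ˢ J) (t, s) (1, 0)) := by
    filter_upwards [hR.isOpen.mem_nhds hR.zero_mem] with s hs
    exact hR.apply_velocity_eq hφ hβ (q := (t, s)) ⟨ht, hs⟩
  rw [h2.deriv_eq]
  exact h1.deriv.symm

/-- The density of the first variation in terms of the coefficients `σ_i`. -/
lemma variationDensity_eq_sum (hR : IsSmoothRectangle δ φ I J) (hk : 1 ≤ k)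
    (hσ : IsSourceForm σ) (ht : t ∈ I) :
    variationDensity σ δ t = ∑ i, (deriv (fun s => φ ((δ s).curve t)) 0) i *
      sourceCoeff φ hφ σ i ((δ 0).lift k t) := by
  have hq : (t, (0 : ℝ)) ∈ I ×ˢ J := ⟨ht, hR.zero_mem⟩
  have hz := hR.familyProlong_mem_target (k := k) hφ hq
  have hsrc := LocalSection.lift_mem_source (k := k) hφ (hR.mem_dom t ht 0 hR.zero_mem)
    (hR.mem_source t ht 0 hR.zero_mem)
  have hd := hR.hasDerivAt_familyProlong (k := k) hφ ht
  rw [hR.variationDensity_eq_inChart hφ ht]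
  set c := iteratedDeriv (k + 1) (coordCurve φ (δ 0)) t
  set z := familyProlong k φ δ (t, 0) with hzdef
  set w := fderivWithin ℝ (familyProlong k φ δ) (I ×ˢ J) (t, 0) (0, 1)
  have hw1 : w.1 = 0 := by
    have h1 : HasDerivAt (fun s => (familyProlong k φ δ (t, s)).1) w.1 0 :=
      (ContinuousLinearMap.fst ℝ ℝ (Fin (k + 1) → Coord n)).hasFDerivAt.comp_hasDerivAt 0 hd
    exact h1.unique (hasDerivAt_const 0 t)
  have hw0 : deriv (fun s => φ ((δ s).curve t)) 0 = w.2 0 := by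
    have h1 : HasDerivAt (fun s => (familyProlong k φ δ (t, s)).2 0) (w.2 0) 0 :=
      (((ContinuousLinearMap.proj (0 : Fin (k + 1))).comp
        (ContinuousLinearMap.snd ℝ ℝ (Fin (k + 1) → Coord n)))).hasFDerivAt.comp_hasDerivAt 0 hd
    rw [← h1.deriv]
    simp [familyProlong, prolong]
  let S : JetModel n k →L[ℝ] ℝ :=
    -covec (JetModel n k) ((inChart (adaptedChart k φ hφ) σ z).curryLeft (contactVec z c))
  have hSapp : ∀ Y, S Y = inChart (adaptedChart k φ hφ) σ z ![Y, contactVec z c] := by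
    intro Y
    rw [map_swap_two]
    change -(inChart (adaptedChart k φ hφ) σ z (Matrix.vecCons _ _)) = _
    congr 2
    funext j
    fin_cases j <;> rfl
  have hSp : ∀ a i, a ≠ 0 → S (partialVec i a) = 0 := by
    intro a i ha
    rw [hSapp]
    exact hσ.inChart_apply hφ hz rfl (by simp [partialVec, Pi.single_eq_of_ne (Ne.symm ha)])
      ![contactVec z c]
  rw [← hSapp, covector_eq_sum S hw1, Finset.sum_eq_single 0 (fun a _ ha =>
    Finset.sum_eq_zero fun i _ => by rw [hSp a i ha, mul_zero]) (by simp), hw0]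
  refine Finset.sum_congr rfl fun i _ => ?_
  rw [hSapp, sourceCoeff_eq hφ hk hσ i hsrc c, hR.adaptedChart_lift_zero hφ ht]

/-- The boundary term vanishes where the `m`-jet is fixed. -/
lemma boundaryTerm_eq_zero (hR : IsSmoothRectangle δ φ I J)
    (hφ : φ ∈ IsManifold.maximalAtlas (𝓡 n) ∞ M) {r m : ℕ} (hσ : IsSourceForm σ)
    (hβ : IsLepageRepresentative α σ β)
    (hloc : ∀ u, ∃ U L, u ∈ U ∧ IsLocalLagrangian r α U L)
    (hm : r ≤ m ∨ IsOfOrderOn m Set.univ α) (ht : t ∈ I)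
    (hfix : ∀ s ∈ J, (δ s).lift m t = (δ 0).lift m t) : boundaryTerm β δ t = 0 := by
  rw [hR.boundaryTerm_eq hφ ht]
  have hd := hR.hasDerivAt_familyProlong (k := k) hφ ht
  refine coordCovec_eq_zero_of_fixed hφ hσ hβ hloc hm (hR.mem_dom t ht 0 hR.zero_mem)
    (hR.mem_source t ht 0 hR.zero_mem) ?_ fun a ha => ?_
  · have h1 := (ContinuousLinearMap.fst ℝ ℝ (Fin (k + 1) → Coord n)).hasFDerivAt.comp_hasDerivAt
      0 hd
    exact h1.unique (hasDerivAt_const 0 t)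
  · have h1 := (((ContinuousLinearMap.proj a).comp
        (ContinuousLinearMap.snd ℝ ℝ (Fin (k + 1) → Coord n)))).hasFDerivAt.comp_hasDerivAt 0 hd
    -- For `a ≤ m` this component can be read from the `m`-jet, which is constant in `s`.
    refine h1.unique ((hasDerivAt_const 0 (iteratedDeriv a (coordCurve φ (δ 0)) t)).congr_of_eventuallyEq ?_)
    filter_upwards [hR.isOpen.mem_nhds hR.zero_mem] with s hs
    have h2 := congrArg (adaptedChart m φ hφ) (hfix s hs)
    rw [LocalSection.adaptedChart_lift hφ (hR.mem_dom t ht s hs) (hR.mem_source t ht s hs),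
      LocalSection.adaptedChart_lift hφ (hR.mem_dom t ht 0 hR.zero_mem)
        (hR.mem_source t ht 0 hR.zero_mem)] at h2
    exact congrFun (congrArg Prod.snd h2) ⟨a, by omega⟩

end IsSmoothRectangle

end Variation

/-! ### The first variation formula -/

section FirstVariation

variable {n : ℕ} {M : Type*} [TopologicalSpace M] [ChartedSpace (Coord n) M]
  [IsManifold (𝓡 n) ∞ M] {k r m : ℕ} {γ : LocalSection n M} {a b ε : ℝ}
  {δ : ℝ → LocalSection n M} {α β : JetForm n M k 1} {σ : JetForm n M k 2} {t : ℝ}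

/-- Continuity of the variation at `(t, 0)` keeps it in the chart domain on a small box. -/
lemma IsVariation.exists_smoothRectangle (hδ : IsVariation m γ a b ε δ) (hab : a < b)
    (φ : OpenPartialHomeomorph M (Coord n)) (ht : t ∈ Set.Icc a b)
    (hs : (δ 0).curve t ∈ φ.source) :
    ∃ ρ > 0, Set.Ioo (-ρ) ρ ⊆ Set.Icc (-ε) ε ∧
      IsSmoothRectangle δ φ (Set.Icc a b ∩ Set.Ioo (t - ρ) (t + ρ)) (Set.Ioo (-ρ) ρ) := by
  have h0 : (0 : ℝ) ∈ Set.Icc (-ε) ε := ⟨by linarith [hδ.pos], hδ.pos.le⟩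
  have hc : ContinuousWithinAt (fun q : ℝ × ℝ => (δ q.2).curve q.1)
      (Set.Icc a b ×ˢ Set.Icc (-ε) ε) (t, 0) := hδ.smooth.continuousOn (t, 0) ⟨ht, h0⟩
  have hev := hc.preimage_mem_nhdsWithin (φ.open_source.mem_nhds hs)
  obtain ⟨ρ', hρ', hball⟩ := Metric.mem_nhdsWithin_iff.1 hev
  set ρ := min ρ' ε with hρdef
  have hρ : 0 < ρ := lt_min hρ' hδ.pos
  have hJ : Set.Ioo (-ρ) ρ ⊆ Set.Icc (-ε) ε := fun s hs =>
    ⟨by linarith [hs.1, min_le_right ρ' ε], by linarith [hs.2, min_le_right ρ' ε]⟩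
  -- Even when `t` is `a` or `b` the interval is nondegenerate; convexity then gives unique
  -- derivatives and density of the interior.
  have hI : (interior (Set.Icc a b ∩ Set.Ioo (t - ρ) (t + ρ))).Nonempty := by
    have hlt : max a (t - ρ) < min b (t + ρ) := by
      rw [lt_min_iff, max_lt_iff, max_lt_iff]
      exact ⟨⟨hab, by linarith [ht.2]⟩, by linarith [ht.1], by linarith⟩
    refine (Set.nonempty_Ioo.2 hlt).mono (interior_maximal (fun x hx => ?_) isOpen_Ioo)
    obtain ⟨h1, h2⟩ := hx
    rw [max_lt_iff] at h1
    rw [lt_min_iff] at h2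
    exact ⟨⟨h1.1.le, h2.1.le⟩, h1.2, h2.2⟩
  have hIc : Convex ℝ (Set.Icc a b ∩ Set.Ioo (t - ρ) (t + ρ)) :=
    (convex_Icc a b).inter (convex_Ioo _ _)
  have hSc : Convex ℝ ((Set.Icc a b ∩ Set.Ioo (t - ρ) (t + ρ)) ×ˢ Set.Ioo (-ρ) ρ) :=
    hIc.prod (convex_Ioo _ _)
  refine ⟨ρ, hρ, hJ, uniqueDiffOn_convex hIc hI, isOpen_Ioo, ⟨by linarith, hρ⟩, ?_,
    fun x hx s hs => hδ.subset_dom s (hJ hs) hx.1, fun x hx s hs => ?_,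
    hδ.smooth.mono (Set.prod_mono Set.inter_subset_left hJ)⟩
  · rw [hSc.closure_interior_eq_closure_of_nonempty_interior]
    · exact subset_closure
    · rw [interior_prod_eq]
      exact hI.prod ⟨0, by rw [interior_Ioo]; exact ⟨by linarith, hρ⟩⟩
  · refine hball (a := (x, s)) ⟨?_, hx.1, hJ hs⟩
    rw [Metric.mem_ball, Prod.dist_eq, max_lt_iff, Real.dist_eq, Real.dist_eq, abs_lt, abs_lt]
    have := min_le_left ρ' ε
    exact ⟨⟨by linarith [hx.2.1], by linarith [hx.2.2]⟩, by simp only [sub_zero]; linarith [hs.1],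
      by simp only [sub_zero]; linarith [hs.2]⟩

lemma IsVariation.continuousOn_variationDensity (hδ : IsVariation m γ a b ε δ) (hab : a < b)
    (hβ : IsLepageRepresentative α σ β) : ContinuousOn (variationDensity σ δ) (Set.Icc a b) := by
  intro t ht
  obtain ⟨ρ, hρ, -, hR⟩ := hδ.exists_smoothRectangle hab _ ht
    (mem_chart_source (Coord n) ((δ 0).curve t))
  have hmem : t ∈ Set.Ioo (t - ρ) (t + ρ) := ⟨by linarith, by linarith⟩
  refine (hR.continuousOn_variationDensity (IsManifold.chart_mem_maximalAtlas _) hβ t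
    ⟨ht, hmem⟩).mono_of_mem_nhdsWithin ?_
  exact Filter.inter_mem self_mem_nhdsWithin (mem_nhdsWithin_of_mem_nhds (isOpen_Ioo.mem_nhds hmem))

/-- The first variation formula. -/
theorem IsVariation.hasDerivAt_action (hδ : IsVariation m γ a b ε δ) (hab : a < b)
    (hσ : IsSourceForm σ) (hβ : IsLepageRepresentative α σ β)
    (hloc : ∀ u, ∃ U L, u ∈ U ∧ IsLocalLagrangian r α U L)
    (hm : r ≤ m ∨ IsOfOrderOn m Set.univ α) :
    HasDerivAt (fun s => action α (δ s) a b) (∫ t in a..b, variationDensity σ δ t) 0 := by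
  have hatlas : ∀ t : ℝ, chartAt (Coord n) ((δ 0).curve t) ∈
      IsManifold.maximalAtlas (𝓡 n) ∞ M := fun t => IsManifold.chart_mem_maximalAtlas _
  have hrect : ∀ t ∈ Set.Icc a b, ∃ ρ > 0, Set.Ioo (-ρ) ρ ⊆ Set.Icc (-ε) ε ∧
      IsSmoothRectangle δ (chartAt (Coord n) ((δ 0).curve t))
        (Set.Icc a b ∩ Set.Ioo (t - ρ) (t + ρ)) (Set.Ioo (-ρ) ρ) := fun t ht =>
    hδ.exists_smoothRectangle hab _ ht (mem_chart_source (Coord n) ((δ 0).curve t))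
  obtain ⟨hcont, hderiv⟩ := hasDerivAt_integral_of_contDiffWithinAt
    (f := fun q : ℝ × ℝ => α ((δ q.2).lift k q.1) (fun _ => (δ q.2).velocity k q.1)) hab (by
      intro t ht
      obtain ⟨ρ, hρ, -, hR⟩ := hrect t ht
      have hmem : ((0 : ℝ), t) ∈ Set.Ioo (-ρ) ρ ×ˢ Set.Ioo (t - ρ) (t + ρ) :=
        ⟨⟨by linarith, hρ⟩, by linarith, by linarith⟩
      filter_upwards [(isOpen_Ioo.prod isOpen_Ioo).mem_nhds hmem] with q hq hqI
      refine ((hR.contDiffOn_integrand (hatlas t) hβ (q.2, q.1)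
        ⟨⟨hqI, hq.2⟩, hq.1⟩).of_le ENat.LEInfty.out).mono_of_mem_nhdsWithin ?_
      have hopen : Set.Ioo (t - ρ) (t + ρ) ×ˢ Set.Ioo (-ρ) ρ ∈ 𝓝 (q.2, q.1) :=
        (isOpen_Ioo.prod isOpen_Ioo).mem_nhds ⟨hq.2, hq.1⟩
      filter_upwards [self_mem_nhdsWithin, mem_nhdsWithin_of_mem_nhds hopen] with x h1 h2
      exact ⟨⟨h1.1, h2.1⟩, h2.2⟩)
  have hdens := hδ.continuousOn_variationDensity hab hβ
  -- `boundaryTerm` and `variationDensity` are defined without charts, so the local identities hold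
  -- on all of `[a, b]` and need no subdivision of the interval.
  have hB : ∀ t ∈ Set.Icc a b, HasDerivWithinAt (boundaryTerm β δ)
      (deriv (fun s => α ((δ s).lift k t) (fun _ => (δ s).velocity k t)) 0 -
        variationDensity σ δ t) (Set.Icc a b) t := by
    intro t ht
    obtain ⟨ρ, hρ, -, hR⟩ := hrect t ht
    have hmem : t ∈ Set.Ioo (t - ρ) (t + ρ) := ⟨by linarith, by linarith⟩
    refine (hR.hasDerivWithinAt_boundaryTerm (hatlas t) hβ ⟨ht, hmem⟩).mono_of_mem_nhdsWithin ?_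
    exact Filter.inter_mem self_mem_nhdsWithin
      (mem_nhdsWithin_of_mem_nhds (isOpen_Ioo.mem_nhds hmem))
  have hzero : ∀ t ∈ Set.Icc a b, (∀ s ∈ Set.Icc (-ε) ε, (δ s).lift m t = γ.lift m t) →
      boundaryTerm β δ t = 0 := by
    intro t ht hfix
    obtain ⟨ρ, hρ, hJ, hR⟩ := hrect t ht
    exact hR.boundaryTerm_eq_zero (hatlas t) hσ hβ hloc hm ⟨ht, by linarith, by linarith⟩
      fun s hs => (hfix s (hJ hs)).trans (hfix 0 (hJ hR.zero_mem)).symm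
  have hFTC := intervalIntegral.integral_eq_sub_of_hasDerivAt_of_le hab.le
    (fun t ht => (hB t ht).continuousWithinAt)
    (fun t ht => (hB t (Set.Ioo_subset_Icc_self ht)).hasDerivAt (Icc_mem_nhds ht.1 ht.2))
    ((hcont.sub hdens).intervalIntegrable_of_Icc hab.le)
  rw [hzero a (Set.left_mem_Icc.2 hab.le) hδ.left_fixed,
    hzero b (Set.right_mem_Icc.2 hab.le) hδ.right_fixed, sub_zero,
    intervalIntegral.integral_sub (hcont.intervalIntegrable_of_Icc hab.le)
      (hdens.intervalIntegrable_of_Icc hab.le), sub_eq_zero] at hFTC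
  exact hderiv.congr_deriv hFTC

end FirstVariation

/-! ### Compactly supported variations -/

section Bump

variable {n : ℕ} {M : Type*} [TopologicalSpace M] [ChartedSpace (Coord n) M]
  [IsManifold (𝓡 n) ∞ M] {k r m : ℕ} {γ γ' : LocalSection n M} {t : ℝ}
  {α β : JetForm n M k 1} {σ : JetForm n M k 2} {φ : OpenPartialHomeomorph M (Coord n)}

lemma lift_congr (ht : t ∈ γ.dom) (ht' : t ∈ γ'.dom) (h : γ.curve =ᶠ[𝓝 t] γ'.curve) :
    γ.lift k t = γ'.lift k t := by
  rw [LocalSection.lift_of_mem ht, LocalSection.lift_of_mem ht']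
  refine Quotient.sound ⟨rfl, h.self_of_nhds, fun a _ => ?_⟩
  exact (h.fun_comp _).iteratedDeriv_eq a

/-- Along the section `σ_i` is an antisymmetrised derivative of the smooth covector field of `β`,
evaluated on vectors that vary continuously. -/
lemma continuousAt_sourceCoeff (hφ : φ ∈ IsManifold.maximalAtlas (𝓡 n) ∞ M) (hk : 1 ≤ k)
    (hσ : IsSourceForm σ) (hβ : IsLepageRepresentative α σ β) (ht : t ∈ γ.dom)
    (hs : γ.curve t ∈ φ.source) (i : Fin n) :
    ContinuousAt (fun s => sourceCoeff φ hφ σ i (γ.lift k s)) t := by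
  have hy := LocalSection.contDiffAt_coord hφ ht hs
  have hz : ContinuousAt (prolong k (coordCurve φ γ)) t := (contDiffAt_prolong hy).continuousAt
  have hV : ContinuousAt (fun s => contactVec (prolong k (coordCurve φ γ) s)
      (iteratedDeriv (k + 1) (coordCurve φ γ) s)) t := by
    simp only [contactVec_prolong]
    exact continuousAt_const.prodMk
      (continuousAt_pi.2 fun a => (contDiffAt_iteratedDeriv hy (a + 1)).continuousAt)
  have hD : ContinuousAt (fun s => fderiv ℝ (coordCovec hφ β) (prolong k (coordCurve φ γ) s)) t :=
    ((contDiffAt_coordCovec hφ hβ.smooth (prolong_mem_target hφ ht hs)).fderiv_right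
      (m := ∞) (by simp)).continuousAt.comp hz
  have hmain := ((hD.clm_apply (continuousAt_const (y := partialVec i 0))).clm_apply hV).sub
    ((hD.clm_apply hV).clm_apply (continuousAt_const (y := partialVec i 0)))
  refine hmain.congr ?_
  filter_upwards [LocalSection.eventually_mem ht hs] with s h
  rw [sourceCoeff_eq hφ hk hσ i (LocalSection.lift_mem_source hφ h.1 h.2)
    (iteratedDeriv (k + 1) (coordCurve φ γ) s), LocalSection.adaptedChart_lift hφ h.1 h.2]
  exact (hβ.source_eq hφ (prolong_mem_target hφ h.1 h.2) _ _).symm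

/-- The section `t ↦ φ⁻¹(φ(γ(t)) + s χ(t) v)`. -/
def perturbedSection (hφ : φ ∈ IsManifold.maximalAtlas (𝓡 n) ∞ M) (γ : LocalSection n M)
    (O : Set ℝ) (hO : IsOpen O) (hOc : O.OrdConnected) (hOγ : O ⊆ γ.dom)
    (hOφ : ∀ t ∈ O, γ.curve t ∈ φ.source) {χ : ℝ → ℝ} (hχ : ContDiff ℝ ∞ χ) (v : Coord n) (s : ℝ)
    (hs : ∀ t ∈ O, φ (γ.curve t) + (s * χ t) • v ∈ φ.target) : LocalSection n M where
  dom := O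
  isOpen_dom := hO
  ordConnected_dom := hOc
  curve t := φ.symm (φ (γ.curve t) + (s * χ t) • v)
  smooth := by
    refine (contMDiffOn_symm_of_mem_maximalAtlas hφ).comp (ContDiffOn.contMDiffOn ?_) hs
    have hy : ContDiffOn ℝ ∞ (fun t => φ (γ.curve t)) O := fun t ht =>
      (LocalSection.contDiffAt_coord hφ (hOγ ht) (hOφ t ht)).contDiffWithinAt
    exact hy.add ((contDiff_const.mul hχ).smul contDiff_const).contDiffOn

/-- A section which satisfies the variational principle is a zero of the coefficients `σ_i`. -/
lemma sourceCoeff_eq_zero_of_variationalPrinciple (hφ : φ ∈ IsManifold.maximalAtlas (𝓡 n) ∞ M)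
    (hk : 1 ≤ k) (hσ : IsSourceForm σ) (hβ : IsLepageRepresentative α σ β)
    (hloc : ∀ u, ∃ U L, u ∈ U ∧ IsLocalLagrangian r α U L)
    (hm : r ≤ m ∨ IsOfOrderOn m Set.univ α) (hγ : SatisfiesVariationalPrinciple m α γ)
    {t₀ : ℝ} (ht : t₀ ∈ γ.dom) (hs : γ.curve t₀ ∈ φ.source) (i : Fin n) :
    sourceCoeff φ hφ σ i (γ.lift k t₀) = 0 := by
  by_contra hne
  set c := sourceCoeff φ hφ σ i (γ.lift k t₀) with hc
  have hpos : ∀ᶠ s in 𝓝 t₀, 0 < c * sourceCoeff φ hφ σ i (γ.lift k s) := by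
    have h := (continuousAt_const (y := c)).mul (continuousAt_sourceCoeff hφ hk hσ hβ ht hs i)
    exact h.eventually_const_lt (mul_self_pos.2 hne)
  obtain ⟨ρ, hρ, hball⟩ := Metric.eventually_nhds_iff_ball.1
    ((LocalSection.eventually_mem ht hs).and hpos)
  rw [Real.ball_eq_Ioo] at hball
  set O := Set.Ioo (t₀ - ρ) (t₀ + ρ) with hOdef
  have hOγ : O ⊆ γ.dom := fun s hs => (hball s hs).1.1
  have hOφ : ∀ s ∈ O, γ.curve s ∈ φ.source := fun s hs => (hball s hs).1.2
  -- The support has radius `ρ / 4`, well inside the interval of radius `ρ / 2` used for the action,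
  -- so all jets at its ends are fixed.
  let χ : ContDiffBump t₀ := ⟨ρ / 8, ρ / 4, by linarith, by linarith⟩
  have hχ0 : ∀ s, ρ / 4 ≤ |s - t₀| → χ s = 0 := fun s hs =>
    χ.zero_of_le_dist (by rw [Real.dist_eq]; exact hs)
  -- The factor `c`, the value of `σ_i` at `t₀`, makes the density positive at `t₀` whatever its
  -- sign.
  let v : Coord n := EuclideanSpace.single i c
  have hyc : ∀ s ∈ O, ContinuousAt (fun s => φ (γ.curve s)) s := fun s hs =>
    (LocalSection.contDiffAt_coord hφ (hOγ hs) (hOφ s hs)).continuousAt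
  have hK : Metric.closedBall t₀ (ρ / 4) ⊆ O := by
    rw [Real.closedBall_eq_Icc]
    exact fun s hs => ⟨by linarith [hs.1], by linarith [hs.2]⟩
  have htarget : ∀ᶠ s in 𝓝 (0 : ℝ), ∀ x ∈ Metric.closedBall t₀ (ρ / 4),
      φ (γ.curve x) + (s * χ x) • v ∈ φ.target := by
    refine (isCompact_closedBall t₀ (ρ / 4)).eventually_forall_of_forall_eventually fun x hx => ?_
    have h1 : ContinuousAt (fun q : ℝ × ℝ => φ (γ.curve q.2) + (q.1 * χ q.2) • v) (0, x) :=
      (ContinuousAt.comp (f := Prod.snd) (x := ((0 : ℝ), x)) (hyc x (hK hx)) continuousAt_snd).add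
        (((continuous_fst.mul (χ.continuous.comp continuous_snd)).smul
          continuous_const).continuousAt)
    refine h1.preimage_mem_nhds (φ.open_target.mem_nhds ?_)
    simpa using φ.map_source (hOφ x (hK hx))
  obtain ⟨ε', hε', hε'b⟩ := Metric.eventually_nhds_iff_ball.1 htarget
  set ε := ε' / 2 with hεdef
  have hε : 0 < ε := by positivity
  have hεle : -ε ≤ ε := by linarith
  have htgt : ∀ s ∈ Set.Icc (-ε) ε, ∀ x ∈ O, φ (γ.curve x) + (s * χ x) • v ∈ φ.target := by
    intro s hs x hx
    by_cases hxK : x ∈ Metric.closedBall t₀ (ρ / 4)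
    · refine hε'b s ?_ x hxK
      rw [Real.ball_eq_Ioo]
      exact ⟨by linarith [hs.1], by linarith [hs.2]⟩
    · rw [Metric.mem_closedBall, Real.dist_eq, not_le] at hxK
      simpa [hχ0 x hxK.le] using φ.map_source (hOφ x hx)
  -- A family needs a section for every real `s`; clamping to `[-ε, ε]` keeps the curve in the chart
  -- target and changes nothing near 0.
  let δ : ℝ → LocalSection n M := fun s =>
    perturbedSection hφ γ O isOpen_Ioo Set.ordConnected_Ioo hOγ hOφ χ.contDiff v
      (Set.projIcc (-ε) ε hεle s) (htgt _ (Set.projIcc (-ε) ε hεle s).2)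
  have hδc : ∀ s ∈ Set.Icc (-ε) ε, ∀ x, (δ s).curve x = φ.symm (φ (γ.curve x) + (s * χ x) • v) := by
    intro s hs x
    change φ.symm (φ (γ.curve x) + ((Set.projIcc (-ε) ε hεle s : ℝ) * χ x) • v) = _
    rw [Set.projIcc_of_mem hεle hs]
  have h0 : (0 : ℝ) ∈ Set.Icc (-ε) ε := ⟨by linarith, hε.le⟩
  have hδγ : ∀ s, ∀ x ∈ O, χ x = 0 → (δ s).curve x = γ.curve x := by
    intro s x hx hx0
    change φ.symm (φ (γ.curve x) + ((Set.projIcc (-ε) ε hεle s : ℝ) * χ x) • v) = _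
    rw [hx0, mul_zero, zero_smul, add_zero, φ.left_inv (hOφ x hx)]
  have hδ0 : ∀ x ∈ O, (δ 0).curve x = γ.curve x := by
    intro x hx
    rw [hδc 0 h0, zero_mul, zero_smul, add_zero, φ.left_inv (hOφ x hx)]
  set a := t₀ - ρ / 2 with hadef
  set b := t₀ + ρ / 2 with hbdef
  have hab : a < b := by linarith
  have hsubO : Set.Icc a b ⊆ O := fun x hx => ⟨by linarith [hx.1], by linarith [hx.2]⟩
  have hfix : ∀ s, ∀ x ∈ O, ρ / 4 < |x - t₀| → (δ s).lift m x = γ.lift m x := by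
    intro s x hx hxd
    refine lift_congr (show x ∈ O from hx) (hOγ hx) ?_
    have hopen : IsOpen {x : ℝ | ρ / 4 < |x - t₀|} := isOpen_lt continuous_const (by fun_prop)
    filter_upwards [isOpen_Ioo.mem_nhds hx, hopen.mem_nhds hxd] with x' h1 h2
    exact hδγ s x' h1 (hχ0 x' h2.le)
  have hvar : IsVariation m γ a b ε δ := by
    refine ⟨hε, fun s _ => hsubO, ?_, fun x hx => hδ0 x (hsubO hx), fun s _ => ?_, fun s _ => ?_⟩
    · have hsm : ContDiffOn ℝ ∞ (fun q : ℝ × ℝ => φ (γ.curve q.1) + (q.2 * χ q.1) • v)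
          (Set.Icc a b ×ˢ Set.Icc (-ε) ε) := by
        have h1 : ContDiffOn ℝ ∞ (fun q : ℝ × ℝ => φ (γ.curve q.1))
            (Set.Icc a b ×ˢ Set.Icc (-ε) ε) := fun q hq =>
          ((LocalSection.contDiffAt_coord hφ (hOγ (hsubO hq.1)) (hOφ _ (hsubO hq.1))).comp q
            contDiffAt_fst).contDiffWithinAt
        exact h1.add ((contDiff_snd.mul (χ.contDiff.comp contDiff_fst)).smul
          contDiff_const).contDiffOn
      exact ((contMDiffOn_symm_of_mem_maximalAtlas hφ).comp hsm.contMDiffOn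
        fun q hq => htgt q.2 hq.2 q.1 (hsubO hq.1)).congr fun q hq => hδc q.2 hq.2 q.1
    · refine hfix s a (hsubO (Set.left_mem_Icc.2 hab.le)) ?_
      rw [hadef, show t₀ - ρ / 2 - t₀ = -(ρ / 2) by ring, abs_neg, abs_of_pos (by linarith)]
      linarith
    · refine hfix s b (hsubO (Set.right_mem_Icc.2 hab.le)) ?_
      rw [hbdef, show t₀ + ρ / 2 - t₀ = ρ / 2 by ring, abs_of_pos (by linarith)]
      linarith
  have hzero := (hvar.hasDerivAt_action hab hσ hβ hloc hm).unique
    (hγ a b hab (hsubO.trans hOγ) ε δ hvar)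
  -- The density is nonnegative on `[a, b]`, positive at `t₀` and continuous, so its integral cannot
  -- be zero.
  have hdens : ∀ x ∈ Set.Icc a b, variationDensity σ δ x =
      χ x * (c * sourceCoeff φ hφ σ i (γ.lift k x)) := by
    intro x hx
    have hxO := hsubO hx
    obtain ⟨η, hη, -, hR⟩ := hvar.exists_smoothRectangle hab φ hx
      (by rw [hδ0 x hxO]; exact hOφ x hxO)
    rw [hR.variationDensity_eq_sum hφ hk hσ ⟨hx, by linarith, by linarith⟩]
    have hder : deriv (fun s => φ ((δ s).curve x)) 0 = χ x • v := by
      have h1 : (fun s => φ ((δ s).curve x)) =ᶠ[𝓝 0]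
          fun s => φ (γ.curve x) + (s * χ x) • v := by
        filter_upwards [Icc_mem_nhds (show -ε < 0 by linarith) hε] with s hs
        rw [hδc s hs, φ.right_inv (htgt s hs x hxO)]
      have h2 : HasDerivAt (fun s : ℝ => φ (γ.curve x) + (s * χ x) • v) (χ x • v) 0 := by
        simpa using (((hasDerivAt_id (0 : ℝ)).mul_const (χ x)).smul_const v).const_add
          (φ (γ.curve x))
      rw [h1.deriv_eq, h2.deriv]
    have hlift : (δ 0).lift k x = γ.lift k x := by
      refine lift_congr (show x ∈ O from hxO) (hOγ hxO) ?_
      filter_upwards [isOpen_Ioo.mem_nhds hxO] with x' hx' using hδ0 x' hx'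
    rw [hder, hlift, Finset.sum_eq_single i (fun j _ hj => by simp [v, hj]) (by simp)]
    simp [v]
    ring
  have hposint : 0 < ∫ x in a..b, variationDensity σ δ x := by
    refine intervalIntegral.integral_pos hab (hvar.continuousOn_variationDensity hab hβ)
      (fun x hx => ?_) ⟨t₀, ⟨by linarith, by linarith⟩, ?_⟩
    · rw [hdens x (Set.Ioc_subset_Icc_self hx)]
      exact mul_nonneg χ.nonneg (hball x (hsubO (Set.Ioc_subset_Icc_self hx))).2.le
    · have ht₀ : t₀ ∈ Set.Icc a b := ⟨by linarith, by linarith⟩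
      rw [hdens t₀ ht₀, χ.one_of_mem_closedBall (Metric.mem_closedBall_self (by positivity)),
        one_mul]
      exact (hball t₀ (hsubO ht₀)).2
  exact hposint.ne' hzero

end Bump

end JetVar

end

/-! ### The theorem -/

theorem mainTheorem4 {n : ℕ} {M : Type*} [TopologicalSpace M] [ChartedSpace (Coord n) M]
    [IsManifold (𝓡 n) ∞ M] (k r m : ℕ) (hk : 1 ≤ k) (hr : 2 * r ≤ k)
    (α : JetForm n M k 1) (hα : SmoothOn α Set.univ)
    (hloc : ∀ u, ∃ U L, u ∈ U ∧ IsLocalLagrangian r α U L)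
    (hm : r ≤ m ∨ IsOfOrderOn m Set.univ α)
    (σ : JetForm n M k 2) (hσ : SmoothOn σ Set.univ) (hsource : IsSourceForm σ)
    (hclass : VariationallyEquivalentOn Set.univ σ (extD α))
    (γ : LocalSection n M) :
    (SatisfiesVariationalPrinciple m α γ ↔
      ∀ t ∈ γ.dom, interiorProduct σ (γ.lift k t) (γ.velocity k t) = 0) ∧
    (∀ t ∈ γ.dom, ∀ (φ : OpenPartialHomeomorph M (Coord n))
      (hφ : φ ∈ IsManifold.maximalAtlas (𝓡 n) ∞ M), γ.curve t ∈ φ.source →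
        (interiorProduct σ (γ.lift k t) (γ.velocity k t) = 0 ↔
          ∀ i, sourceCoeff φ hφ σ i (γ.lift k t) = 0) ∧
        ∀ U L, IsLocalLagrangian r α U L → γ.lift k t ∈ U →
          ∀ i, sourceCoeff φ hφ σ i (γ.lift k t) = eulerLagrange φ hφ L γ i t) := by
  obtain ⟨β, hβ⟩ := exists_lepageRepresentative hα hclass
  refine ⟨⟨fun hγ t ht => ?_, fun hEL a b hab hsub ε δ hδ => ?_⟩, fun t ht φ hφ hs =>
    ⟨interiorProduct_velocity_eq_zero_iff hφ hk hsource ht hs, fun U L hL hU i =>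
      sourceCoeff_eq_eulerLagrange hφ hk hsource hβ hL ht hs hU i⟩⟩
  · have hφ := IsManifold.chart_mem_maximalAtlas (I := 𝓡 n) (n := ∞) (γ.curve t)
    have hs := mem_chart_source (Coord n) (γ.curve t)
    exact (interiorProduct_velocity_eq_zero_iff hφ hk hsource ht hs).2 fun i =>
      sourceCoeff_eq_zero_of_variationalPrinciple hφ hk hsource hβ hloc hm hγ ht hs i
  · refine (hδ.hasDerivAt_action hab hsource hβ hloc hm).congr_deriv ?_
    -- Only the open interval is treated: there `δ 0` and `γ` agree on a neighbourhood of each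
    -- point, hence have the same jets. The two ends do not affect the integral.
    have hzero : Set.EqOn (variationDensity σ δ) (fun _ => 0) (Set.Ioo a b) := by
      intro t ht
      have htI : t ∈ Set.Icc a b := Set.Ioo_subset_Icc_self ht
      have h0 : (0 : ℝ) ∈ Set.Icc (-ε) ε := ⟨by linarith [hδ.pos], hδ.pos.le⟩
      have hφ := IsManifold.chart_mem_maximalAtlas (I := 𝓡 n) (n := ∞) (γ.curve t)
      have hs := mem_chart_source (Coord n) (γ.curve t)
      obtain ⟨ρ, hρ, -, hR⟩ := hδ.exists_smoothRectangle hab (chartAt (Coord n) (γ.curve t)) htI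
        (by rw [hδ.start t htI]; exact hs)
      have hlift : (δ 0).lift k t = γ.lift k t := by
        refine lift_congr (hδ.subset_dom 0 h0 htI) (hsub htI) ?_
        filter_upwards [Icc_mem_nhds ht.1 ht.2] with x hx using hδ.start x hx
      rw [hR.variationDensity_eq_sum hφ hk hsource ⟨htI, by linarith, by linarith⟩, hlift]
      refine Finset.sum_eq_zero fun i _ => ?_
      rw [(interiorProduct_velocity_eq_zero_iff hφ hk hsource (hsub htI) hs).1
        (hEL t (hsub htI)) i, mul_zero]
    rw [intervalIntegral.integral_of_le hab.le, MeasureTheory.integral_Ioc_eq_integral_Ioo,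
      MeasureTheory.setIntegral_congr_fun measurableSet_Ioo hzero]
    simp
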